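/- Let $K$ be a field of characteristic $0$, let $q\in K$ with $q\neq 0$, $q^2\neq -1$, and let $M,N\ge 1$. Put $$\hat R_n=q\sum_i e^i_i\otimes e^i_i+\sum_{i\ne j}e^j_i\otimes e^i_j+(q-q^{-1})\sum_{i<j}e^i_i\otimes e^j_j$$ (the braid matrix of $SL_q(n)$; $e^i_j$ is the $n\times n$ matrix unit with $1$ in row $i$, column $j$), and let ${\cal P}^S_n=\frac{\hat R_n+q^{-1}}{q+q^{-1}}$, ${\cal P}^A_n=\frac{q-\hat R_n}{q+q^{-1}}$, so that $\hat R_n=q{\cal P}_n^S-q^{-1}{\cal P}_n^A$. With collective indices $A=(\alpha,a)$, $1\le\alpha\le M$, $1\le a\le N$, let $\hat{\sf R}_\pm=\hat R_M^{\pm1}\otimes\hat R_N$, ${\sf P}^-={\cal P}^S_M\otimes{\cal P}^A_N+{\cal P}^A_M\otimes{\cal P}^S_N$ and ${\sf P}^+={\cal P}^A_M\otimes{\cal P}^A_N+{\cal P}^S_M\otimes{\cal P}^S_N$. Then: 1. There are the projector decompositions (mutually orthogonal idempotents with sum $1$) $\hat{\sf R}_+=-{\sf P}^-+q^2\,{\cal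 P}^S_M\otimes{\cal P}^S_N+q^{-2}\,{\cal P}^A_M\otimes{\cal P}^A_N$ and $\hat{\sf R}_-={\sf P}^+-q^2\,{\cal P}^A_M\otimes{\cal P}^S_N-q^{-2}\,{\cal P}^S_M\otimes{\cal P}^A_N$. 2. Let ${\cal A}^q_+$ (the $q$-Weyl algebra) be the unital $K$-algebra generated by $A^+_A,A^A$ with relations (summation over repeated indices) $$({\sf P}^-)^{CD}_{AB}A^+_CA^+_D=0,\quad ({\sf P}^-)^{AB}_{CD}A^DA^C=0,\quad A^AA^+_B-\delta^A_B{\bf 1}-(\hat{\sf R}_+)^{AC}_{BD}A^+_CA^D=0,$$ and let ${\cal A}^q_-$ (the $q$-Clifford algebra) be the one with relations $$({\sf P}^+)^{CD}_{AB}A^+_CA^+_D=0,\quad ({\sf P}^+)^{AB}_{CD}A^DA^C=0,\quad A^AA^+_B-\delta^A_B{\bf 1}+(\hat{\sf R}_-)^{AC}_{BD}A^+_CA^D=0.$$ Both are $GL_q(M)\times SL_q(N)$-covariant. That is, let $H=Fun(GL_q(M)\times SL_q(N))$ be the algebra generated by $T^\alpha_\beta$, $t^{\pm1}$ and $T^a_b$,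 where $(T^\alpha_\beta)$ and $(T^a_b)$ satisfy $\hat R^{ij}_{hk}T^h_lT^k_m=T^i_hT^j_k\hat R^{hk}_{lm}$ with $\hat R=\hat R_M$ and $\hat R=\hat R_N$ respectively, the $T^\alpha_\beta$ commute with the $T^a_b$, $\det_q(T^\alpha_\beta)=t$ is central and invertible, and $\det_q(T^a_b)=1$ (here $\det_qT=\sum_\sigma(-q)^{\ell(\sigma)}T^1_{\sigma(1)}\cdots T^n_{\sigma(n)}$). Then $H$ is a Hopf algebra with $\Delta(T^i_j)=T^i_h\otimes T^h_j$, $\varepsilon(T^i_j)=\delta^i_j$ on both families of generators, with antipode $S$; and, with $T^A_B=T^\alpha_\beta T^a_b$, each of ${\cal A}^q_\pm$ is a right $H$-comodule algebra through an algebra homomorphism ${\cal A}^q_\pm\to{\cal A}^q_\pm\otimes H$ with $A^+_A\mapsto A^+_B\otimes T^B_A$ and $A^A\mapsto A^B\otimes S(T^A_B)$. 3. ${\cal A}^q_+$ and ${\cal A}^q_-$ have the same Poincaré series as their classical counterparts, the Weyl (upper sign) and Clifford (lower sign) algebras generated by $a^+_A,a^A$ with relations $$a^+_Aa^+_B\mp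 a^+_Ba^+_A=0,\quad a^Aa^B\mp a^Ba^A=0,\quad a^Aa^+_B-\delta^A_B{\bf 1}\mp a^+_Ba^A=0.$$ Here the Poincaré series is $\sum_{n\ge0}\dim(F_n/F_{n-1})\,t^n$, with $F_n$ the span of all words of length at most $n$ in the generators and $F_{-1}=0$. -/

import Mathlib

open scoped TensorProduct

noncomputable section

namespace QHeis

/-! ### Braid matrices and projectors.
Matrix entries `X (i, j) (h, k)` are the numbers usually written with upper indices `i j` and lower
indices `h k`. -/

section Braid

variable {K : Type*} [Field K]

/-- The braid matrix of `SL_q(n)`: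
`q ∑ e^i_i ⊗ e^i_i + ∑_{i ≠ j} e^j_i ⊗ e^i_j + (q - q⁻¹) ∑_{i < j} e^i_i ⊗ e^j_j`,
where `e^i_j` is the matrix unit with a `1` in row `i` and column `j`. -/
def Rhat (q : K) (n : ℕ) : Matrix (Fin n × Fin n) (Fin n × Fin n) K :=
  q • ∑ i, Matrix.kronecker (Matrix.single i i 1) (Matrix.single i i 1)
    + ∑ i, ∑ j, (if i ≠ j then
        Matrix.kronecker (Matrix.single j i 1) (Matrix.single i j 1) else 0)
    + (q - q⁻¹) • ∑ i, ∑ j, (if i < j then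
        Matrix.kronecker (Matrix.single i i 1) (Matrix.single j j 1) else 0)

/-- The deformed symmetric projector: spectral projector of `Rhat` for the eigenvalue `q`. -/
def PS (q : K) (n : ℕ) : Matrix (Fin n × Fin n) (Fin n × Fin n) K :=
  (q + q⁻¹)⁻¹ • (Rhat q n + q⁻¹ • 1)

/-- The deformed antisymmetric projector: spectral projector of `Rhat` for the eigenvalue
`-q⁻¹`. -/
def PA (q : K) (n : ℕ) : Matrix (Fin n × Fin n) (Fin n × Fin n) K :=
  (q + q⁻¹)⁻¹ • (q • 1 - Rhat q n)

/-- Collective indices `A = (α, a)`. -/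
abbrev Idx (M N : ℕ) : Type := Fin M × Fin N

/-- `(X ⊗ Y)^{AB}_{CD} = X^{αβ}_{γδ} Y^{ab}_{cd}` with
`A = (α, a)`, `B = (β, b)`, `C = (γ, c)`, `D = (δ, d)`. -/
def tens {M N : ℕ} (X : Matrix (Fin M × Fin M) (Fin M × Fin M) K)
    (Y : Matrix (Fin N × Fin N) (Fin N × Fin N) K) :
    Matrix (Idx M N × Idx M N) (Idx M N × Idx M N) K :=
  Matrix.of fun U L =>
    X (U.1.1, U.2.1) (L.1.1, L.2.1) * Y (U.1.2, U.2.2) (L.1.2, L.2.2)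

/-- `R̂_M ⊗ R̂`. -/
def RPlus (q : K) (M N : ℕ) : Matrix (Idx M N × Idx M N) (Idx M N × Idx M N) K :=
  tens (Rhat q M) (Rhat q N)

/-- `R̂_M⁻¹ ⊗ R̂`. -/
def RMinus (q : K) (M N : ℕ) : Matrix (Idx M N × Idx M N) (Idx M N × Idx M N) K :=
  tens (Rhat q M)⁻¹ (Rhat q N)

/-- The antisymmetric projector `P_M^S ⊗ P^A + P_M^A ⊗ P^S`. -/
def PMinus (q : K) (M N : ℕ) : Matrix (Idx M N × Idx M N) (Idx M N × Idx M N) K :=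
  tens (PS q M) (PA q N) + tens (PA q M) (PS q N)

/-- The symmetric projector `P_M^A ⊗ P^A + P_M^S ⊗ P^S`. -/
def PPlus (q : K) (M N : ℕ) : Matrix (Idx M N × Idx M N) (Idx M N × Idx M N) K :=
  tens (PA q M) (PA q N) + tens (PS q M) (PS q N)

/-- A triple of mutually orthogonal idempotents with sum `1`. -/
structure IsProjectorTriple {ι : Type*} [Fintype ι] [DecidableEq ι] (P Q R : Matrix ι ι K) :
    Prop where
  idem₁ : P * P = P
  idem₂ : Q * Q = Q
  idem₃ : R * R = R
  orth₁₂ : P * Q = 0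
  orth₂₁ : Q * P = 0
  orth₁₃ : P * R = 0
  orth₃₁ : R * P = 0
  orth₂₃ : Q * R = 0
  orth₃₂ : R * Q = 0
  sum_eq_one : P + Q + R = 1

end Braid

/-! ### Deformed and classical Heisenberg algebras -/

/-- Generators: `cr A` stands for `A⁺_A` (lower index), `an A` for `A^A` (upper index). -/
inductive HGen (I : Type) : Type
  | cr (A : I) : HGen I
  | an (A : I) : HGen I

section Heisenberg

variable {K : Type*} [Field K] {I : Type} [Fintype I] [DecidableEq I]

/-- `A⁺_A` in the free algebra. -/
abbrev fcr (K : Type*) [Field K] {I : Type} (A : I) : FreeAlgebra K (HGen I) :=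
  FreeAlgebra.ι K (HGen.cr A)

/-- `A^A` in the free algebra. -/
abbrev fan (K : Type*) [Field K] {I : Type} (A : I) : FreeAlgebra K (HGen I) :=
  FreeAlgebra.ι K (HGen.an A)

/-- The relations
`P^{CD}_{AB} A⁺_C A⁺_D = 0`, `P^{AB}_{CD} A^D A^C = 0`,
`A^A A⁺_B - δ^A_B 1 - S^{AC}_{BD} A⁺_C A^D = 0`. -/
inductive HeisRel (P S : Matrix (I × I) (I × I) K) :
    FreeAlgebra K (HGen I) → FreeAlgebra K (HGen I) → Prop
  | cr_cr (A B : I) : HeisRel P S (∑ C, ∑ D, P (C, D) (A, B) • (fcr K C * fcr K D)) 0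
  | an_an (A B : I) : HeisRel P S (∑ C, ∑ D, P (A, B) (C, D) • (fan K D * fan K C)) 0
  | an_cr (A B : I) : HeisRel P S
      (fan K A * fcr K B - (if A = B then 1 else 0)
        - ∑ C, ∑ D, S (A, C) (B, D) • (fcr K C * fan K D)) 0

/-- The unital algebra generated by the `A⁺_A`, `A^A` with the relations `HeisRel P S`. -/
abbrev Heis (P S : Matrix (I × I) (I × I) K) : Type _ := RingQuot (HeisRel P S)

/-- The generators of `Heis P S`. -/
def Heis.gen (P S : Matrix (I × I) (I × I) K) (g : HGen I) : Heis P S :=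
  RingQuot.mkAlgHom K (HeisRel P S) (FreeAlgebra.ι K g)

/-- The canonical (anti)commutation relations `a⁺_i a⁺_j ∓ a⁺_j a⁺_i = 0`,
`a^i a^j ∓ a^j a^i = 0`, `a^i a⁺_j - δ^i_j 1 ∓ a⁺_j a^i = 0`, with `∓` written as `- s`:
`s = 1` for the Weyl and `s = -1` for the Clifford algebra. -/
inductive ClassRel (I : Type) [DecidableEq I] (s : K) :
    FreeAlgebra K (HGen I) → FreeAlgebra K (HGen I) → Prop
  | cr_cr (i j : I) : ClassRel I s (fcr K i * fcr K j - s • (fcr K j * fcr K i)) 0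
  | an_an (i j : I) : ClassRel I s (fan K i * fan K j - s • (fan K j * fan K i)) 0
  | an_cr (i j : I) : ClassRel I s
      (fan K i * fcr K j - (if i = j then 1 else 0) - s • (fcr K j * fan K i)) 0

/-- The classical Heisenberg algebra (`s = 1`: Weyl, `s = -1`: Clifford). -/
abbrev Classical (I : Type) [DecidableEq I] (s : K) : Type _ := RingQuot (ClassRel I s)

/-- The generators of the classical Heisenberg algebra. -/
def Classical.gen (I : Type) [DecidableEq I] (s : K) (g : HGen I) : Classical I s :=
  RingQuot.mkAlgHom K (ClassRel I s) (FreeAlgebra.ι K g)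

/-- The `GL_q(M) × SL_q(N)`-covariant `q`-Weyl algebra:
`P⁻ A⁺ A⁺ = 0`, `P⁻ A A = 0`, `A A⁺ - 1 - R̂₊ A⁺ A = 0`. -/
abbrev QWeyl (q : K) (M N : ℕ) : Type _ := Heis (PMinus q M N) (RPlus q M N)

/-- The `GL_q(M) × SL_q(N)`-covariant `q`-Clifford algebra:
`P⁺ A⁺ A⁺ = 0`, `P⁺ A A = 0`, `A A⁺ - 1 + R̂₋ A⁺ A = 0`. -/
abbrev QClifford (q : K) (M N : ℕ) : Type _ := Heis (PPlus q M N) (-RMinus q M N)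

end Heisenberg

/-! ### Poincaré series -/

section Poincare

variable (K : Type*) [Field K] {A : Type*} [Ring A] [Algebra K A] {ι : Type*}

/-- The span of all words of length `< n` in the given generators. -/
def wordFiltration (g : ι → A) (n : ℕ) : Submodule K A :=
  Submodule.span K {x | ∃ l : List ι, l.length < n ∧ x = (l.map g).prod}

/-- The Poincaré series `∑ₙ dim (F_{≤ n} / F_{≤ n-1}) tⁿ`, where `F_{≤ n}` is the span of the words
of length at most `n` in the generators, and `F_{≤ -1} = 0`. -/
def poincareSeries (g : ι → A) : PowerSeries ℕ :=
  PowerSeries.mk fun n =>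
    Module.finrank K (wordFiltration K g (n + 1) ⧸
      (wordFiltration K g n).submoduleOf (wordFiltration K g (n + 1)))

end Poincare

/-! ### The quantum group `GL_q(M) × SL_q(N)` and its comodule algebras -/

/-- Generators of `Fun(GL_q(M) × SL_q(N))`: `gl α β` is `T^α_β`, `sl a b` is `T^a_b`, and `t`,
`tinv` are the quantum determinant of `GL_q(M)` and its inverse. -/
inductive FunGen (M N : ℕ) : Type
  | gl (α β : Fin M) : FunGen M N
  | t : FunGen M N
  | tinv : FunGen M N
  | sl (a b : Fin N) : FunGen M N

section FunAlg

variable {K : Type*} [Field K]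

/-- The quantum determinant `∑_σ (-q)^{ℓ(σ)} T^1_{σ(1)} ⋯ T^n_{σ(n)}`, where `ℓ(σ)` is the number of
inversions of `σ`. -/
def qdet (q : K) {n : ℕ} {A : Type*} [Ring A] [Algebra K A] (T : Matrix (Fin n) (Fin n) A) : A :=
  ∑ σ : Equiv.Perm (Fin n),
    (-q) ^ (Finset.univ.filter fun p : Fin n × Fin n => p.1 < p.2 ∧ σ p.2 < σ p.1).card •
      (List.ofFn fun i => T i (σ i)).prod

/-- `T^α_β` in the free algebra. -/
def fgl (K : Type*) [Field K] (M N : ℕ) : Matrix (Fin M) (Fin M) (FreeAlgebra K (FunGen M N)) :=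
  Matrix.of fun α β => FreeAlgebra.ι K (FunGen.gl α β)

/-- `T^a_b` in the free algebra. -/
def fsl (K : Type*) [Field K] (M N : ℕ) : Matrix (Fin N) (Fin N) (FreeAlgebra K (FunGen M N)) :=
  Matrix.of fun a b => FreeAlgebra.ι K (FunGen.sl a b)

/-- `t` in the free algebra. -/
def ft (K : Type*) [Field K] (M N : ℕ) : FreeAlgebra K (FunGen M N) := FreeAlgebra.ι K FunGen.t

/-- `t⁻¹` in the free algebra. -/
def ftinv (K : Type*) [Field K] (M N : ℕ) : FreeAlgebra K (FunGen M N) :=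
  FreeAlgebra.ι K FunGen.tinv

/-- The relations of `Fun(GL_q(M) × SL_q(N))`: for both factors
`R̂^{ij}_{hk} T^h_l T^k_m = T^i_h T^j_k R̂^{hk}_{lm}`; `det_q = t` central and invertible for
`GL_q(M)`; `det_q = 1` for `SL_q(N)`; the two factors commute. -/
inductive FunRel (q : K) (M N : ℕ) :
    FreeAlgebra K (FunGen M N) → FreeAlgebra K (FunGen M N) → Prop
  | gl_gl (i j l m : Fin M) : FunRel q M N
      (∑ h, ∑ k, Rhat q M (i, j) (h, k) • (fgl K M N h l * fgl K M N k m))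
      (∑ h, ∑ k, Rhat q M (h, k) (l, m) • (fgl K M N i h * fgl K M N j k))
  | sl_sl (i j l m : Fin N) : FunRel q M N
      (∑ h, ∑ k, Rhat q N (i, j) (h, k) • (fsl K M N h l * fsl K M N k m))
      (∑ h, ∑ k, Rhat q N (h, k) (l, m) • (fsl K M N i h * fsl K M N j k))
  | gl_sl (α β : Fin M) (a b : Fin N) : FunRel q M N
      (fgl K M N α β * fsl K M N a b) (fsl K M N a b * fgl K M N α β)
  | det_gl : FunRel q M N (qdet q (fgl K M N)) (ft K M N)
  | det_sl : FunRel q M N (qdet q (fsl K M N)) 1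
  | t_tinv : FunRel q M N (ft K M N * ftinv K M N) 1
  | tinv_t : FunRel q M N (ftinv K M N * ft K M N) 1
  | t_central (g : FunGen M N) : FunRel q M N
      (ft K M N * FreeAlgebra.ι K g) (FreeAlgebra.ι K g * ft K M N)

/-- The algebra `Fun(GL_q(M) × SL_q(N))`. -/
abbrev FunAlg (q : K) (M N : ℕ) : Type _ := RingQuot (FunRel q M N)

/-- The generators of `Fun(GL_q(M) × SL_q(N))`. -/
def FunAlg.gen (q : K) (M N : ℕ) (g : FunGen M N) : FunAlg q M N :=
  RingQuot.mkAlgHom K (FunRel q M N) (FreeAlgebra.ι K g)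

/-- The collective generators `T^A_B = T^α_β T^a_b` with `A = (α, a)`, `B = (β, b)`. -/
def FunAlg.T (q : K) (M N : ℕ) (A B : Idx M N) : FunAlg q M N :=
  FunAlg.gen q M N (FunGen.gl A.1 B.1) * FunAlg.gen q M N (FunGen.sl A.2 B.2)

end FunAlg

section Hopf

variable {K : Type*} [Field K] {H : Type*} [Ring H] [Algebra K H]

/-- `Δ`, `ε`, `S` make the algebra `H` a Hopf algebra. -/
structure IsHopf (Δ : H →ₐ[K] H ⊗[K] H) (ε : H →ₐ[K] K) (S : H →ₗ[K] H) : Prop where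
  coassoc : (Algebra.TensorProduct.assoc K K K H H H).toAlgHom.comp
      ((Algebra.TensorProduct.map Δ (AlgHom.id K H)).comp Δ)
    = (Algebra.TensorProduct.map (AlgHom.id K H) Δ).comp Δ
  rTensor_counit : ∀ x, Algebra.TensorProduct.map ε (AlgHom.id K H) (Δ x) = 1 ⊗ₜ[K] x
  lTensor_counit : ∀ x, Algebra.TensorProduct.map (AlgHom.id K H) ε (Δ x) = x ⊗ₜ[K] 1
  antipode_left : ∀ x, LinearMap.mul' K H (S.rTensor H (Δ x)) = algebraMap K H (ε x)
  antipode_right : ∀ x, LinearMap.mul' K H (S.lTensor H (Δ x)) = algebraMap K H (ε x)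

/-- The algebra homomorphism `φ : A → A ⊗ H` is a right coaction, so that it makes `A` a right
comodule algebra of the bialgebra `(H, Δ, ε)`. -/
structure IsCoaction (Δ : H →ₐ[K] H ⊗[K] H) (ε : H →ₐ[K] K)
    {A : Type*} [Ring A] [Algebra K A] (φ : A →ₐ[K] A ⊗[K] H) : Prop where
  coassoc : (Algebra.TensorProduct.assoc K K K A H H).toAlgHom.comp
      ((Algebra.TensorProduct.map φ (AlgHom.id K H)).comp φ)
    = (Algebra.TensorProduct.map (AlgHom.id K A) Δ).comp φ
  counit : ∀ x, Algebra.TensorProduct.map (AlgHom.id K A) ε (φ x) = x ⊗ₜ[K] 1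

end Hopf

/-- `Heis P S` is `GL_q(M) × SL_q(N)`-covariant: `A⁺_A ↦ A⁺_B ⊗ T^B_A` and
`A^A ↦ A^B ⊗ S(T^A_B)` define the structure of a right comodule algebra of
`Fun(GL_q(M) × SL_q(N))`. -/
def IsCovariant {K : Type*} [Field K] (q : K) (M N : ℕ)
    (Δ : FunAlg q M N →ₐ[K] FunAlg q M N ⊗[K] FunAlg q M N) (ε : FunAlg q M N →ₐ[K] K)
    (antipode : FunAlg q M N →ₗ[K] FunAlg q M N)
    (P S : Matrix (Idx M N × Idx M N) (Idx M N × Idx M N) K) : Prop :=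
  ∃ φ : Heis P S →ₐ[K] Heis P S ⊗[K] FunAlg q M N,
    IsCoaction Δ ε φ ∧
    (∀ A, φ (Heis.gen P S (HGen.cr A)) =
      ∑ B, Heis.gen P S (HGen.cr B) ⊗ₜ[K] FunAlg.T q M N B A) ∧
    (∀ A, φ (Heis.gen P S (HGen.an A)) =
      ∑ B, Heis.gen P S (HGen.an B) ⊗ₜ[K] antipode (FunAlg.T q M N A B))

end QHeis

end

/-! The braid matrix satisfies the Hecke relation $(\hat R-q)(\hat R+q^{-1})=0$, and $q+q^{-1}\ne
0$, so it is diagonalised by its two projectors. Tensoring the two factors multiplies eigenvalues,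
and this is the projector decomposition: `RPlus` has eigenvalue $-1$ on `PMinus`, and `-RMinus` has
eigenvalue $-1$ on `PPlus`; in both cases the other two eigenvalues are $q^2$ and $q^{-2}$. Hence
the Weyl and Clifford cases are one situation (`IsHeisPair`): a braid matrix $S$ and a polynomial
$P$ in $S$ with $P(1+S)=(1+S)P=0$.

Poincaré series. The classical algebras are the case $q=1$, where $\hat R$ is the flip. It therefore
suffices to give, for every admissible $q$, a basis adapted to the word filtration (`HasPBW`) whose
index set and degrees depend only on $M$ and $N$. All such bases come from `HasPBW.crossedProduct`:
if an exchange rule moves generators of $C$ past those of $B$, and the resulting operators on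
$B\otimes C$ satisfy the relations of the big algebra $E$, then $B\otimes C\to E$ is bijective,
because acting on $1\otimes 1$ inverts it. The relations hold for the operators since a relation
that vanishes on $1\otimes C$ and slides past the generators of $B$ (Yang–Baxter) vanishes
everywhere (`crossOp_relation`).

This is used at three levels. The Heisenberg algebra is the creation algebra `Quad P` tensored with
its opposite (`hasPBW_heis`); here $P(1+S)=(1+S)P=0$ kills the terms produced by $\delta^A_B$. The
creation algebra has the relations $\hat R_M A_1A_2=A_1A_2R'_N$ of quantum matrices, because $P$ is
the square of a multiple of $\hat R_M\otimes 1-1\otimes R'_N$; so it is a braided product of $N$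
copies of a quantum space (`hasPBW_exchange`). That space is a braided product of $M$ algebras in
one generator, $K[x]$ for Weyl and $K[x]/(x^2)$ for Clifford.

Covariance. The quantum determinant is the factor by which the top form of the quantum exterior
algebra is multiplied when $x_j\mapsto\sum_i x_iT^i_j$ (up to transposing $T$). Comparing
coefficients of the top form gives multiplicativity of the determinant, both adjugates, hence an
inverse of $T$, and the determinant of that inverse. These verify the defining relations for
$\Delta$, $\varepsilon$ and $S$; the Hopf axioms need checking only on generators. Finally any
matrix that intertwines $T_1T_2$, in particular any polynomial in the braid matrices, gives
relations preserved by $A^+\mapsto A^+T$, $A\mapsto S(T)A$ (`HeisRelations.coactGen`). -/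

set_option linter.unusedSectionVars false

namespace QHeis

/-! ### The braid matrix of one factor: entries, Hecke relation, spectral projectors -/

section BraidEntries

variable {K : Type*} [Field K]

/-- Diagonal coefficient of the braid matrix. -/
def dcoef (q : K) {n : ℕ} (a b : Fin n) : K :=
  if a = b then q else if a < b then q - q⁻¹ else 0

/-- Off-diagonal coefficient of the braid matrix. -/
def fcoef (K : Type*) [Field K] {n : ℕ} (a b : Fin n) : K := if a = b then 0 else 1

theorem fcoef_comm {n : ℕ} (a b : Fin n) : fcoef K a b = fcoef K b a := by
  simp [fcoef, eq_comm]

theorem ite_kronecker_single_apply {n : ℕ} (p : Prop) [Decidable p] (i j k l a b c d : Fin n) :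
    (if p then Matrix.kronecker (Matrix.single i j (1 : K)) (Matrix.single k l 1) else 0)
      (a, b) (c, d) = if i = a then (if k = b then
        (if p ∧ j = c ∧ l = d then 1 else 0) else 0) else 0 := by
  by_cases h : p
  · rw [if_pos h, show Matrix.kronecker (Matrix.single i j (1 : K)) (Matrix.single k l 1)
      (a, b) (c, d) = Matrix.single i j (1 : K) a c * Matrix.single k l 1 b d from rfl]
    simp only [Matrix.single_apply, h, true_and]
    by_cases h1 : i = a <;> by_cases h2 : k = b <;> by_cases h3 : j = c <;>
      by_cases h4 : l = d <;> simp [h1, h2, h3, h4]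
  · simp [h]

/-- Row $(a,b)$ meets only the columns $(a,b)$ and $(b,a)$. For $a=b$ these coincide, and `fcoef`
vanishes there to avoid counting the entry twice. -/
theorem Rhat_apply (q : K) (n : ℕ) (a b c d : Fin n) :
    Rhat q n (a, b) (c, d) =
      (if c = a ∧ d = b then dcoef q a b else 0) + (if c = b ∧ d = a then fcoef K a b else 0) := by
  have e1 : (∑ i : Fin n, Matrix.kronecker (Matrix.single i i (1 : K)) (Matrix.single i i 1))
      (a, b) (c, d) = if a = b ∧ a = c ∧ b = d then 1 else 0 := by
    have := fun i : Fin n => ite_kronecker_single_apply (K := K) True i i i i a b c d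
    simp only [if_true] at this
    simp only [Matrix.sum_apply, this, Finset.sum_ite_eq', Finset.mem_univ]
    by_cases h : a = b <;> simp [h]
  have e2 : (∑ i : Fin n, ∑ j : Fin n, (if i ≠ j then
        Matrix.kronecker (Matrix.single j i (1 : K)) (Matrix.single i j 1) else 0))
      (a, b) (c, d) = if b ≠ a ∧ b = c ∧ a = d then 1 else 0 := by
    simp only [Matrix.sum_apply, ite_kronecker_single_apply, Finset.sum_ite_eq', Finset.mem_univ,
      if_true]
  have e3 : (∑ i : Fin n, ∑ j : Fin n, (if i < j then
        Matrix.kronecker (Matrix.single i i (1 : K)) (Matrix.single j j 1) else 0))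
      (a, b) (c, d) = if a < b ∧ a = c ∧ b = d then 1 else 0 := by
    simp only [Matrix.sum_apply, ite_kronecker_single_apply]
    rw [Finset.sum_comm]
    simp only [Finset.sum_ite_eq', Finset.mem_univ, if_true]
  simp only [Rhat, Matrix.add_apply, Matrix.smul_apply, e1, e2, e3, dcoef, fcoef, smul_eq_mul,
    @eq_comm _ c a, @eq_comm _ d b, @eq_comm _ c b, @eq_comm _ d a, ne_eq, @eq_comm _ b a]
  by_cases h1 : a = b <;> by_cases h2 : a = c <;> by_cases h3 : b = d <;>
    by_cases h4 : b = c <;> by_cases h5 : a = d <;> by_cases h6 : a < b <;>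
    simp_all

theorem Rhat_symm (q : K) (n : ℕ) (U L : Fin n × Fin n) : Rhat q n U L = Rhat q n L U := by
  obtain ⟨a, b⟩ := U
  obtain ⟨c, d⟩ := L
  rw [Rhat_apply, Rhat_apply]
  by_cases h2 : c = a <;> by_cases h3 : d = b <;>
    by_cases h4 : c = b <;> by_cases h5 : d = a <;> simp_all [fcoef_comm, eq_comm]

variable {V : Type*} [AddCommGroup V] [Module K V]

theorem sum_Rhat_smul (q : K) {n : ℕ} (a b : Fin n) (f : Fin n → Fin n → V) :
    ∑ c, ∑ d, Rhat q n (a, b) (c, d) • f c d = dcoef q a b • f a b + fcoef K a b • f b a := by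
  simp only [Rhat_apply, add_smul, Finset.sum_add_distrib, ite_and, ite_smul, zero_smul]
  simp [Finset.sum_ite_eq']

theorem sum_Rhat_smul' (q : K) {n : ℕ} (a b : Fin n) (f : Fin n → Fin n → V) :
    ∑ c, ∑ d, Rhat q n (c, d) (a, b) • f c d = dcoef q a b • f a b + fcoef K a b • f b a := by
  rw [← sum_Rhat_smul]
  simp only [Rhat_symm q n (a, b)]

theorem Rhat_mulVec (q : K) {n : ℕ} (v : Fin n × Fin n → K) (a b : Fin n) :
    (Rhat q n).mulVec v (a, b) = dcoef q a b * v (a, b) + fcoef K a b * v (b, a) := by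
  simp only [Matrix.mulVec, dotProduct, Fintype.sum_prod_type]
  exact sum_Rhat_smul q a b fun c d => v (c, d)

/-- The Hecke relation: for $a<b$ the block on the index pairs $(a,b)$, $(b,a)$ has trace $q-q^{-1}$
and determinant $-1$, and on $(a,a)$ the matrix is the scalar $q$. -/
theorem Rhat_mul_self {q : K} (hq : q ≠ 0) (n : ℕ) :
    Rhat q n * Rhat q n = (q - q⁻¹) • Rhat q n + 1 := by
  refine Matrix.ext_of_mulVec_single fun ab => ?_
  generalize (Pi.single ab (1 : K) : Fin n × Fin n → K) = v
  funext ⟨c, d⟩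
  simp only [← Matrix.mulVec_mulVec, Matrix.add_mulVec, Matrix.smul_mulVec, Matrix.one_mulVec,
    Pi.add_apply, Pi.smul_apply, smul_eq_mul, Rhat_mulVec]
  rcases lt_trichotomy c d with h | h | h
  · simp [dcoef, fcoef, h, h.ne, h.ne', h.not_gt]
  · subst h; simp [dcoef, fcoef]; field_simp; ring
  · simp [dcoef, fcoef, h, h.ne, h.ne', h.not_gt]

/-- The inverse of the braid matrix. -/
theorem Rhat_mul_sub {q : K} (hq : q ≠ 0) (n : ℕ) :
    Rhat q n * (Rhat q n - (q - q⁻¹) • 1) = 1 := by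
  rw [mul_sub, Rhat_mul_self hq, mul_smul_comm, mul_one]; abel

theorem Rhat_inv {q : K} (hq : q ≠ 0) (n : ℕ) : (Rhat q n)⁻¹ = Rhat q n - (q - q⁻¹) • 1 :=
  Matrix.inv_eq_right_inv (Rhat_mul_sub hq n)

theorem q_add_inv_ne {q : K} (hq : q ≠ 0) (hq2 : q ^ 2 ≠ -1) : q + q⁻¹ ≠ 0 := by
  intro h
  apply hq2
  field_simp at h
  linear_combination h

theorem PS_add_PA {q : K} (hq : q ≠ 0) (hq2 : q ^ 2 ≠ -1) (n : ℕ) : PS q n + PA q n = 1 := by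
  rw [PS, PA, ← smul_add, show Rhat q n + q⁻¹ • 1 + (q • 1 - Rhat q n)
    = (q + q⁻¹) • (1 : Matrix _ _ K) by rw [add_smul]; abel, smul_smul,
    inv_mul_cancel₀ (q_add_inv_ne hq hq2), one_smul]

theorem PS_mul_PA {q : K} (hq : q ≠ 0) (n : ℕ) : PS q n * PA q n = 0 := by
  rw [PS, PA, smul_mul_smul_comm, add_mul, mul_sub, mul_sub, Rhat_mul_self hq]
  simp only [mul_smul_comm, smul_mul_assoc, mul_one, one_mul, smul_smul]
  rw [mul_inv_cancel₀ hq]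
  module

theorem PA_mul_PS {q : K} (hq : q ≠ 0) (n : ℕ) : PA q n * PS q n = 0 := by
  rw [PS, PA, smul_mul_smul_comm, sub_mul, mul_add, mul_add, Rhat_mul_self hq]
  simp only [mul_smul_comm, smul_mul_assoc, mul_one, one_mul, smul_smul]
  rw [inv_mul_cancel₀ hq]
  module

theorem PS_mul_self {q : K} (hq : q ≠ 0) (hq2 : q ^ 2 ≠ -1) (n : ℕ) :
    PS q n * PS q n = PS q n := by
  have := congrArg (PS q n * ·) (PS_add_PA hq hq2 n)
  simpa [mul_add, PS_mul_PA hq] using this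

theorem PA_mul_self {q : K} (hq : q ≠ 0) (hq2 : q ^ 2 ≠ -1) (n : ℕ) :
    PA q n * PA q n = PA q n := by
  have := congrArg (PA q n * ·) (PS_add_PA hq hq2 n)
  simpa [mul_add, PA_mul_PS hq] using this

theorem Rhat_eq {q : K} (hq : q ≠ 0) (hq2 : q ^ 2 ≠ -1) (n : ℕ) :
    Rhat q n = q • PS q n - q⁻¹ • PA q n := by
  have h := q_add_inv_ne hq hq2
  rw [PS, PA, smul_comm q, smul_comm q⁻¹, ← smul_sub, eq_inv_smul_iff₀ h, smul_add, smul_sub,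
    smul_smul, smul_smul, mul_inv_cancel₀ hq, inv_mul_cancel₀ hq]
  module

theorem Rhat_inv_eq {q : K} (hq : q ≠ 0) (hq2 : q ^ 2 ≠ -1) (n : ℕ) :
    (Rhat q n)⁻¹ = q⁻¹ • PS q n - q • PA q n := by
  rw [Rhat_inv hq, Rhat_eq hq hq2, ← PS_add_PA hq hq2 n]
  module

end BraidEntries

/-! ### Collective indices and the projector decompositions -/

section Tens

variable {K : Type*} [Field K] {M N : ℕ}

theorem tens_mul (X X' : Matrix (Fin M × Fin M) (Fin M × Fin M) K)
    (Y Y' : Matrix (Fin N × Fin N) (Fin N × Fin N) K) :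
    tens X Y * tens X' Y' = tens (X * X') (Y * Y') := by
  ext ⟨⟨a, a'⟩, ⟨b, b'⟩⟩ ⟨⟨c, c'⟩, ⟨d, d'⟩⟩
  simp only [tens, Matrix.mul_apply, Matrix.of_apply, Fintype.sum_prod_type, Finset.sum_mul_sum]
  refine Finset.sum_congr rfl fun i _ => ?_
  refine Finset.sum_congr rfl fun j _ => Finset.sum_congr rfl fun k _ =>
    Finset.sum_congr rfl fun l _ => by ring

theorem tens_add_left (X X' : Matrix (Fin M × Fin M) (Fin M × Fin M) K)
    (Y : Matrix (Fin N × Fin N) (Fin N × Fin N) K) :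
    tens (X + X') Y = tens X Y + tens X' Y := by
  ext; simp [tens, add_mul]

theorem tens_sub_left (X X' : Matrix (Fin M × Fin M) (Fin M × Fin M) K)
    (Y : Matrix (Fin N × Fin N) (Fin N × Fin N) K) :
    tens (X - X') Y = tens X Y - tens X' Y := by
  ext; simp [tens, sub_mul]

theorem tens_add_right (X : Matrix (Fin M × Fin M) (Fin M × Fin M) K)
    (Y Y' : Matrix (Fin N × Fin N) (Fin N × Fin N) K) :
    tens X (Y + Y') = tens X Y + tens X Y' := by
  ext; simp [tens, mul_add]

theorem tens_sub_right (X : Matrix (Fin M × Fin M) (Fin M × Fin M) K)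
    (Y Y' : Matrix (Fin N × Fin N) (Fin N × Fin N) K) :
    tens X (Y - Y') = tens X Y - tens X Y' := by
  ext; simp [tens, mul_sub]

theorem tens_smul_left (r : K) (X : Matrix (Fin M × Fin M) (Fin M × Fin M) K)
    (Y : Matrix (Fin N × Fin N) (Fin N × Fin N) K) : tens (r • X) Y = r • tens X Y := by
  ext; simp [tens, mul_assoc]

theorem tens_smul_right (r : K) (X : Matrix (Fin M × Fin M) (Fin M × Fin M) K)
    (Y : Matrix (Fin N × Fin N) (Fin N × Fin N) K) : tens X (r • Y) = r • tens X Y := by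
  ext; simp [tens, mul_left_comm]

theorem tens_zero_left (Y : Matrix (Fin N × Fin N) (Fin N × Fin N) K) :
    tens (0 : Matrix (Fin M × Fin M) (Fin M × Fin M) K) Y = 0 := by
  ext; simp [tens]

theorem tens_zero_right (X : Matrix (Fin M × Fin M) (Fin M × Fin M) K) :
    tens X (0 : Matrix (Fin N × Fin N) (Fin N × Fin N) K) = 0 := by
  ext; simp [tens]

theorem tens_one : tens (1 : Matrix (Fin M × Fin M) (Fin M × Fin M) K)
    (1 : Matrix (Fin N × Fin N) (Fin N × Fin N) K) = 1 := by
  ext ⟨⟨a, a'⟩, ⟨b, b'⟩⟩ ⟨⟨c, c'⟩, ⟨d, d'⟩⟩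
  simp only [tens, Matrix.of_apply, Matrix.one_apply, Prod.mk.injEq]
  by_cases h1 : a = c <;> by_cases h2 : a' = c' <;> by_cases h3 : b = d <;> simp [h1, h2, h3]

theorem isProjectorTriple_PMinus {q : K} (hq : q ≠ 0) (hq2 : q ^ 2 ≠ -1) (M N : ℕ) :
    IsProjectorTriple (PMinus q M N) (tens (PS q M) (PS q N)) (tens (PA q M) (PA q N)) := by
  constructor <;>
    simp only [PMinus, add_mul, mul_add, tens_mul, PS_mul_PA hq, PA_mul_PS hq,
      PS_mul_self hq hq2, PA_mul_self hq hq2, tens_zero_left, tens_zero_right, add_zero, zero_add]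
  rw [← tens_one, ← PS_add_PA hq hq2 M, ← PS_add_PA hq hq2 N]
  simp only [tens_add_left, tens_add_right]
  abel

theorem isProjectorTriple_PPlus {q : K} (hq : q ≠ 0) (hq2 : q ^ 2 ≠ -1) (M N : ℕ) :
    IsProjectorTriple (PPlus q M N) (tens (PA q M) (PS q N)) (tens (PS q M) (PA q N)) := by
  constructor <;>
    simp only [PPlus, add_mul, mul_add, tens_mul, PS_mul_PA hq, PA_mul_PS hq,
      PS_mul_self hq hq2, PA_mul_self hq hq2, tens_zero_left, tens_zero_right, add_zero, zero_add]
  rw [← tens_one, ← PS_add_PA hq hq2 M, ← PS_add_PA hq hq2 N]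
  simp only [tens_add_left, tens_add_right]
  abel

/-- Eigenvalues multiply: $q\cdot(-q^{-1})=-1$ on both mixed blocks, which therefore merge into one
projector. -/
theorem RPlus_eq {q : K} (hq : q ≠ 0) (hq2 : q ^ 2 ≠ -1) (M N : ℕ) :
    RPlus q M N = -PMinus q M N + q ^ 2 • tens (PS q M) (PS q N)
      + (q ^ 2)⁻¹ • tens (PA q M) (PA q N) := by
  rw [RPlus, Rhat_eq hq hq2 M, Rhat_eq hq hq2 N, PMinus]
  simp only [tens_sub_left, tens_sub_right, tens_smul_left, tens_smul_right, smul_smul, smul_sub,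
    mul_inv_cancel₀ hq, inv_mul_cancel₀ hq, ← sq, inv_pow]
  module

/-- Inverting the first factor changes its eigenvalues to $q^{-1}$ and $-q$, so now the two unmixed
blocks share an eigenvalue, namely $1$. -/
theorem RMinus_eq {q : K} (hq : q ≠ 0) (hq2 : q ^ 2 ≠ -1) (M N : ℕ) :
    RMinus q M N = PPlus q M N - q ^ 2 • tens (PA q M) (PS q N)
      - (q ^ 2)⁻¹ • tens (PS q M) (PA q N) := by
  rw [RMinus, Rhat_inv_eq hq hq2 M, Rhat_eq hq hq2 N, PPlus]
  simp only [tens_sub_left, tens_sub_right, tens_smul_left, tens_smul_right, smul_smul, smul_sub,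
    mul_inv_cancel₀ hq, inv_mul_cancel₀ hq, ← sq, inv_pow]
  module

end Tens

end QHeis

namespace QHeis

/-! ### The Yang–Baxter equation and matrices that slide through a braid -/

section Legs

variable {K : Type*} [Field K] {I : Type} [Fintype I] [DecidableEq I]

/-- `X ⊗ 1` on triple indices. -/
def leg₁₂ (X : Matrix (I × I) (I × I) K) : Matrix (I × I × I) (I × I × I) K :=
  Matrix.of fun U L => X (U.1, U.2.1) (L.1, L.2.1) * if U.2.2 = L.2.2 then 1 else 0

/-- `1 ⊗ X` on triple indices. -/
def leg₂₃ (X : Matrix (I × I) (I × I) K) : Matrix (I × I × I) (I × I × I) K :=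
  Matrix.of fun U L => (if U.1 = L.1 then 1 else 0) * X U.2 L.2

theorem sum_leg₁₂_smul {V : Type*} [AddCommGroup V] [Module K V] (X : Matrix (I × I) (I × I) K)
    (a b c : I) (f : I × I × I → V) :
    ∑ t, leg₁₂ X (a, b, c) t • f t = ∑ u, ∑ v, X (a, b) (u, v) • f (u, v, c) := by
  simp [leg₁₂, Fintype.sum_prod_type]

theorem sum_leg₂₃_smul {V : Type*} [AddCommGroup V] [Module K V] (X : Matrix (I × I) (I × I) K)
    (a b c : I) (f : I × I × I → V) :
    ∑ t, leg₂₃ X (a, b, c) t • f t = ∑ u, ∑ v, X (b, c) (u, v) • f (a, u, v) := by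
  simp [leg₂₃, Fintype.sum_prod_type, ite_smul, Finset.sum_ite_irrel]
  
theorem sum_leg₁₂_smul' {V : Type*} [AddCommGroup V] [Module K V] (X : Matrix (I × I) (I × I) K)
    (a b c : I) (f : I × I × I → V) :
    ∑ t, leg₁₂ X t (a, b, c) • f t = ∑ u, ∑ v, X (u, v) (a, b) • f (u, v, c) := by
  simp [leg₁₂, Fintype.sum_prod_type]

theorem sum_leg₂₃_smul' {V : Type*} [AddCommGroup V] [Module K V] (X : Matrix (I × I) (I × I) K)
    (a b c : I) (f : I × I × I → V) :
    ∑ t, leg₂₃ X t (a, b, c) • f t = ∑ u, ∑ v, X (u, v) (b, c) • f (a, u, v) := by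
  simp [leg₂₃, Fintype.sum_prod_type, ite_smul, Finset.sum_ite_irrel]

theorem leg₁₂_one : leg₁₂ (1 : Matrix (I × I) (I × I) K) = 1 := by
  ext ⟨a, b, c⟩ ⟨d, e, f⟩
  simp only [leg₁₂, Matrix.of_apply, Matrix.one_apply, Prod.mk.injEq]
  by_cases h1 : a = d <;> by_cases h2 : b = e <;> by_cases h3 : c = f <;> simp [h1, h2, h3]

theorem leg₂₃_one : leg₂₃ (1 : Matrix (I × I) (I × I) K) = 1 := by
  ext ⟨a, b, c⟩ ⟨d, e, f⟩
  simp only [leg₂₃, Matrix.of_apply, Matrix.one_apply, Prod.mk.injEq]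
  by_cases h1 : a = d <;> by_cases h2 : b = e <;> by_cases h3 : c = f <;> simp [h1, h2, h3]

theorem leg₁₂_mul (X Y : Matrix (I × I) (I × I) K) : leg₁₂ (X * Y) = leg₁₂ X * leg₁₂ Y := by
  ext ⟨a, b, c⟩ ⟨d, e, f⟩
  simp only [Matrix.mul_apply, ← smul_eq_mul (a := leg₁₂ X _ _)]
  rw [sum_leg₁₂_smul]
  simp [leg₁₂, Matrix.mul_apply, Fintype.sum_prod_type, Finset.sum_ite_irrel]

theorem leg₂₃_mul (X Y : Matrix (I × I) (I × I) K) : leg₂₃ (X * Y) = leg₂₃ X * leg₂₃ Y := by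
  ext ⟨a, b, c⟩ ⟨d, e, f⟩
  simp only [Matrix.mul_apply, ← smul_eq_mul (a := leg₂₃ X _ _)]
  rw [sum_leg₂₃_smul]
  simp [leg₂₃, Matrix.mul_apply, Fintype.sum_prod_type, Finset.sum_ite_irrel]

theorem leg₁₂_add (X Y : Matrix (I × I) (I × I) K) : leg₁₂ (X + Y) = leg₁₂ X + leg₁₂ Y := by
  ext; simp only [leg₁₂, Matrix.of_apply, Matrix.add_apply, add_mul]

theorem leg₂₃_add (X Y : Matrix (I × I) (I × I) K) : leg₂₃ (X + Y) = leg₂₃ X + leg₂₃ Y := by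
  ext; simp only [leg₂₃, Matrix.of_apply, Matrix.add_apply, mul_add]

theorem leg₁₂_smul (r : K) (X : Matrix (I × I) (I × I) K) : leg₁₂ (r • X) = r • leg₁₂ X := by
  ext; simp only [leg₁₂, Matrix.of_apply, Matrix.smul_apply, smul_mul_assoc]

theorem leg₂₃_smul (r : K) (X : Matrix (I × I) (I × I) K) : leg₂₃ (r • X) = r • leg₂₃ X := by
  ext; simp only [leg₂₃, Matrix.of_apply, Matrix.smul_apply, mul_smul_comm]

/-- The Yang–Baxter (braid) equation. -/
def IsBraid (S : Matrix (I × I) (I × I) K) : Prop :=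
  leg₁₂ S * leg₂₃ S * leg₁₂ S = leg₂₃ S * leg₁₂ S * leg₂₃ S

/-- The matrices `P` that can be moved through the braid matrix `S`. -/
structure Slides (S P : Matrix (I × I) (I × I) K) : Prop where
  fst : leg₁₂ S * leg₂₃ S * leg₁₂ P = leg₂₃ P * (leg₁₂ S * leg₂₃ S)
  snd : leg₂₃ S * leg₁₂ S * leg₂₃ P = leg₁₂ P * (leg₂₃ S * leg₁₂ S)

/-- Together with the closure lemmas below, this lets every polynomial in a braid matrix slide
through it; the projectors are such polynomials. -/
theorem IsBraid.slides {S : Matrix (I × I) (I × I) K} (h : IsBraid S) : Slides S S :=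
  ⟨by rw [h, mul_assoc], by rw [← h, mul_assoc]⟩

theorem Slides.one (S : Matrix (I × I) (I × I) K) : Slides S 1 :=
  ⟨by simp [leg₁₂_one, leg₂₃_one], by simp [leg₁₂_one, leg₂₃_one]⟩

theorem Slides.add {S P Q : Matrix (I × I) (I × I) K} (h : Slides S P) (h' : Slides S Q) :
    Slides S (P + Q) :=
  ⟨by rw [leg₁₂_add, leg₂₃_add, mul_add, add_mul, h.fst, h'.fst],
    by rw [leg₁₂_add, leg₂₃_add, mul_add, add_mul, h.snd, h'.snd]⟩

theorem Slides.smul {S P : Matrix (I × I) (I × I) K} (h : Slides S P) (r : K) :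
    Slides S (r • P) :=
  ⟨by rw [leg₁₂_smul, leg₂₃_smul, mul_smul_comm, smul_mul_assoc, h.fst],
    by rw [leg₁₂_smul, leg₂₃_smul, mul_smul_comm, smul_mul_assoc, h.snd]⟩

theorem Slides.mul {S P Q : Matrix (I × I) (I × I) K} (h : Slides S P) (h' : Slides S Q) :
    Slides S (P * Q) :=
  ⟨by rw [leg₁₂_mul, leg₂₃_mul, ← mul_assoc, h.fst, mul_assoc, h'.fst, mul_assoc],
    by rw [leg₁₂_mul, leg₂₃_mul, ← mul_assoc, h.snd, mul_assoc, h'.snd, mul_assoc]⟩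

theorem IsBraid.smul {S : Matrix (I × I) (I × I) K} (h : IsBraid S) (r : K) :
    IsBraid (r • S) := by
  rw [IsBraid] at h ⊢
  simp only [leg₁₂_smul, leg₂₃_smul, mul_smul_comm, smul_mul_assoc, h]

/-- Both sides of the equation for `T` are inverses of the same braid word in `S`. -/
theorem IsBraid.of_inverse {S T : Matrix (I × I) (I × I) K} (h : IsBraid S) (hST : S * T = 1) :
    IsBraid T := by
  have h1 : leg₁₂ S * leg₁₂ T = 1 := by rw [← leg₁₂_mul, hST, leg₁₂_one]
  have h2 : leg₂₃ S * leg₂₃ T = 1 := by rw [← leg₂₃_mul, hST, leg₂₃_one]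
  have e1 : (leg₁₂ S * leg₂₃ S * leg₁₂ S) * (leg₁₂ T * leg₂₃ T * leg₁₂ T) = 1 := by
    simp only [mul_assoc]
    rw [← mul_assoc (leg₁₂ S) (leg₁₂ T), h1, one_mul, ← mul_assoc (leg₂₃ S) (leg₂₃ T), h2,
      one_mul, h1]
  have e2 : (leg₁₂ S * leg₂₃ S * leg₁₂ S) * (leg₂₃ T * leg₁₂ T * leg₂₃ T) = 1 := by
    rw [h]
    simp only [mul_assoc]
    rw [← mul_assoc (leg₂₃ S) (leg₂₃ T), h2, one_mul, ← mul_assoc (leg₁₂ S) (leg₁₂ T), h1,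
      one_mul, h2]
  exact left_inv_eq_right_inv (mul_eq_one_comm.mp e1) e2

end Legs

/-! ### Yang–Baxter for the braid matrix of one factor -/

section RhatBraid

variable {K : Type*} [Field K]

theorem leg₁₂_Rhat_mulVec (q : K) {n : ℕ} (v : Fin n × Fin n × Fin n → K) (a b c : Fin n) :
    (leg₁₂ (Rhat q n)).mulVec v (a, b, c) =
      dcoef q a b * v (a, b, c) + fcoef K a b * v (b, a, c) := by
  have := (sum_leg₁₂_smul (Rhat q n) a b c v).trans
    (sum_Rhat_smul q a b fun x y => v (x, y, c))
  simpa [Matrix.mulVec, dotProduct] using this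

theorem leg₂₃_Rhat_mulVec (q : K) {n : ℕ} (v : Fin n × Fin n × Fin n → K) (a b c : Fin n) :
    (leg₂₃ (Rhat q n)).mulVec v (a, b, c) =
      dcoef q b c * v (a, b, c) + fcoef K b c * v (a, c, b) := by
  have := (sum_leg₂₃_smul (Rhat q n) a b c v).trans
    (sum_Rhat_smul q b c fun x y => v (a, x, y))
  simpa [Matrix.mulVec, dotProduct] using this

theorem dcoef_self (q : K) {n : ℕ} (a : Fin n) : dcoef q a a = q := by simp [dcoef]

theorem dcoef_of_lt (q : K) {n : ℕ} {a b : Fin n} (h : a < b) : dcoef q a b = q - q⁻¹ := by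
  simp [dcoef, h, h.ne]

theorem dcoef_of_gt (q : K) {n : ℕ} {a b : Fin n} (h : b < a) : dcoef q a b = 0 := by
  simp [dcoef, h.ne', h.not_gt]

theorem fcoef_self {n : ℕ} (a : Fin n) : fcoef K a a = 0 := by simp [fcoef]

theorem fcoef_of_ne {n : ℕ} {a b : Fin n} (h : a ≠ b) : fcoef K a b = 1 := by simp [fcoef, h]

/-- Both sides, applied to `v` and evaluated at $(a,b,c)$, combine values of `v` at permutations of
$(a,b,c)$ with coefficients that depend only on the relative order of the three indices, so finitely
many identities remain. -/
theorem isBraid_Rhat {q : K} (hq : q ≠ 0) (n : ℕ) : IsBraid (Rhat q n) := by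
  rw [IsBraid]
  refine Matrix.ext_of_mulVec_single fun t => ?_
  generalize (Pi.single t (1 : K) : Fin n × Fin n × Fin n → K) = v
  funext ⟨a, b, c⟩
  simp only [← Matrix.mulVec_mulVec, leg₁₂_Rhat_mulVec, leg₂₃_Rhat_mulVec]
  have hqq : q * q⁻¹ = 1 := mul_inv_cancel₀ hq
  -- With the inverse replaced by a variable $p$ subject to $qp=1$, the remaining goals are
  -- polynomial.
  generalize q⁻¹ = p at hqq
  rcases lt_trichotomy a b with h1 | h1 | h1 <;> rcases lt_trichotomy b c with h2 | h2 | h2 <;>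
    rcases lt_trichotomy a c with h3 | h3 | h3 <;> try (exfalso; order)
  all_goals
    try subst h1
    try subst h2
    try subst h3
    simp only [dcoef_self, fcoef_self, dcoef_of_lt, dcoef_of_gt, fcoef_of_ne, ne_eq, *, ne_of_lt,
      ne_of_gt, not_false_eq_true]
    try grind

end RhatBraid

/-! ### Yang–Baxter for collective indices, and Heisenberg pairs -/

section TensBraid

variable {K : Type*} [Field K] {M N : ℕ}

/-- Separation of the two components of a triple of collective indices. -/
def idxTriple (M N : ℕ) : Idx M N × Idx M N × Idx M N ≃
    (Fin M × Fin M × Fin M) × (Fin N × Fin N × Fin N) where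
  toFun t := ((t.1.1, t.2.1.1, t.2.2.1), (t.1.2, t.2.1.2, t.2.2.2))
  invFun t := ((t.1.1, t.2.1), (t.1.2.1, t.2.2.1), (t.1.2.2, t.2.2.2))
  left_inv _ := rfl
  right_inv _ := rfl

/-- The analogue of `tens` for triple indices. -/
def tensTriple (X : Matrix (Fin M × Fin M × Fin M) (Fin M × Fin M × Fin M) K)
    (Y : Matrix (Fin N × Fin N × Fin N) (Fin N × Fin N × Fin N) K) :
    Matrix (Idx M N × Idx M N × Idx M N) (Idx M N × Idx M N × Idx M N) K :=
  (Matrix.kroneckerMap (· * ·) X Y).submatrix (idxTriple M N) (idxTriple M N)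

theorem tensTriple_mul (X X' : Matrix (Fin M × Fin M × Fin M) (Fin M × Fin M × Fin M) K)
    (Y Y' : Matrix (Fin N × Fin N × Fin N) (Fin N × Fin N × Fin N) K) :
    tensTriple X Y * tensTriple X' Y' = tensTriple (X * X') (Y * Y') := by
  rw [tensTriple, tensTriple, Matrix.submatrix_mul_equiv, ← Matrix.mul_kronecker_mul]
  rfl

theorem leg₁₂_tens (X : Matrix (Fin M × Fin M) (Fin M × Fin M) K)
    (Y : Matrix (Fin N × Fin N) (Fin N × Fin N) K) :
    leg₁₂ (tens X Y) = tensTriple (leg₁₂ X) (leg₁₂ Y) := by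
  ext ⟨a, b, c, c'⟩ ⟨d, e, f, f'⟩
  change X _ _ * Y _ _ * (if (c, c') = (f, f') then 1 else 0) =
    X _ _ * (if c = f then 1 else 0) * (Y _ _ * (if c' = f' then 1 else 0))
  by_cases h1 : c = f <;> by_cases h2 : c' = f' <;> simp [h1, h2, idxTriple]

theorem leg₂₃_tens (X : Matrix (Fin M × Fin M) (Fin M × Fin M) K)
    (Y : Matrix (Fin N × Fin N) (Fin N × Fin N) K) :
    leg₂₃ (tens X Y) = tensTriple (leg₂₃ X) (leg₂₃ Y) := by
  ext ⟨⟨a, a'⟩, b, c⟩ ⟨⟨d, d'⟩, e, f⟩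
  change (if (a, a') = (d, d') then 1 else 0) * (X _ _ * Y _ _) =
    (if a = d then 1 else 0) * X _ _ * ((if a' = d' then 1 else 0) * Y _ _)
  by_cases h1 : a = d <;> by_cases h2 : a' = d' <;> simp [h1, h2, idxTriple]

theorem IsBraid.tens {X : Matrix (Fin M × Fin M) (Fin M × Fin M) K}
    {Y : Matrix (Fin N × Fin N) (Fin N × Fin N) K} (hX : IsBraid X) (hY : IsBraid Y) :
    IsBraid (tens X Y) := by
  rw [IsBraid] at *
  simp only [leg₁₂_tens, leg₂₃_tens, tensTriple_mul, hX, hY]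

theorem isBraid_RPlus {q : K} (hq : q ≠ 0) (M N : ℕ) : IsBraid (RPlus q M N) :=
  (isBraid_Rhat hq M).tens (isBraid_Rhat hq N)

theorem isBraid_RMinus {q : K} (hq : q ≠ 0) (M N : ℕ) : IsBraid (RMinus q M N) := by
  refine IsBraid.tens ((isBraid_Rhat hq M).of_inverse ?_) (isBraid_Rhat hq N)
  rw [Rhat_inv hq, Rhat_mul_sub hq]

theorem tens_symm {X : Matrix (Fin M × Fin M) (Fin M × Fin M) K}
    {Y : Matrix (Fin N × Fin N) (Fin N × Fin N) K} (hX : X.transpose = X) (hY : Y.transpose = Y) :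
    (tens X Y).transpose = tens X Y := by
  ext U L
  simp only [tens, Matrix.transpose_apply, Matrix.of_apply]
  congr 1
  · exact congrFun₂ hX _ _
  · exact congrFun₂ hY _ _

theorem Rhat_transpose (q : K) (n : ℕ) : (Rhat q n).transpose = Rhat q n := by
  ext; exact Rhat_symm ..

theorem PS_transpose (q : K) (n : ℕ) : (PS q n).transpose = PS q n := by
  simp [PS, Rhat_transpose]

theorem PA_transpose (q : K) (n : ℕ) : (PA q n).transpose = PA q n := by
  simp [PA, Rhat_transpose]

theorem PMinus_transpose (q : K) (M N : ℕ) : (PMinus q M N).transpose = PMinus q M N := by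
  simp [PMinus, tens_symm, PS_transpose, PA_transpose]

theorem PPlus_transpose (q : K) (M N : ℕ) : (PPlus q M N).transpose = PPlus q M N := by
  simp [PPlus, tens_symm, PS_transpose, PA_transpose]

/-- The pair of matrices `(P, S)` defines a braided Heisenberg algebra. -/
structure IsHeisPair {I : Type} [Fintype I] [DecidableEq I] (P S : Matrix (I × I) (I × I) K) :
    Prop where
  slides : Slides S P
  mul_add : P * (1 + S) = 0
  add_mul : (1 + S) * P = 0
  symm : P.transpose = P

/-- $S$ is $-1$, $r$, $r^{-1}$ on the images of $P$, $Q$, $R$, so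
$(S-r)(S-r^{-1})=(1+r)(1+r^{-1})P$; as $r\ne -1$, $P$ is a polynomial in $S$. -/
theorem slides_of_projectorTriple {I : Type} [Fintype I] [DecidableEq I]
    {P Q R S : Matrix (I × I) (I × I) K} (h : IsProjectorTriple P Q R) {r : K} (hr : r ≠ 0)
    (hr1 : r ≠ -1) (hS : S = -P + r • Q + r⁻¹ • R) (hb : IsBraid S) : Slides S P := by
  have key : (1 + r) • (1 + r⁻¹) • P = S * S + (-(r + r⁻¹)) • S + 1 := by
    rw [hS, ← h.sum_eq_one]
    simp only [add_mul, mul_add, neg_mul, mul_neg, smul_mul_assoc, mul_smul_comm, h.idem₁, h.idem₂,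
      h.idem₃, h.orth₁₂, h.orth₂₁, h.orth₁₃, h.orth₃₁, h.orth₂₃, h.orth₃₂]
    match_scalars <;> field_simp <;> ring
  have h1 : 1 + r ≠ 0 := fun h => hr1 (by linear_combination h)
  have h2 : 1 + r⁻¹ ≠ 0 := fun h => h1 (by field_simp at h; linear_combination h)
  have : P = (1 + r⁻¹)⁻¹ • (1 + r)⁻¹ • (S * S + (-(r + r⁻¹)) • S + 1) := by
    rw [← key, inv_smul_smul₀ h1, inv_smul_smul₀ h2]
  rw [this]
  exact (((hb.slides.mul hb.slides).add (hb.slides.smul _)).add (Slides.one S)).smul _ |>.smul _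

/-- The identities $P(1+S)=0=(1+S)P$ express that $S=-1$ on the image of $P$. They later cancel the
linear terms that appear when a quadratic relation is moved past a generator. -/
theorem isHeisPair_of_projectorTriple {I : Type} [Fintype I] [DecidableEq I]
    {P Q R S : Matrix (I × I) (I × I) K} (h : IsProjectorTriple P Q R) {r : K} (hr : r ≠ 0)
    (hr1 : r ≠ -1) (hS : S = -P + r • Q + r⁻¹ • R) (hb : IsBraid S) (hP : P.transpose = P) :
    IsHeisPair P S where
  slides := slides_of_projectorTriple h hr hr1 hS hb
  mul_add := by simp [hS, mul_add, h.idem₁, h.orth₁₂, h.orth₁₃]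
  add_mul := by simp [hS, add_mul, h.idem₁, h.orth₂₁, h.orth₃₁]
  symm := hP

theorem isHeisPair_PMinus {q : K} (hq : q ≠ 0) (hq2 : q ^ 2 ≠ -1) (M N : ℕ) :
    IsHeisPair (PMinus q M N) (RPlus q M N) :=
  isHeisPair_of_projectorTriple (isProjectorTriple_PMinus hq hq2 M N) (pow_ne_zero 2 hq) hq2
    (RPlus_eq hq hq2 M N) (isBraid_RPlus hq M N) (PMinus_transpose q M N)

theorem isHeisPair_PPlus {q : K} (hq : q ≠ 0) (hq2 : q ^ 2 ≠ -1) (M N : ℕ) :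
    IsHeisPair (PPlus q M N) (-RMinus q M N) :=
  isHeisPair_of_projectorTriple (isProjectorTriple_PPlus hq hq2 M N) (pow_ne_zero 2 hq) hq2
    (by rw [RMinus_eq hq hq2 M N]; abel)
    (by simpa using (isBraid_RMinus hq M N).smul (-1)) (PPlus_transpose q M N)

end TensBraid

/-! ### Word filtrations, adapted bases and Poincaré series -/

section PBW

variable {K : Type*} [Field K]

theorem wordFiltration_mono {A ι : Type*} [Ring A] [Algebra K A] (g : ι → A) {m n : ℕ}
    (h : m ≤ n) : wordFiltration K g m ≤ wordFiltration K g n :=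
  Submodule.span_mono fun _ ⟨l, hl, hx⟩ => ⟨l, hl.trans_le h, hx⟩

theorem one_mem_wordFiltration {A ι : Type*} [Ring A] [Algebra K A] (g : ι → A) (n : ℕ) :
    1 ∈ wordFiltration K g (n + 1) :=
  Submodule.subset_span ⟨[], by simp, by simp⟩

theorem gen_mem_wordFiltration {A ι : Type*} [Ring A] [Algebra K A] (g : ι → A) (i : ι) :
    g i ∈ wordFiltration K g 2 :=
  Submodule.subset_span ⟨[i], by simp, by simp⟩

theorem mul_mem_wordFiltration {A ι : Type*} [Ring A] [Algebra K A] (g : ι → A) {m n : ℕ}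
    {a b : A} (ha : a ∈ wordFiltration K g (m + 1)) (hb : b ∈ wordFiltration K g (n + 1)) :
    a * b ∈ wordFiltration K g (m + n + 1) := by
  induction ha using Submodule.span_induction with
  | mem x hx =>
    obtain ⟨l, hl, rfl⟩ := hx
    induction hb using Submodule.span_induction with
    | mem y hy =>
      obtain ⟨l', hl', rfl⟩ := hy
      exact Submodule.subset_span ⟨l ++ l', by simp; omega, by simp⟩
    | zero => simp
    | add x y _ _ hx hy => rw [mul_add]; exact add_mem hx hy
    | smul r x _ hx => rw [mul_smul_comm]; exact Submodule.smul_mem _ _ hx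
  | zero => simp
  | add x y _ _ hx hy => rw [add_mul]; exact add_mem hx hy
  | smul r x _ hx => rw [smul_mul_assoc]; exact Submodule.smul_mem _ _ hx

/-- Induction principle for elements of a generated algebra: multiplication by generators
on the left. -/
theorem wordFiltration_le_of_stable {A ι : Type*} [Ring A] [Algebra K A] (g : ι → A)
    (G : ℕ → Submodule K A) (h1 : ∀ n, 1 ∈ G (n + 1))
    (hg : ∀ n i a, a ∈ G n → g i * a ∈ G (n + 1)) (n : ℕ) : wordFiltration K g n ≤ G n := by
  refine Submodule.span_le.mpr ?_
  rintro _ ⟨l, hl, rfl⟩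
  induction l generalizing n with
  | nil =>
    obtain ⟨n, rfl⟩ := Nat.exists_eq_succ_of_ne_zero (Nat.pos_iff_ne_zero.mp hl)
    simpa using h1 n
  | cons i l ih =>
    obtain ⟨n, rfl⟩ := Nat.exists_eq_succ_of_ne_zero (Nat.pos_iff_ne_zero.mp (pos_of_gt hl))
    simp only [List.map_cons, List.prod_cons]
    exact hg n i _ (ih n (by simpa using hl))

/-- The algebra `A` has a basis indexed by `X` that is adapted to the filtration by the length of
words in the generators `g`: the span of the words of length `< n` is spanned by the basis vectors
of degree `< n`. -/
def HasPBW (K : Type*) [Field K] {A ι X : Type*} [Ring A] [Algebra K A] (g : ι → A) (ℓ : X → ℕ) :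
    Prop :=
  ∃ b : Module.Basis X K A,
    ∀ n, wordFiltration K g n = Submodule.span K (b '' {x | ℓ x < n})

/-- Matching the two bases along the common index set is a linear isomorphism that carries one
filtration to the other, hence identifies the graded pieces. The products of the two algebras play
no role. -/
theorem HasPBW.poincareSeries_eq {A A' ι ι' X : Type*} [Ring A] [Algebra K A] [Ring A']
    [Algebra K A'] {g : ι → A} {g' : ι' → A'} {ℓ : X → ℕ} (h : HasPBW K g ℓ)
    (h' : HasPBW K g' ℓ) : poincareSeries K g = poincareSeries K g' := by
  obtain ⟨b, hb⟩ := h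
  obtain ⟨b', hb'⟩ := h'
  let e : A ≃ₗ[K] A' := b.equiv b' (Equiv.refl X)
  have he : ∀ n, (wordFiltration K g n).map (e : A →ₗ[K] A') = wordFiltration K g' n := by
    intro n
    rw [hb, hb', Submodule.map_span, ← Set.image_comp]
    congr 2
    funext x
    simp [e]
  ext n
  simp only [poincareSeries, PowerSeries.coeff_mk]
  let e' : wordFiltration K g (n + 1) ≃ₗ[K] wordFiltration K g' (n + 1) :=
    (e.submoduleMap _).trans (LinearEquiv.ofEq _ _ (he (n + 1)))
  refine (Submodule.Quotient.equiv _ _ e' ?_).finrank_eq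
  ext ⟨y, hy⟩
  change (_ ∈ Submodule.map _ _) ↔ y ∈ wordFiltration K g' n
  rw [Submodule.mem_map]
  constructor
  · rintro ⟨x, hx, hxy⟩
    have : e x = y := congrArg Subtype.val hxy
    rw [← he n, ← this]
    exact ⟨x, hx, rfl⟩
  · intro h
    rw [← he n] at h
    obtain ⟨x, hx, hxy⟩ := h
    exact ⟨⟨x, wordFiltration_mono g (Nat.le_succ n) hx⟩, hx, Subtype.ext hxy⟩

theorem HasPBW.of_linearEquiv {A A' ι ι' X : Type*} [Ring A] [Algebra K A] [Ring A']
    [Algebra K A'] {g : ι → A} {g' : ι' → A'} {ℓ : X → ℕ} (h : HasPBW K g ℓ) (e : A ≃ₗ[K] A')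
    (he : ∀ n, (wordFiltration K g n).map (e : A →ₗ[K] A') = wordFiltration K g' n) :
    HasPBW K g' ℓ := by
  obtain ⟨b, hb⟩ := h
  refine ⟨b.map e, fun n => ?_⟩
  rw [← he, hb, Submodule.map_span, ← Set.image_comp]
  rfl

/-- Reversing a word keeps its length. This is needed because the annihilation operators satisfy the
creation relations in the opposite algebra. -/
theorem HasPBW.op {A ι X : Type*} [Ring A] [Algebra K A] {g : ι → A} {ℓ : X → ℕ}
    (h : HasPBW K g ℓ) : HasPBW K (fun i => MulOpposite.op (g i)) ℓ := by
  refine h.of_linearEquiv (MulOpposite.opLinearEquiv K) fun n => ?_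
  rw [wordFiltration, Submodule.map_span, wordFiltration]
  congr 1
  ext x
  constructor
  · rintro ⟨_, ⟨l, hl, rfl⟩, rfl⟩
    refine ⟨l.reverse, by simpa using hl, ?_⟩
    simp [MulOpposite.op_list_prod, Function.comp_def, List.map_reverse]
  · rintro ⟨l, hl, rfl⟩
    refine ⟨_, ⟨l.reverse, by simpa using hl, rfl⟩, ?_⟩
    simp [MulOpposite.op_list_prod, Function.comp_def, List.map_reverse]

theorem wordFiltration_map {A A' ι ι' : Type*} [Ring A] [Algebra K A] [Ring A'] [Algebra K A']
    (g : ι → A) (g' : ι' → A') (f : A →ₐ[K] A') (e : ι → ι') (hf : ∀ i, f (g i) = g' (e i))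
    (n : ℕ) : (wordFiltration K g n).map f.toLinearMap ≤ wordFiltration K g' n := by
  rw [wordFiltration, Submodule.map_span, wordFiltration]
  refine Submodule.span_mono ?_
  rintro _ ⟨_, ⟨l, hl, rfl⟩, rfl⟩
  refine ⟨l.map e, by simpa using hl, ?_⟩
  simp [map_list_prod, Function.comp_def, hf]

theorem HasPBW.of_algEquiv {A A' ι ι' X : Type*} [Ring A] [Algebra K A] [Ring A'] [Algebra K A']
    {g : ι → A} {g' : ι' → A'} {ℓ : X → ℕ} (h : HasPBW K g ℓ) (f : A ≃ₐ[K] A') (e : ι ≃ ι')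
    (hf : ∀ i, f (g i) = g' (e i)) : HasPBW K g' ℓ := by
  refine h.of_linearEquiv f.toLinearEquiv fun n => le_antisymm ?_ ?_
  · exact wordFiltration_map g g' f.toAlgHom e hf n
  · intro y hy
    refine ⟨f.symm y, ?_, by simp⟩
    refine wordFiltration_map g' g f.symm.toAlgHom e.symm (fun i => ?_) n ⟨y, hy, rfl⟩
    change f.symm (g' i) = _
    rw [AlgEquiv.symm_apply_eq, hf, Equiv.apply_symm_apply]

/-- Two algebras with mutually inverse homomorphisms on generators. -/
theorem HasPBW.of_algHoms {A A' ι ι' X : Type*} [Ring A] [Algebra K A] [Ring A'] [Algebra K A']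
    {g : ι → A} {g' : ι' → A'} {ℓ : X → ℕ} (h : HasPBW K g ℓ) (f : A →ₐ[K] A') (f' : A' →ₐ[K] A)
    (e : ι ≃ ι') (hf : ∀ i, f (g i) = g' (e i)) (hf' : ∀ i, f' (g' (e i)) = g i)
    (hg : Algebra.adjoin K (Set.range g) = ⊤) (hg' : Algebra.adjoin K (Set.range g') = ⊤) :
    HasPBW K g' ℓ := by
  refine h.of_algEquiv (AlgEquiv.ofAlgHom f f' ?_ ?_) e hf
  · refine AlgHom.ext_of_adjoin_eq_top hg' ?_
    rintro _ ⟨i, rfl⟩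
    obtain ⟨i, rfl⟩ := e.surjective i
    simp [hf, hf']
  · refine AlgHom.ext_of_adjoin_eq_top hg ?_
    rintro _ ⟨i, rfl⟩
    simp [hf, hf']

theorem adjoin_ringQuot {ι : Type*} (r : FreeAlgebra K ι → FreeAlgebra K ι → Prop) :
    Algebra.adjoin K (Set.range fun i => RingQuot.mkAlgHom K r (FreeAlgebra.ι K i)) = ⊤ := by
  have : (Set.range fun i => RingQuot.mkAlgHom K r (FreeAlgebra.ι K i)) =
      RingQuot.mkAlgHom K r '' Set.range (FreeAlgebra.ι K) := by
    rw [← Set.range_comp]; rfl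
  rw [this, ← AlgHom.map_adjoin, FreeAlgebra.adjoin_range_ι, Algebra.map_top,
    AlgHom.range_eq_top]
  exact RingQuot.mkAlgHom_surjective K r

theorem induction_of_adjoin {A ι : Type*} [Ring A] [Algebra K A] {g : ι → A}
    (hg : Algebra.adjoin K (Set.range g) = ⊤) {p : A → Prop}
    (h1 : p 1) (hadd : ∀ a b, p a → p b → p (a + b)) (hsmul : ∀ (r : K) a, p a → p (r • a))
    (hmul : ∀ i a, p a → p (g i * a)) (a : A) : p a := by
  have ha : a ∈ Algebra.adjoin K (Set.range g) := hg ▸ Algebra.mem_top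
  rw [← Subalgebra.mem_toSubmodule, Algebra.adjoin_eq_span] at ha
  induction ha using Submodule.span_induction with
  | mem x hx =>
    induction hx using Submonoid.closure_induction_left with
    | one => exact h1
    | mul_left x hx y _ ih => obtain ⟨i, rfl⟩ := hx; exact hmul i y ih
  | zero => simpa using hsmul 0 1 h1
  | add x y _ _ hx hy => exact hadd x y hx hy
  | smul r x _ hx => exact hsmul r x hx

end PBW

/-! ### Crossings: operators on a tensor product of two algebras -/

section Crossing

variable {K : Type*} [Field K] {B C : Type*} [Ring B] [Algebra K B] [Ring C] [Algebra K C]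
  {J : Type*} [Fintype J] [DecidableEq J]

/-- The operator `b ⊗ c ↦ ∑ k, Θ(b) j k ⊗ y k * c` on `B ⊗ C`: multiplication by `y j`, moved past
the elements of `B` with the help of `Θ`. -/
noncomputable def crossOp (Θ : B →ₐ[K] Matrix J J B) (y : J → C) (j : J) :
    Module.End K (B ⊗[K] C) :=
  ∑ k, TensorProduct.map (Matrix.entryLinearMap K B j k ∘ₗ Θ.toLinearMap)
    (LinearMap.mulLeft K (y k))

variable (Θ : B →ₐ[K] Matrix J J B) (y : J → C)

theorem crossOp_tmul (j : J) (b : B) (c : C) :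
    crossOp Θ y j (b ⊗ₜ c) = ∑ k, Θ b j k ⊗ₜ[K] (y k * c) := by
  simp [crossOp, LinearMap.sum_apply]

theorem crossOp_one_tmul (j : J) (c : C) :
    crossOp Θ y j (1 ⊗ₜ c) = 1 ⊗ₜ[K] (y j * c) := by
  rw [crossOp_tmul, map_one, Finset.sum_eq_single j]
  · simp
  · intro k _ hk
    simp [Matrix.one_apply_ne hk.symm]
  · simp

theorem lsmul_tmul (b b' : B) (c : C) :
    Algebra.lsmul K K (B ⊗[K] C) b (b' ⊗ₜ c) = (b * b') ⊗ₜ c := rfl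

/-- This is the multiplicativity of `Θ`, and it is the exchange rule between the two kinds of
operators. -/
theorem crossOp_mul_lsmul (j : J) (b : B) :
    crossOp Θ y j * Algebra.lsmul K K (B ⊗[K] C) b =
      ∑ k, Algebra.lsmul K K (B ⊗[K] C) (Θ b j k) * crossOp Θ y k := by
  refine TensorProduct.ext' fun b' c => ?_
  simp only [Module.End.mul_apply, Algebra.lsmul_coe, TensorProduct.smul_tmul', smul_eq_mul,
    crossOp_tmul, LinearMap.sum_apply, map_mul, Matrix.mul_apply, TensorProduct.sum_tmul,
    Finset.smul_sum]
  exact Finset.sum_comm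

/-- A family of operators that annihilates `1 ⊗ C` and can be moved past the generators of `B`
vanishes. -/
theorem crossOp_relation {ι T : Type*} [Fintype T] {g : ι → B}
    (hg : Algebra.adjoin K (Set.range g) = ⊤) (W : T → Module.End K (B ⊗[K] C))
    (h1 : ∀ t c, W t (1 ⊗ₜ c) = 0) (m : T → ι → T → B)
    (hW : ∀ t i, W t * Algebra.lsmul K K (B ⊗[K] C) (g i) =
      ∑ t', Algebra.lsmul K K (B ⊗[K] C) (m t i t') * W t') (t : T) : W t = 0 := by
  refine TensorProduct.ext' fun b c => ?_
  rw [LinearMap.zero_apply]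
  revert t
  refine induction_of_adjoin hg (p := fun b => ∀ t, W t (b ⊗ₜ c) = 0) (fun t => h1 t c)
    (fun a b ha hb t => by rw [TensorProduct.add_tmul, map_add, ha, hb, add_zero])
    (fun r a ha t => by rw [← TensorProduct.smul_tmul', map_smul, ha, smul_zero])
    (fun i a ha t => ?_) b
  have := LinearMap.congr_fun (hW t i) (a ⊗ₜ c)
  simpa [TensorProduct.smul_tmul', LinearMap.sum_apply, ha] using this

/-- A crossing whose entries on generators have degree at most one never raises degrees, since the
entries of a product of matrices are sums of products. -/
theorem entry_mem_wordFiltration {ι : Type*} {g : ι → B}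
    (hΘ : ∀ i j k, Θ (g i) j k ∈ wordFiltration K g 2) {n : ℕ} {b : B}
    (hb : b ∈ wordFiltration K g n) (j k : J) : Θ b j k ∈ wordFiltration K g n := by
  let G : ℕ → Submodule K B := fun n => ⨅ j, ⨅ k,
    (wordFiltration K g n).comap (Matrix.entryLinearMap K B j k ∘ₗ Θ.toLinearMap)
  have hG : ∀ n b, b ∈ G n ↔ ∀ j k, Θ b j k ∈ wordFiltration K g n := by
    intro n b
    simp [G, Submodule.mem_iInf]
  have key : wordFiltration K g n ≤ G n := by
    refine wordFiltration_le_of_stable g G (fun n => ?_) (fun n i a ha => ?_) n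
    · rw [hG]
      intro j k
      rw [map_one, Matrix.one_apply]
      split_ifs
      · exact one_mem_wordFiltration g n
      · exact zero_mem _
    · rw [hG] at ha ⊢
      intro j k
      rw [map_mul, Matrix.mul_apply]
      refine sum_mem fun l _ => ?_
      -- The length bound is strict, so level `0` is the zero space, to which the product estimate
      -- does not apply.
      rcases n with _ | n
      · have h0 : wordFiltration K g 0 = ⊥ := by simp [wordFiltration]
        have : Θ a l k = 0 := by simpa [h0] using ha l k
        rw [this, mul_zero]
        exact zero_mem _
      · rw [add_comm n 1]
        exact mul_mem_wordFiltration g (m := 1) (hΘ i j l) (ha l k)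
  exact (hG n b).mp (key hb) j k

end Crossing

/-! ### Adapted bases of crossed products -/

section Merge

variable {K : Type*} [Field K] {B C E : Type*} [Ring B] [Algebra K B] [Ring C] [Algebra K C]
  [Ring E] [Algebra K E] {J : Type*} [Fintype J] [DecidableEq J] {ιB ιC ιE X Y : Type*}

theorem tmul_mem_span {gB : ιB → B} {gC : ιC → C} {ℓB : X → ℕ} {ℓC : Y → ℕ}
    (bB : Module.Basis X K B) (bC : Module.Basis Y K C)
    (hB : ∀ n, wordFiltration K gB n = Submodule.span K (bB '' {x | ℓB x < n}))
    (hC : ∀ n, wordFiltration K gC n = Submodule.span K (bC '' {x | ℓC x < n}))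
    {i j n : ℕ} (hij : i + j < n) {b : B} {c : C} (hb : b ∈ wordFiltration K gB (i + 1))
    (hc : c ∈ wordFiltration K gC (j + 1)) :
    b ⊗ₜ[K] c ∈ Submodule.span K
      ((bB.tensorProduct bC) '' {x : X × Y | ℓB x.1 + ℓC x.2 < n}) := by
  rw [hB] at hb
  rw [hC] at hc
  induction hb using Submodule.span_induction with
  | mem b hb =>
    obtain ⟨x, hx, rfl⟩ := hb
    induction hc using Submodule.span_induction with
    | mem c hc =>
      obtain ⟨y, hy, rfl⟩ := hc
      refine Submodule.subset_span ⟨(x, y), ?_, Module.Basis.tensorProduct_apply ..⟩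
      simp only [Set.mem_ofPred_eq] at hx hy ⊢
      omega
    | zero => simp
    | add x y _ _ hx hy => rw [TensorProduct.tmul_add]; exact add_mem hx hy
    | smul r x _ hx => rw [TensorProduct.tmul_smul]; exact Submodule.smul_mem _ _ hx
  | zero => simp
  | add x y _ _ hx hy => rw [TensorProduct.add_tmul]; exact add_mem hx hy
  | smul r x _ hx => rw [← TensorProduct.smul_tmul']; exact Submodule.smul_mem _ _ hx

/-- An algebra `E` generated by two algebras `B` and `C` that acts on `B ⊗ C` by means of a
crossing `Θ` is, as a vector space, the tensor product of the two, and bases adapted to the word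
filtrations of `B` and `C` yield one for `E`. -/
theorem HasPBW.crossedProduct {gB : ιB → B} {gC : ιC → C} {gE : ιE → E} {ℓB : X → ℕ} {ℓC : Y → ℕ}
    (hB : HasPBW K gB ℓB) (hC : HasPBW K gC ℓC)
    (hgB : Algebra.adjoin K (Set.range gB) = ⊤) (hgC : Algebra.adjoin K (Set.range gC) = ⊤)
    (hgE : Algebra.adjoin K (Set.range gE) = ⊤)
    (Θ : B →ₐ[K] Matrix J J B) (y : J → C) (hΘ : ∀ i j k, Θ (gB i) j k ∈ wordFiltration K gB 2)
    (hy : ∀ j, y j ∈ wordFiltration K gC 2) (u : ιC → J) (hu : ∀ j, y (u j) = gC j)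
    (fB : B →ₐ[K] E) (fC : C →ₐ[K] E) (eB : ιB → ιE) (eC : ιC → ιE)
    (hfB : ∀ i, fB (gB i) = gE (eB i)) (hfC : ∀ j, fC (gC j) = gE (eC j))
    (he : ∀ k, (∃ i, eB i = k) ∨ ∃ j, eC j = k)
    (hrel : ∀ j i, fC (y j) * fB (gB i) = ∑ k, fB (Θ (gB i) j k) * fC (y k))
    (ρ : E →ₐ[K] Module.End K (B ⊗[K] C))
    (hρB : ∀ i, ρ (gE (eB i)) = Algebra.lsmul K K (B ⊗[K] C) (gB i))
    (hρC : ∀ j, ρ (gE (eC j)) = crossOp Θ y (u j)) :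
    HasPBW K gE fun x : X × Y => ℓB x.1 + ℓC x.2 := by
  obtain ⟨bB, hbB⟩ := hB
  obtain ⟨bC, hbC⟩ := hC
  -- The exchange rule extends from generators to all of `B` because `Θ` is multiplicative.
  have hrel' : ∀ b j, fC (y j) * fB b = ∑ k, fB (Θ b j k) * fC (y k) := by
    refine induction_of_adjoin hgB (fun j => ?_) (fun a b ha hb j => ?_) (fun r a ha j => ?_)
      (fun i a ha j => ?_)
    · rw [map_one, map_one, mul_one, Finset.sum_eq_single j]
      · simp
      · intro k _ hk
        simp [Matrix.one_apply_ne hk.symm]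
      · simp
    · simp only [map_add, mul_add, ha, hb, Matrix.add_apply, add_mul, Finset.sum_add_distrib]
    · simp only [map_smul, mul_smul_comm, ha, Matrix.smul_apply, smul_mul_assoc, Finset.smul_sum]
    · simp only [map_mul, ← mul_assoc, hrel, Finset.sum_mul, Matrix.mul_apply, map_sum]
      rw [Finset.sum_comm]
      refine Finset.sum_congr rfl fun k _ => ?_
      simp only [mul_assoc, ha k, Finset.mul_sum]
  let μ : B ⊗[K] C →ₗ[K] E := LinearMap.mul' K E ∘ₗ TensorProduct.map fB.toLinearMap fC.toLinearMap
  have hμ : ∀ b c, μ (b ⊗ₜ c) = fB b * fC c := fun b c => by simp [μ]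
  -- The multiplication map intertwines `ρ` with left multiplication on `E`; at `v = 1 ⊗ₜ 1` this
  -- shows that it is surjective.
  have hact : ∀ e v, e * μ v = μ (ρ e v) := by
    refine induction_of_adjoin hgE (fun v => by simp)
      (fun a b ha hb v => by simp only [add_mul, ha, hb, map_add, LinearMap.add_apply])
      (fun r a ha v => by
        rw [smul_mul_assoc, ha, map_smul, LinearMap.smul_apply, map_smul])
      (fun k a ha v => ?_)
    rw [mul_assoc, ha, map_mul, Module.End.mul_apply]
    induction ρ a v using TensorProduct.induction_on with
    | zero => simp
    | add x y hx hy => simp only [map_add, mul_add, hx, hy]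
    | tmul b c =>
      rcases he k with ⟨i, rfl⟩ | ⟨j, rfl⟩
      · rw [hρB, lsmul_tmul, hμ, hμ, map_mul, hfB,
          mul_assoc]
      · rw [hρC, crossOp_tmul, map_sum, hμ, ← hfC, ← hu, ← mul_assoc, hrel', Finset.sum_mul]
        simp only [hμ, map_mul, mul_assoc]
  let Φ : E →ₗ[K] B ⊗[K] C := (LinearMap.applyₗ (1 ⊗ₜ 1)) ∘ₗ ρ.toLinearMap
  have hΦ : ∀ e, Φ e = ρ e (1 ⊗ₜ 1) := fun e => rfl
  have hρfB : ∀ b, ρ (fB b) = Algebra.lsmul K K (B ⊗[K] C) b := by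
    intro b
    refine AlgHom.congr_fun (φ₁ := ρ.comp fB) (AlgHom.ext_of_adjoin_eq_top hgB ?_) b
    rintro _ ⟨i, rfl⟩
    simp only [AlgHom.comp_apply, hfB, hρB]
  have hρfC : ∀ c, ρ (fC c) (1 ⊗ₜ 1) = 1 ⊗ₜ c := by
    refine induction_of_adjoin hgC (by simp) (fun a b ha hb => ?_) (fun r a ha => ?_)
      (fun j a ha => ?_)
    · rw [map_add, map_add, LinearMap.add_apply, ha, hb, TensorProduct.tmul_add]
    · rw [map_smul, map_smul, LinearMap.smul_apply, ha, TensorProduct.tmul_smul]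
    · rw [map_mul, map_mul, Module.End.mul_apply, ha, hfC, hρC, crossOp_one_tmul, hu]
  -- Evaluation of `ρ` at `1 ⊗ₜ 1` inverts `μ`: one composite is `hact`, the other holds since `fC
  -- c` creates `1 ⊗ₜ c` and `fB b` then multiplies the left factor.
  let e : B ⊗[K] C ≃ₗ[K] E := LinearEquiv.ofLinearMap μ Φ
    (LinearMap.ext fun a => by
      simp only [LinearMap.comp_apply, hΦ, ← hact, LinearMap.id_apply, hμ, map_one, mul_one])
    (TensorProduct.ext' fun b c => by
      simp only [LinearMap.comp_apply, hΦ, LinearMap.id_apply, hμ, map_mul, Module.End.mul_apply,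
        hρfC, hρfB, Algebra.lsmul_coe, TensorProduct.smul_tmul', smul_eq_mul, mul_one])
  have hbB' : ∀ x, bB x ∈ wordFiltration K gB (ℓB x + 1) := fun x => by
    rw [hbB]; exact Submodule.subset_span ⟨x, Nat.lt_succ_self _, rfl⟩
  have hbC' : ∀ x, bC x ∈ wordFiltration K gC (ℓC x + 1) := fun x => by
    rw [hbC]; exact Submodule.subset_span ⟨x, Nat.lt_succ_self _, rfl⟩
  refine ⟨(bB.tensorProduct bC).map e, fun n => le_antisymm ?_ ?_⟩
  -- The span of low-degree basis vectors is stable under generators: one from `B` raises the degree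
  -- of the left factor by one, one from `C` that of the right factor by at most one, while the
  -- crossing does not raise the left degree.
  · have hspan : ∀ n, Submodule.span K
        (((bB.tensorProduct bC).map e) '' {x : X × Y | ℓB x.1 + ℓC x.2 < n}) =
        (Submodule.span K ((bB.tensorProduct bC) '' {x : X × Y | ℓB x.1 + ℓC x.2 < n})).map μ := by
      intro n
      rw [Submodule.map_span, ← Set.image_comp]
      rfl
    simp only [hspan]
    refine wordFiltration_le_of_stable gE (fun n => Submodule.map μ (Submodule.span K
      ((bB.tensorProduct bC) '' {x : X × Y | ℓB x.1 + ℓC x.2 < n}))) (fun n => ?_)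
      (fun n k a ha => ?_) n
    · refine ⟨1 ⊗ₜ 1, tmul_mem_span bB bC hbB hbC (i := 0) (j := 0) (by omega)
        (one_mem_wordFiltration gB 0) (one_mem_wordFiltration gC 0), by simp [hμ]⟩
    · obtain ⟨v, hv, rfl⟩ := ha
      rw [hact]
      refine Submodule.mem_map_of_mem ?_
      induction hv using Submodule.span_induction with
      | zero => simp
      | add x y _ _ hx hy => rw [map_add]; exact add_mem hx hy
      | smul r x _ hx => rw [map_smul]; exact Submodule.smul_mem _ _ hx
      | mem v hv =>
        obtain ⟨⟨x, y'⟩, hxy, rfl⟩ := hv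
        simp only [Set.mem_ofPred_eq] at hxy
        rw [Module.Basis.tensorProduct_apply]
        rcases he k with ⟨i, rfl⟩ | ⟨j, rfl⟩
        · rw [hρB, lsmul_tmul]
          exact tmul_mem_span bB bC hbB hbC (i := 1 + ℓB x) (j := ℓC y') (by omega)
            (mul_mem_wordFiltration gB (m := 1) (gen_mem_wordFiltration gB i) (hbB' x)) (hbC' y')
        · rw [hρC, crossOp_tmul]
          refine sum_mem fun l _ => ?_
          exact tmul_mem_span bB bC hbB hbC (i := ℓB x) (j := 1 + ℓC y') (by omega)
            (entry_mem_wordFiltration Θ hΘ (hbB' x) _ _)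
            (mul_mem_wordFiltration gC (m := 1) (hy l) (hbC' y'))
  · refine Submodule.span_le.mpr ?_
    rintro _ ⟨⟨x, y'⟩, hxy, rfl⟩
    have h1 : fB (bB x) ∈ wordFiltration K gE (ℓB x + 1) :=
      wordFiltration_map gB gE fB eB hfB _ ⟨_, hbB' x, rfl⟩
    have h2 : fC (bC y') ∈ wordFiltration K gE (ℓC y' + 1) :=
      wordFiltration_map gC gE fC eC hfC _ ⟨_, hbC' y', rfl⟩
    have h3 : ((bB.tensorProduct bC).map e) (x, y') = fB (bB x) * fC (bC y') := by
      rw [Module.Basis.map_apply, Module.Basis.tensorProduct_apply]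
      exact hμ _ _
    rw [h3]
    exact wordFiltration_mono gE (Nat.succ_le_of_lt hxy) (mul_mem_wordFiltration gE h1 h2)

end Merge

/-! ### Index bookkeeping for products of leg matrices and double sums -/

section LegCoefficients

variable {K : Type*} [Field K] {J : Type} [Fintype J] [DecidableEq J]

theorem leg₂₃_mul_leg₁₂_apply (X Y : Matrix (J × J) (J × J) K) (a b c d e f : J) :
    (leg₂₃ X * leg₁₂ Y) (a, b, c) (d, e, f) = ∑ u, X (b, c) (u, f) * Y (a, u) (d, e) := by
  simp only [Matrix.mul_apply, ← smul_eq_mul (a := leg₂₃ X _ _)]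
  rw [sum_leg₂₃_smul]
  simp [leg₁₂]

theorem leg₁₂_mul_leg₂₃_apply (X Y : Matrix (J × J) (J × J) K) (a b c d e f : J) :
    (leg₁₂ X * leg₂₃ Y) (a, b, c) (d, e, f) = ∑ u, X (a, b) (d, u) * Y (u, c) (e, f) := by
  simp only [Matrix.mul_apply, ← smul_eq_mul (a := leg₁₂ X _ _)]
  rw [sum_leg₁₂_smul]
  simp [leg₂₃, Finset.sum_ite_irrel]

theorem leg₁₂_mul_apply (X : Matrix (J × J) (J × J) K) (N : Matrix (J × J × J) (J × J × J) K)
    (a b c : J) (t : J × J × J) :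
    (leg₁₂ X * N) (a, b, c) t = ∑ u, ∑ v, X (a, b) (u, v) * N (u, v, c) t := by
  simp only [Matrix.mul_apply, ← smul_eq_mul (a := leg₁₂ X _ _)]
  rw [sum_leg₁₂_smul]
  rfl

theorem leg₂₃_mul_apply (X : Matrix (J × J) (J × J) K) (N : Matrix (J × J × J) (J × J × J) K)
    (a b c : J) (t : J × J × J) :
    (leg₂₃ X * N) (a, b, c) t = ∑ u, ∑ v, X (b, c) (u, v) * N (a, u, v) t := by
  simp only [Matrix.mul_apply, ← smul_eq_mul (a := leg₂₃ X _ _)]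
  rw [sum_leg₂₃_smul]
  rfl

theorem mul_leg₁₂_apply (X : Matrix (J × J) (J × J) K) (N : Matrix (J × J × J) (J × J × J) K)
    (a b c : J) (t : J × J × J) :
    (N * leg₁₂ X) t (a, b, c) = ∑ u, ∑ v, X (u, v) (a, b) * N t (u, v, c) := by
  simp only [Matrix.mul_apply, mul_comm (N _ _), ← smul_eq_mul (a := leg₁₂ X _ _)]
  rw [sum_leg₁₂_smul']
  rfl

theorem mul_leg₂₃_apply (X : Matrix (J × J) (J × J) K) (N : Matrix (J × J × J) (J × J × J) K)
    (a b c : J) (t : J × J × J) :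
    (N * leg₂₃ X) t (a, b, c) = ∑ u, ∑ v, X (u, v) (b, c) * N t (a, u, v) := by
  simp only [Matrix.mul_apply, mul_comm (N _ _), ← smul_eq_mul (a := leg₂₃ X _ _)]
  rw [sum_leg₂₃_smul']
  rfl

end LegCoefficients

section SumExchange

variable {K : Type*} [Field K] {V : Type*} [AddCommGroup V] [Module K V]
  {J J' : Type*} [Fintype J] [Fintype J']

theorem sum_sum_smul_comm (c : J → J → K) (d : J → J → J' → J' → K) (v : J' → J' → V) :
    ∑ a, ∑ b, c a b • ∑ x, ∑ y, d a b x y • v x y =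
      ∑ x, ∑ y, (∑ a, ∑ b, c a b * d a b x y) • v x y := by
  simp only [Finset.smul_sum, smul_smul, Finset.sum_smul]
  calc _ = ∑ a, ∑ x, ∑ b, ∑ y, (c a b * d a b x y) • v x y :=
        Finset.sum_congr rfl fun a _ => Finset.sum_comm
    _ = ∑ x, ∑ a, ∑ y, ∑ b, (c a b * d a b x y) • v x y := by
        rw [Finset.sum_comm]
        exact Finset.sum_congr rfl fun x _ => Finset.sum_congr rfl fun a _ => Finset.sum_comm
    _ = _ := Finset.sum_congr rfl fun x _ => Finset.sum_comm

end SumExchange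

/-! ### Quadratic algebras and braided products of their copies -/

section QuadraticAlgebras

variable {K : Type*} [Field K] {J : Type} [Fintype J] [DecidableEq J]

/-- The relations `∑ Q (γ, δ) (α, β) x_γ x_δ = 0` of a quadratic algebra. -/
inductive QuadRel (Q : Matrix (J × J) (J × J) K) : FreeAlgebra K J → FreeAlgebra K J → Prop
  | mk (α β : J) : QuadRel Q
      (∑ γ, ∑ δ, Q (γ, δ) (α, β) • (FreeAlgebra.ι K γ * FreeAlgebra.ι K δ)) 0

/-- The quadratic algebra with relations `QuadRel Q`. -/
def Quad (Q : Matrix (J × J) (J × J) K) : Type _ := RingQuot (QuadRel Q)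

noncomputable instance (Q : Matrix (J × J) (J × J) K) : Ring (Quad Q) :=
  inferInstanceAs (Ring (RingQuot (QuadRel Q)))

noncomputable instance (Q : Matrix (J × J) (J × J) K) : Algebra K (Quad Q) :=
  inferInstanceAs (Algebra K (RingQuot (QuadRel Q)))

/-- The projection from the free algebra. -/
noncomputable def Quad.mk (Q : Matrix (J × J) (J × J) K) : FreeAlgebra K J →ₐ[K] Quad Q :=
  RingQuot.mkAlgHom K (QuadRel Q)

/-- The generators of `Quad Q`. -/
noncomputable def Quad.gen (Q : Matrix (J × J) (J × J) K) (α : J) : Quad Q :=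
  Quad.mk Q (FreeAlgebra.ι K α)

theorem Quad.adjoin_gen (Q : Matrix (J × J) (J × J) K) :
    Algebra.adjoin K (Set.range (Quad.gen Q)) = ⊤ := adjoin_ringQuot _

theorem Quad.rel (Q : Matrix (J × J) (J × J) K) (α β : J) :
    ∑ γ, ∑ δ, Q (γ, δ) (α, β) • (Quad.gen Q γ * Quad.gen Q δ) = 0 := by
  have h : Quad.mk Q _ = Quad.mk Q _ := RingQuot.mkAlgHom_rel K (QuadRel.mk (Q := Q) α β)
  simpa [Quad.gen] using h

theorem Quad.exists_lift (Q : Matrix (J × J) (J × J) K) {A : Type*} [Ring A] [Algebra K A]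
    (x : J → A) (h : ∀ α β, ∑ γ, ∑ δ, Q (γ, δ) (α, β) • (x γ * x δ) = 0) :
    ∃ f : Quad Q →ₐ[K] A, ∀ α, f (Quad.gen Q α) = x α := by
  have hx : ∀ ⦃a b⦄, QuadRel Q a b → FreeAlgebra.lift K x a = FreeAlgebra.lift K x b := by
    rintro _ _ ⟨α, β⟩
    simpa using h α β
  exact ⟨RingQuot.liftAlgHom K ⟨FreeAlgebra.lift K x, hx⟩, fun α =>
    (RingQuot.liftAlgHom_mkAlgHom_apply K _ hx _).trans (FreeAlgebra.lift_ι_apply _ _)⟩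

/-- The relations of the braided product of `n` copies of `Quad Q`: each copy satisfies the
relations of `Quad Q`, and the copies are reordered by means of `Z`. -/
inductive BlockRel (Z Q : Matrix (J × J) (J × J) K) (n : ℕ) :
    FreeAlgebra K (J × Fin n) → FreeAlgebra K (J × Fin n) → Prop
  | same (α β : J) (a : Fin n) : BlockRel Z Q n
      (∑ γ, ∑ δ, Q (γ, δ) (α, β) • (FreeAlgebra.ι K (γ, a) * FreeAlgebra.ι K (δ, a))) 0
  | cross (α β : J) (a b : Fin n) (h : a < b) : BlockRel Z Q n
      (FreeAlgebra.ι K (α, b) * FreeAlgebra.ι K (β, a))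
      (∑ γ, ∑ δ, Z (γ, δ) (α, β) • (FreeAlgebra.ι K (γ, a) * FreeAlgebra.ι K (δ, b)))

/-- The braided product of `n` copies of `Quad Q`. -/
def Block (Z Q : Matrix (J × J) (J × J) K) (n : ℕ) : Type _ := RingQuot (BlockRel Z Q n)

noncomputable instance (Z Q : Matrix (J × J) (J × J) K) (n : ℕ) : Ring (Block Z Q n) :=
  inferInstanceAs (Ring (RingQuot (BlockRel Z Q n)))

noncomputable instance (Z Q : Matrix (J × J) (J × J) K) (n : ℕ) : Algebra K (Block Z Q n) :=
  inferInstanceAs (Algebra K (RingQuot (BlockRel Z Q n)))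

/-- The projection from the free algebra. -/
noncomputable def Block.mk (Z Q : Matrix (J × J) (J × J) K) (n : ℕ) :
    FreeAlgebra K (J × Fin n) →ₐ[K] Block Z Q n :=
  RingQuot.mkAlgHom K (BlockRel Z Q n)

/-- The generators of `Block Z Q n`. -/
noncomputable def Block.gen (Z Q : Matrix (J × J) (J × J) K) (n : ℕ) (i : J × Fin n) :
    Block Z Q n :=
  Block.mk Z Q n (FreeAlgebra.ι K i)

variable (Z Q : Matrix (J × J) (J × J) K) (n : ℕ)

theorem Block.adjoin_gen : Algebra.adjoin K (Set.range (Block.gen Z Q n)) = ⊤ :=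
  adjoin_ringQuot _

theorem Block.rel_same (α β : J) (a : Fin n) :
    ∑ γ, ∑ δ, Q (γ, δ) (α, β) • (Block.gen Z Q n (γ, a) * Block.gen Z Q n (δ, a)) = 0 := by
  have h : Block.mk Z Q n _ = Block.mk Z Q n _ :=
    RingQuot.mkAlgHom_rel K (BlockRel.same (Z := Z) (Q := Q) α β a)
  simpa [Block.gen] using h

theorem Block.rel_cross (α β : J) {a b : Fin n} (h : a < b) :
    Block.gen Z Q n (α, b) * Block.gen Z Q n (β, a) =
      ∑ γ, ∑ δ, Z (γ, δ) (α, β) • (Block.gen Z Q n (γ, a) * Block.gen Z Q n (δ, b)) := by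
  have h : Block.mk Z Q n _ = Block.mk Z Q n _ :=
    RingQuot.mkAlgHom_rel K (BlockRel.cross (Z := Z) (Q := Q) α β a b h)
  simpa [Block.gen] using h

theorem Block.exists_lift {A : Type*} [Ring A] [Algebra K A] (x : J × Fin n → A)
    (h : ∀ α β a, ∑ γ, ∑ δ, Q (γ, δ) (α, β) • (x (γ, a) * x (δ, a)) = 0)
    (h' : ∀ α β a b, a < b → x (α, b) * x (β, a) =
      ∑ γ, ∑ δ, Z (γ, δ) (α, β) • (x (γ, a) * x (δ, b))) :
    ∃ f : Block Z Q n →ₐ[K] A, ∀ i, f (Block.gen Z Q n i) = x i := by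
  have hx : ∀ ⦃a b⦄, BlockRel Z Q n a b → FreeAlgebra.lift K x a = FreeAlgebra.lift K x b := by
    rintro _ _ (⟨α, β, a⟩ | ⟨α, β, a, b, hab⟩)
    · simpa using h α β a
    · simpa using h' α β a b hab
  exact ⟨RingQuot.liftAlgHom K ⟨FreeAlgebra.lift K x, hx⟩, fun α =>
    (RingQuot.liftAlgHom_mkAlgHom_apply K _ hx _).trans (FreeAlgebra.lift_ι_apply _ _)⟩

end QuadraticAlgebras

/-! ### The crossing that adjoins one more copy -/

section BlockCrossing

variable {K : Type*} [Field K] {J : Type} [Fintype J] [DecidableEq J]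
  {A : Type*} [Ring A] [Algebra K A]

/-- The crossing matrix of an element with components `f`. -/
def blockTheta (Z : Matrix (J × J) (J × J) K) (f : J → A) (β : J) : Matrix J J A :=
  Matrix.of fun α δ => ∑ γ, Z (γ, δ) (α, β) • f γ

variable (Z : Matrix (J × J) (J × J) K) (f g : J → A)

theorem blockTheta_mul (β₁ β₂ α δ : J) :
    (blockTheta Z f β₁ * blockTheta Z g β₂) α δ =
      ∑ γ₁, ∑ γ₂, (leg₂₃ Z * leg₁₂ Z) (γ₁, γ₂, δ) (α, β₁, β₂) • (f γ₁ * g γ₂) := by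
  simp only [leg₂₃_mul_leg₁₂_apply, Finset.sum_smul]
  simp only [blockTheta, Matrix.mul_apply, Matrix.of_apply, Finset.sum_mul_sum,
    smul_mul_smul_comm]
  rw [Finset.sum_comm]
  refine Finset.sum_congr rfl fun γ₁ _ => ?_
  rw [Finset.sum_comm]
  simp only [mul_comm]

theorem sum_smul_blockTheta_mul (Q : Matrix (J × J) (J × J) K) (t₁ t₂ α δ : J) :
    ∑ β₁, ∑ β₂, Q (β₁, β₂) (t₁, t₂) • (blockTheta Z f β₁ * blockTheta Z g β₂) α δ =
      ∑ γ₁, ∑ γ₂, (leg₂₃ Z * leg₁₂ Z * leg₂₃ Q) (γ₁, γ₂, δ) (α, t₁, t₂) • (f γ₁ * g γ₂) := by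
  simp only [blockTheta_mul, mul_leg₂₃_apply]
  exact sum_sum_smul_comm (fun β₁ β₂ => Q (β₁, β₂) (t₁, t₂))
    (fun β₁ β₂ γ₁ γ₂ => (leg₂₃ Z * leg₁₂ Z) (γ₁, γ₂, δ) (α, β₁, β₂)) fun γ₁ γ₂ => f γ₁ * g γ₂

theorem sum_leg₁₂_mul_smul (Q : Matrix (J × J) (J × J) K) (N : Matrix (J × J × J) (J × J × J) K)
    (δ : J) (t : J × J × J) :
    ∑ γ₁, ∑ γ₂, (leg₁₂ Q * N) (γ₁, γ₂, δ) t • (f γ₁ * g γ₂) =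
      ∑ u, ∑ v, N (u, v, δ) t • ∑ γ₁, ∑ γ₂, Q (γ₁, γ₂) (u, v) • (f γ₁ * g γ₂) := by
  rw [sum_sum_smul_comm (fun u v => N (u, v, δ) t) (fun u v γ₁ γ₂ => Q (γ₁, γ₂) (u, v))
    fun γ₁ γ₂ => f γ₁ * g γ₂]
  simp only [leg₁₂_mul_apply, mul_comm]

theorem sum_leg₂₃_mul_smul (Q : Matrix (J × J) (J × J) K) (N : Matrix (J × J × J) (J × J × J) K)
    (δ : J) (t : J × J × J) :
    ∑ γ₁, ∑ γ₂, (leg₂₃ Q * N) (δ, γ₁, γ₂) t • (f γ₁ * g γ₂) =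
      ∑ u, ∑ v, N (δ, u, v) t • ∑ γ₁, ∑ γ₂, Q (γ₁, γ₂) (u, v) • (f γ₁ * g γ₂) := by
  rw [sum_sum_smul_comm (fun u v => N (δ, u, v) t) (fun u v γ₁ γ₂ => Q (γ₁, γ₂) (u, v))
    fun γ₁ γ₂ => f γ₁ * g γ₂]
  simp only [leg₂₃_mul_apply, mul_comm]

/-- Sliding carries `Q` from the legs of the upper indices of the crossing to the legs contracted
with $f\,g$, where the relation annihilates it. -/
theorem blockTheta_same {Z Q : Matrix (J × J) (J × J) K} (hQ : Slides Z Q) {f g : J → A}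
    (h : ∀ α β, ∑ γ, ∑ δ, Q (γ, δ) (α, β) • (f γ * g δ) = 0) (α β : J) :
    ∑ γ, ∑ δ, Q (γ, δ) (α, β) • (blockTheta Z f γ * blockTheta Z g δ) = 0 := by
  ext ε ζ
  have := sum_smul_blockTheta_mul Z f g Q α β ε ζ
  rw [hQ.snd, sum_leg₁₂_mul_smul] at this
  simp only [h, smul_zero, Finset.sum_const_zero] at this
  simpa only [Matrix.sum_apply, Matrix.smul_apply, Matrix.zero_apply] using this

/-- The reordering rule between different copies survives the crossing by Yang–Baxter, that is, by
sliding `Z` through itself. -/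
theorem blockTheta_cross {Z : Matrix (J × J) (J × J) K} (hZ : IsBraid Z) {f g : J → A}
    (h : ∀ α β, g α * f β = ∑ γ, ∑ δ, Z (γ, δ) (α, β) • (f γ * g δ)) (α β : J) :
    blockTheta Z g α * blockTheta Z f β =
      ∑ γ, ∑ δ, Z (γ, δ) (α, β) • (blockTheta Z f γ * blockTheta Z g δ) := by
  ext ε ζ
  simp only [Matrix.sum_apply, Matrix.smul_apply]
  rw [sum_smul_blockTheta_mul, hZ.slides.snd, sum_leg₁₂_mul_smul, blockTheta_mul]
  simp only [h]

/-- Moving a quadratic expression in the `y` past the `x`. -/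
theorem block_quadratic_mul {Z Q : Matrix (J × J) (J × J) K} (hQ : Slides Z Q) {x y : J → A}
    (h : ∀ α β, y α * x β = ∑ γ, ∑ δ, Z (γ, δ) (α, β) • (x γ * y δ)) (α β ε : J) :
    (∑ γ, ∑ δ, Q (γ, δ) (α, β) • (y γ * y δ)) * x ε =
      ∑ κ, x κ * ∑ u, ∑ v, (leg₁₂ Z * leg₂₃ Z) (κ, u, v) (α, β, ε) •
        ∑ γ, ∑ δ, Q (γ, δ) (u, v) • (y γ * y δ) := by
  have h1 : ∀ γ δ, y γ * y δ * x ε =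
      ∑ κ, x κ * ∑ u, ∑ v, (leg₁₂ Z * leg₂₃ Z) (κ, u, v) (γ, δ, ε) • (y u * y v) := by
    intro γ δ
    simp only [mul_assoc, h, Finset.mul_sum, mul_smul_comm, leg₁₂_mul_leg₂₃_apply]
    simp only [← mul_assoc, h, Finset.sum_mul, Finset.smul_sum, smul_mul_assoc, smul_smul,
      Finset.sum_smul]
    calc _ = ∑ w, ∑ κ, ∑ v, ∑ u, (Z (w, v) (δ, ε) * Z (κ, u) (γ, w)) • (x κ * y u * y v) :=
          Finset.sum_congr rfl fun w _ => Finset.sum_comm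
      _ = ∑ κ, ∑ w, ∑ u, ∑ v, (Z (w, v) (δ, ε) * Z (κ, u) (γ, w)) • (x κ * y u * y v) := by
          rw [Finset.sum_comm]
          exact Finset.sum_congr rfl fun _ _ => Finset.sum_congr rfl fun _ _ => Finset.sum_comm
      _ = ∑ κ, ∑ u, ∑ v, ∑ w, (Z (w, v) (δ, ε) * Z (κ, u) (γ, w)) • (x κ * y u * y v) := by
          refine Finset.sum_congr rfl fun _ _ => ?_
          rw [Finset.sum_comm]
          exact Finset.sum_congr rfl fun _ _ => Finset.sum_comm
      _ = _ := by simp only [mul_comm]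
  simp only [← sum_leg₂₃_mul_smul, ← hQ.fst, mul_leg₁₂_apply]
  have h2 := fun κ => sum_sum_smul_comm (fun γ δ => Q (γ, δ) (α, β))
    (fun γ δ u v => (leg₁₂ Z * leg₂₃ Z) (κ, u, v) (γ, δ, ε)) (fun u v => y u * y v)
  simp only [← h2, Finset.sum_mul, smul_mul_assoc, h1, Finset.smul_sum (N := A), Finset.mul_sum,
    mul_smul_comm]
  calc _ = ∑ γ, ∑ κ, ∑ δ, _ := Finset.sum_congr rfl fun γ _ => Finset.sum_comm
    _ = _ := Finset.sum_comm

end BlockCrossing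

/-! ### Adapted bases of braided products -/

section BlockPBW

variable {K : Type*} [Field K] {J : Type} [Fintype J] [DecidableEq J]

/-- Index set of a product basis. -/
def PowIdx (X : Type) : ℕ → Type
  | 0 => PUnit
  | n + 1 => PowIdx X n × X

/-- Degree of the elements of a product basis. -/
def powDeg {X : Type} (ℓ : X → ℕ) : (n : ℕ) → PowIdx X n → ℕ
  | 0, _ => 0
  | n + 1, x => powDeg ℓ n x.1 + ℓ x.2

theorem hasPBW_block_zero (Z Q : Matrix (J × J) (J × J) K) {X : Type} (ℓ : X → ℕ) :
    HasPBW K (Block.gen Z Q 0) (powDeg ℓ 0) := by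
  have h0 : HasPBW K (fun i : J × Fin 0 => (i.2.elim0 : K)) (powDeg ℓ 0) := by
    refine ⟨Module.Basis.singleton PUnit K, fun n => ?_⟩
    rcases n with _ | n
    · simp [wordFiltration, powDeg]
    · have : (1 : K) ∈ wordFiltration K (fun i : J × Fin 0 => (i.2.elim0 : K)) (n + 1) :=
        one_mem_wordFiltration _ n
      have h1 : wordFiltration K (fun i : J × Fin 0 => (i.2.elim0 : K)) (n + 1) = ⊤ := by
        refine eq_top_iff.mpr fun x _ => ?_
        simpa using Submodule.smul_mem _ x this
      rw [h1, eq_comm, eq_top_iff]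
      intro x _
      have : (1 : K) ∈ Submodule.span K
          (Module.Basis.singleton PUnit K '' {x | powDeg ℓ 0 x < n + 1}) :=
        Submodule.subset_span ⟨PUnit.unit, by simp [powDeg], by simp⟩
      have hx := Submodule.smul_mem _ x this
      rw [smul_eq_mul, mul_one] at hx
      exact hx
  obtain ⟨f, hf⟩ := Block.exists_lift Z Q 0 (fun i => (i.2.elim0 : K)) (fun _ _ a => a.elim0)
    (fun _ _ a => a.elim0)
  refine h0.of_algHoms (Algebra.ofId K _) f (Equiv.refl _) (fun i => i.2.elim0)
    (fun i => i.2.elim0) ?_ (Block.adjoin_gen Z Q 0)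
  exact Subsingleton.elim _ _

theorem sum_blockTheta_mul {B : Type*} [Ring B] [Algebra K B] (Z : Matrix (J × J) (J × J) K)
    {E : Type*} [Ring E] [Algebra K E] (f : B →ₐ[K] E) (x : J → B)
    (y : J → E) (α β : J) : ∑ δ, f (blockTheta Z x β α δ) * y δ =
      ∑ γ, ∑ δ, Z (γ, δ) (α, β) • (f (x γ) * y δ) := by
  simp only [blockTheta, Matrix.of_apply, map_sum, map_smul, Finset.sum_mul, smul_mul_assoc]
  exact Finset.sum_comm

/-- The new copy is adjoined by a crossing. The essential check is that its operators satisfy the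
relations `Q` on the whole tensor product: they do on $1\otimes C$, and moving such a relation past
a generator of the earlier copies gives combinations of the same relations. -/
theorem hasPBW_block_succ {Z Q : Matrix (J × J) (J × J) K} (hZ : IsBraid Z) (hQ : Slides Z Q)
    {n : ℕ} {X Y : Type*} {ℓ : X → ℕ} {ℓ' : Y → ℕ} (h : HasPBW K (Block.gen Z Q n) ℓ)
    (h' : HasPBW K (Quad.gen Q) ℓ') :
    HasPBW K (Block.gen Z Q (n + 1)) fun x : X × Y => ℓ x.1 + ℓ' x.2 := by
  obtain ⟨Θ, hΘ⟩ := Block.exists_lift Z Q n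
    (fun i => blockTheta Z (fun γ => Block.gen Z Q n (γ, i.2)) i.1)
    (fun α β a => blockTheta_same hQ (fun γ δ => Block.rel_same Z Q n γ δ a) α β)
    (fun α β a b hab => blockTheta_cross hZ (fun γ δ => Block.rel_cross Z Q n γ δ hab) α β)
  obtain ⟨fB, hfB⟩ := Block.exists_lift Z Q n (fun i => Block.gen Z Q (n + 1) (i.1, i.2.castSucc))
    (fun α β a => Block.rel_same Z Q (n + 1) α β a.castSucc)
    (fun α β a b hab => Block.rel_cross Z Q (n + 1) α β (Fin.castSucc_lt_castSucc_iff.mpr hab))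
  obtain ⟨fC, hfC⟩ := Quad.exists_lift Q (fun α => Block.gen Z Q (n + 1) (α, Fin.last n))
    (fun α β => Block.rel_same Z Q (n + 1) α β (Fin.last n))
  let Y := crossOp Θ (Quad.gen Q)
  let X : J × Fin n → Module.End K (Block Z Q n ⊗[K] Quad Q) :=
    fun i => Algebra.lsmul K K _ (Block.gen Z Q n i)
  have hYX : ∀ α β a, Y α * X (β, a) = ∑ γ, ∑ δ, Z (γ, δ) (α, β) • (X (γ, a) * Y δ) := by
    intro α β a
    simp only [X, Y]
    rw [crossOp_mul_lsmul, hΘ]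
    exact sum_blockTheta_mul Z
      (Algebra.lsmul K K (Block Z Q n ⊗[K] Quad Q) :
        Block Z Q n →ₐ[K] Module.End K (Block Z Q n ⊗[K] Quad Q))
      (fun γ => Block.gen Z Q n (γ, a)) _ α β
  have hYY : ∀ α β, ∑ γ, ∑ δ, Q (γ, δ) (α, β) • (Y γ * Y δ) = 0 := by
    intro α β
    refine crossOp_relation (Block.adjoin_gen Z Q n)
      (fun t : J × J => ∑ γ, ∑ δ, Q (γ, δ) t • (Y γ * Y δ)) (fun t c => ?_)
      (fun t i t' => ∑ κ, (leg₁₂ Z * leg₂₃ Z) (κ, t'.1, t'.2) (t.1, t.2, i.1) •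
        Block.gen Z Q n (κ, i.2)) (fun t i => ?_) (α, β)
    · have := congrArg (fun z => (1 : Block Z Q n) ⊗ₜ[K] (z * c)) (Quad.rel Q t.1 t.2)
      simp only [zero_mul, TensorProduct.tmul_zero, Finset.sum_mul, TensorProduct.tmul_sum,
        smul_mul_assoc, TensorProduct.tmul_smul, mul_assoc] at this
      simp only [LinearMap.sum_apply, LinearMap.smul_apply, Module.End.mul_apply, Y,
        crossOp_one_tmul]
      exact this
    · rw [block_quadratic_mul hQ (fun α β => hYX α β i.2), Fintype.sum_prod_type]
      obtain ⟨W, hW⟩ : ∃ W : J × J → Module.End K (Block Z Q n ⊗[K] Quad Q),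
        ∀ t, W t = ∑ γ, ∑ δ, Q (γ, δ) t • (Y γ * Y δ) := ⟨_, fun _ => rfl⟩
      simp only [← hW, map_sum, map_smul, Finset.sum_mul, smul_mul_assoc, Finset.mul_sum,
        mul_smul_comm]
      rw [Finset.sum_comm]
      exact Finset.sum_congr rfl fun u _ => Finset.sum_comm
  obtain ⟨ρ, hρ⟩ := Block.exists_lift Z Q (n + 1)
    (fun i => Fin.lastCases (motive := fun _ => Module.End K (Block Z Q n ⊗[K] Quad Q))
      (Y i.1) (fun a => X (i.1, a)) i.2)
    (fun α β a => by
      refine Fin.lastCases ?_ (fun a => ?_) a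
      · simpa using hYY α β
      · simp only [Fin.lastCases_castSucc, X, ← map_mul, ← map_smul, ← map_sum,
          Block.rel_same, map_zero])
    (fun α β a b => by
      refine Fin.lastCases ?_ (fun b => ?_) b
      · refine Fin.lastCases (fun h => absurd h (lt_irrefl _)) (fun a _ => ?_) a
        simpa using hYX α β a
      · refine Fin.lastCases (fun h => absurd h (Fin.castSucc_lt_last b).not_gt) (fun a h => ?_) a
        simp only [Fin.lastCases_castSucc, X, ← map_mul, ← map_smul, ← map_sum,
          Block.rel_cross Z Q n α β (Fin.castSucc_lt_castSucc_iff.mp h)])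
  refine h.crossedProduct h' (Block.adjoin_gen Z Q n) (Quad.adjoin_gen Q)
    (Block.adjoin_gen Z Q (n + 1)) Θ (Quad.gen Q) (fun i j k => ?_)
    (gen_mem_wordFiltration _) id (fun _ => rfl) fB fC (fun i => (i.1, i.2.castSucc))
    (fun α => (α, Fin.last n)) hfB hfC (fun k => ?_) (fun j i => ?_) ρ (fun i => ?_) (fun j => ?_)
  · rw [hΘ]
    exact sum_mem fun γ _ => Submodule.smul_mem _ _ (gen_mem_wordFiltration _ _)
  · obtain ⟨α, a⟩ := k
    refine Fin.lastCases (Or.inr ⟨α, rfl⟩) (fun a => Or.inl ⟨(α, a), rfl⟩) a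
  · rw [hΘ, hfC, hfB, Block.rel_cross Z Q (n + 1) _ _ (Fin.castSucc_lt_last i.2)]
    simp only [hfC]
    rw [sum_blockTheta_mul]
    simp only [hfB]
  · rw [hρ]; simp [X]
  · rw [hρ]; simp [Y]

theorem hasPBW_block {Z Q : Matrix (J × J) (J × J) K} (hZ : IsBraid Z) (hQ : Slides Z Q)
    {X : Type} {ℓ : X → ℕ} (h : HasPBW K (Quad.gen Q) ℓ) :
    ∀ n, HasPBW K (Block.gen Z Q n) (powDeg ℓ n)
  | 0 => hasPBW_block_zero Z Q ℓ
  | n + 1 => hasPBW_block_succ hZ hQ (hasPBW_block hZ hQ h n) h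

end BlockPBW

/-! ### Quadratic algebras with the same relations -/

section QuadTransfer

variable {K : Type*} [Field K] {J J' : Type} [Fintype J] [DecidableEq J] [Fintype J']
  [DecidableEq J']

theorem sum_mul_apply_smul {V : Type*} [AddCommGroup V] [Module K V]
    (A B : Matrix (J × J) (J × J) K) (t : J × J) (f : J → J → V) :
    ∑ γ, ∑ δ, (A * B) (γ, δ) t • f γ δ =
      ∑ κ, ∑ μ, B (κ, μ) t • ∑ γ, ∑ δ, A (γ, δ) (κ, μ) • f γ δ := by
  rw [sum_sum_smul_comm (fun κ μ => B (κ, μ) t) (fun κ μ γ δ => A (γ, δ) (κ, μ)) f]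
  simp only [Matrix.mul_apply, Fintype.sum_prod_type, mul_comm]

theorem sum_one_apply_smul {V : Type*} [AddCommGroup V] [Module K V] (α β : J) (f : J → J → V) :
    ∑ γ, ∑ δ, (1 : Matrix (J × J) (J × J) K) (γ, δ) (α, β) • f γ δ = f α β := by
  simp only [Matrix.one_apply, Prod.mk.injEq, ite_and, ite_smul, one_smul, zero_smul]
  simp

theorem quadRel_mul {A : Type*} [Ring A] [Algebra K A] {Q : Matrix (J × J) (J × J) K} {x : J → A}
    (h : ∀ α β, ∑ γ, ∑ δ, Q (γ, δ) (α, β) • (x γ * x δ) = 0) (N : Matrix (J × J) (J × J) K)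
    (α β : J) : ∑ γ, ∑ δ, (Q * N) (γ, δ) (α, β) • (x γ * x δ) = 0 := by
  rw [sum_mul_apply_smul]
  simp [h]

theorem sum_smul_of_exchange {A : Type*} [Ring A] [Algebra K A] {Z : Matrix (J × J) (J × J) K}
    {x y : J → A} (h : ∀ α β, y α * x β = ∑ γ, ∑ δ, Z (γ, δ) (α, β) • (x γ * y δ))
    (B : Matrix (J × J) (J × J) K) (t : J × J) :
    ∑ γ, ∑ δ, B (γ, δ) t • (y γ * x δ) = ∑ γ, ∑ δ, (Z * B) (γ, δ) t • (x γ * y δ) := by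
  simp only [h]
  exact (sum_mul_apply_smul Z B t fun γ δ => x γ * y δ).symm

/-- The columns are the relations, so the two factorisations say that `Q` and `Q'` have the same
column space and define the same algebra. -/
theorem hasPBW_quad_of_eq_mul {Q Q' N N' : Matrix (J × J) (J × J) K} (h : Q = Q' * N)
    (h' : Q' = Q * N') {X : Type*} {ℓ : X → ℕ} (hQ : HasPBW K (Quad.gen Q) ℓ) :
    HasPBW K (Quad.gen Q') ℓ := by
  obtain ⟨f, hf⟩ := Quad.exists_lift Q (Quad.gen Q') (fun α β => by
    rw [h]; exact quadRel_mul (Quad.rel Q') N α β)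
  obtain ⟨f', hf'⟩ := Quad.exists_lift Q' (Quad.gen Q) (fun α β => by
    rw [h']; exact quadRel_mul (Quad.rel Q) N' α β)
  exact hQ.of_algHoms f f' (Equiv.refl _) hf hf' (Quad.adjoin_gen Q) (Quad.adjoin_gen Q')

theorem hasPBW_quad_reindex {Q : Matrix (J × J) (J × J) K} {Q' : Matrix (J' × J') (J' × J') K}
    (e : J ≃ J') (h : ∀ a b c d, Q' (e a, e b) (e c, e d) = Q (a, b) (c, d)) {X : Type*}
    {ℓ : X → ℕ} (hQ : HasPBW K (Quad.gen Q) ℓ) : HasPBW K (Quad.gen Q') ℓ := by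
  obtain ⟨f, hf⟩ := Quad.exists_lift Q (fun α => Quad.gen Q' (e α)) (fun α β => by
    rw [← Quad.rel Q' (e α) (e β), ← e.sum_comp]
    refine Finset.sum_congr rfl fun γ _ => ?_
    rw [← e.sum_comp]
    simp only [h])
  obtain ⟨f', hf'⟩ := Quad.exists_lift Q' (fun α => Quad.gen Q (e.symm α)) (fun α β => by
    obtain ⟨α, rfl⟩ := e.surjective α
    obtain ⟨β, rfl⟩ := e.surjective β
    rw [← Quad.rel Q α β, ← e.sum_comp]
    refine Finset.sum_congr rfl fun γ _ => ?_
    rw [← e.sum_comp]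
    simp only [h, Equiv.symm_apply_apply])
  exact hQ.of_algHoms f f' e hf (fun i => by rw [hf', Equiv.symm_apply_apply])
    (Quad.adjoin_gen Q) (Quad.adjoin_gen Q')

end QuadTransfer

/-! ### One generator: polynomials and dual numbers -/

section OneGenerator

variable {K : Type*} [Field K]

theorem hasPBW_powers {A : Type*} [Ring A] [Algebra K A] (g : A) {X : Type*} {ℓ : X → ℕ}
    (b : Module.Basis X K A) (hb : ∀ x, b x = g ^ ℓ x)
    (hg : ∀ n, g ^ n ∈ Submodule.span K (b '' {x | ℓ x < n + 1})) :
    HasPBW K (fun _ : Fin 1 => g) ℓ := by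
  refine ⟨b, fun n => le_antisymm (Submodule.span_le.mpr ?_) (Submodule.span_le.mpr ?_)⟩
  · rintro _ ⟨l, hl, rfl⟩
    rw [List.map_const', List.prod_replicate]
    exact Submodule.span_mono (Set.image_mono fun x (hx : ℓ x < _) => by
      change ℓ x < n; omega) (hg l.length)
  · rintro _ ⟨x, hx, rfl⟩
    exact Submodule.subset_span ⟨List.replicate (ℓ x) 0, by simpa using hx, by simp [hb]⟩

theorem hasPBW_polynomial :
    HasPBW K (fun _ : Fin 1 => (Polynomial.X : Polynomial K)) (id : ℕ → ℕ) :=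
  hasPBW_powers _ (Polynomial.basisMonomials K)
    (fun n => by simp [Polynomial.X_pow_eq_monomial])
    (fun n => Submodule.subset_span ⟨n, by simp, by simp [Polynomial.X_pow_eq_monomial]⟩)

theorem hasPBW_dualNumber :
    HasPBW K (fun _ : Fin 1 => (DualNumber.eps : DualNumber K)) (Fin.val : Fin 2 → ℕ) := by
  let e : (K × K) ≃ₗ[K] DualNumber K := LinearEquiv.refl K (K × K)
  refine hasPBW_powers _ ((Module.Basis.finTwoProd K).map e) (fun x => ?_) (fun n => ?_)
  · fin_cases x
    · simp; rfl
    · simp; rfl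
  · match n with
    | 0 => exact Submodule.subset_span ⟨0, by simp, by simp; rfl⟩
    | 1 => exact Submodule.subset_span ⟨1, by simp, by simp; rfl⟩
    | n + 2 => rw [pow_add, sq, DualNumber.eps_mul_eps, mul_zero]; exact zero_mem _

theorem Rhat_one (q : K) : Rhat q 1 = q • 1 := by
  ext ⟨a, b⟩ ⟨c, d⟩
  fin_cases a; fin_cases b; fin_cases c; fin_cases d
  simp [Rhat_apply, dcoef, fcoef]

theorem hasPBW_quad_zero : HasPBW K (Quad.gen (0 : Matrix (Fin 1 × Fin 1) (Fin 1 × Fin 1) K))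
    (id : ℕ → ℕ) := by
  obtain ⟨f, hf⟩ := Quad.exists_lift (0 : Matrix (Fin 1 × Fin 1) (Fin 1 × Fin 1) K)
    (fun _ => (Polynomial.X : Polynomial K)) (fun α β => by simp)
  refine hasPBW_polynomial.of_algHoms (Polynomial.aeval (Quad.gen _ 0)) f (Equiv.refl _)
    (fun i => by rw [Subsingleton.elim i 0]; simp)
    (fun i => by rw [hf]) ?_ (Quad.adjoin_gen _)
  rw [Set.range_const]
  exact Polynomial.adjoin_X

theorem hasPBW_quad_smul_one {c : K} (hc : c ≠ 0) :
    HasPBW K (Quad.gen (c • 1 : Matrix (Fin 1 × Fin 1) (Fin 1 × Fin 1) K))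
      (Fin.val : Fin 2 → ℕ) := by
  have hrel := Quad.rel (c • 1 : Matrix (Fin 1 × Fin 1) (Fin 1 × Fin 1) K) 0 0
  simp only [Finset.univ_unique, Fin.default_eq_zero, Finset.sum_singleton, Matrix.smul_apply,
    Matrix.one_apply_eq, smul_eq_mul, mul_one, smul_eq_zero, hc, false_or] at hrel
  obtain ⟨f, hf⟩ := Quad.exists_lift (c • 1 : Matrix (Fin 1 × Fin 1) (Fin 1 × Fin 1) K)
    (fun _ => (DualNumber.eps : DualNumber K)) (fun α β => by simp)
  refine hasPBW_dualNumber.of_algHoms (DualNumber.lift ⟨(Algebra.ofId K _, Quad.gen _ 0),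
    hrel, fun r => (Algebra.commutes r _).symm⟩) f (Equiv.refl _)
    (fun i => by rw [Subsingleton.elim i 0]; simp)
    (fun i => by rw [hf]) ?_ (Quad.adjoin_gen _)
  rw [Set.range_const, ← DualNumber.range_inlAlgHom_sup_adjoin_eps (R := K) (A := K),
    right_eq_sup]
  rintro _ ⟨r, rfl⟩
  exact Subalgebra.algebraMap_mem _ r

end OneGenerator

/-! ### Quantum matrices and the creation algebras -/

section Exchange

variable {K : Type*} [Field K] {M N : ℕ}

theorem sum_tens_smul {V : Type*} [AddCommGroup V] [Module K V]
    (X : Matrix (Fin M × Fin M) (Fin M × Fin M) K) (Y : Matrix (Fin N × Fin N) (Fin N × Fin N) K)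
    (α β : Fin M) (a b : Fin N) (f : Idx M N → Idx M N → V) :
    ∑ C, ∑ D, tens X Y (C, D) ((α, a), (β, b)) • f C D =
      ∑ γ, ∑ δ, X (γ, δ) (α, β) • ∑ c, ∑ d, Y (c, d) (a, b) • f (γ, c) (δ, d) := by
  simp only [tens, Matrix.of_apply, Fintype.sum_prod_type, Finset.smul_sum, smul_smul]
  exact Finset.sum_congr rfl fun γ _ => Finset.sum_comm

theorem sum_sub_smul_one_smul {V : Type*} [AddCommGroup V] [Module K V]
    (X : Matrix (Fin M × Fin M) (Fin M × Fin M) K) (w : K) (f : Fin M → Fin M → V) (α β : Fin M) :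
    ∑ γ, ∑ δ, (X - w • 1) (γ, δ) (α, β) • f γ δ =
      (∑ γ, ∑ δ, X (γ, δ) (α, β) • f γ δ) - w • f α β := by
  simp only [Matrix.sub_apply, sub_smul, Finset.sum_sub_distrib, Matrix.smul_apply, smul_eq_mul,
    mul_smul, ← Finset.smul_sum, sum_one_apply_smul]

theorem sum_smul_matrix_smul {V : Type*} [AddCommGroup V] [Module K V]
    (X : Matrix (Fin M × Fin M) (Fin M × Fin M) K) (s : K) (f : Fin M → Fin M → V)
    (t : Fin M × Fin M) :
    ∑ γ, ∑ δ, (s • X) (γ, δ) t • f γ δ = s • ∑ γ, ∑ δ, X (γ, δ) t • f γ δ := by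
  simp only [Matrix.smul_apply, smul_eq_mul, mul_smul, ← Finset.smul_sum]

theorem sum_exchange_smul {V : Type*} [AddCommGroup V] [Module K V] {s l u v : K}
    (X : Matrix (Fin M × Fin M) (Fin M × Fin M) K)
    {R' : Matrix (Fin N × Fin N) (Fin N × Fin N) K}
    (hR' : ∀ a b c d, R' (c, d) (a, b) =
      (if c = a ∧ d = b then (if a = b then l else if a < b then u else v) else 0)
        + if c = b ∧ d = a then (if a = b then 0 else s) else 0)
    (f : Idx M N → Idx M N → V) (α β : Fin M) (a b : Fin N) :
    ∑ C : Idx M N, ∑ D : Idx M N,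
      (tens X 1 - tens 1 R' : Matrix (Idx M N × Idx M N) (Idx M N × Idx M N) K) (C, D)
        ((α, a), (β, b)) • f C D =
      (∑ γ, ∑ δ, X (γ, δ) (α, β) • f (γ, a) (δ, b)) -
        ((if a = b then l else if a < b then u else v) • f (α, a) (β, b) +
          (if a = b then 0 else s) • f (α, b) (β, a)) := by
  simp only [Matrix.sub_apply, sub_smul, Finset.sum_sub_distrib, sum_tens_smul, sum_one_apply_smul]
  congr 1
  simp only [hR', add_smul, Finset.sum_add_distrib, ite_and, ite_smul, zero_smul]
  simp [Finset.sum_ite_eq']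

/-- A quadratic algebra with `R A₁ A₂ = A₁ A₂ R'` is a braided product of quantum spaces. -/
theorem hasPBW_exchange {q : K} (hq : q ≠ 0) {s l u v : K} (hs : s * s = 1)
    (huv : u + v = q - q⁻¹) (huv' : u * v = 0) {R' : Matrix (Fin N × Fin N) (Fin N × Fin N) K}
    (hR' : ∀ a b c d, R' (c, d) (a, b) =
      (if c = a ∧ d = b then (if a = b then l else if a < b then u else v) else 0)
        + if c = b ∧ d = a then (if a = b then 0 else s) else 0) {X : Type*} {ℓ : X → ℕ}
    (h : HasPBW K (Block.gen (s • (Rhat q M - u • 1)) (Rhat q M - l • 1) N) ℓ) :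
    HasPBW K (Quad.gen (tens (Rhat q M) 1 - tens 1 R')) ℓ := by
  -- Since $u+v=q-q^{-1}$ and $uv=0$, this is the Hecke relation $(\hat R-u)(\hat R-v)=1$. It makes
  -- the relation for $a>b$ a consequence of the one for $a<b$.
  have hmul : (s • (Rhat q M - u • 1)) * (Rhat q M - v • 1) = s • 1 := by
    rw [smul_mul_assoc, sub_mul, mul_sub, mul_sub, Rhat_mul_self hq, ← huv]
    simp only [smul_mul_assoc, one_mul, mul_smul_comm, mul_one, smul_smul, mul_comm v u, huv']
    congr 1
    module
  -- The relation reads $\hat R\,x_ax_a=l\,x_ax_a$ for equal second indices and $\hat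
  -- R\,x_ax_b=u\,x_ax_b+s\,x_bx_a$ for $a<b$; solving the latter for $x_bx_a$ with $s^2=1$ gives
  -- the reordering rule.
  obtain ⟨f, hf⟩ := Block.exists_lift (s • (Rhat q M - u • 1)) (Rhat q M - l • 1) N
    (Quad.gen (tens (Rhat q M) 1 - tens 1 R'))
    (fun α β a => by
      have := Quad.rel (tens (Rhat q M) 1 - tens 1 R') (α, a) (β, a)
      rw [sum_exchange_smul _ hR'] at this
      rw [sum_sub_smul_one_smul, ← this]
      simp)
    (fun α β a b hab => by
      have := Quad.rel (tens (Rhat q M) 1 - tens 1 R') (α, a) (β, b)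
      rw [sum_exchange_smul _ hR', sub_eq_zero, if_neg hab.ne, if_pos hab, if_neg hab.ne] at this
      rw [sum_smul_matrix_smul, sum_sub_smul_one_smul, this, add_sub_cancel_left,
        smul_smul, hs, one_smul])
  obtain ⟨f', hf'⟩ := Quad.exists_lift (tens (Rhat q M) 1 - tens 1 R')
    (Block.gen (s • (Rhat q M - u • 1)) (Rhat q M - l • 1) N)
    (fun ⟨α, a⟩ ⟨β, b⟩ => by
      rw [sum_exchange_smul _ hR', sub_eq_zero]
      rcases lt_trichotomy a b with hab | rfl | hab
      · have := Block.rel_cross (s • (Rhat q M - u • 1)) (Rhat q M - l • 1) N α β hab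
        rw [sum_smul_matrix_smul, sum_sub_smul_one_smul] at this
        rw [if_neg hab.ne, if_pos hab, if_neg hab.ne, this, smul_smul, hs, one_smul]
        abel
      · have := Block.rel_same (s • (Rhat q M - u • 1)) (Rhat q M - l • 1) N α β a
        rw [sum_sub_smul_one_smul, sub_eq_zero] at this
        simpa using this
      · have := fun α β => Block.rel_cross (s • (Rhat q M - u • 1)) (Rhat q M - l • 1) N α β hab
        rw [if_neg hab.ne', if_neg hab.not_gt, if_neg hab.ne', ← sub_eq_iff_eq_add',
          ← sum_sub_smul_one_smul]
        rw [sum_smul_of_exchange this, hmul]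
        rw [sum_smul_matrix_smul, sum_one_apply_smul])
  exact h.of_algHoms f f' (Equiv.refl _) hf hf' (Block.adjoin_gen ..) (Quad.adjoin_gen _)

/-- Quantum matrices have the Poincaré series of their one-dimensional analogue, to the power
`M * N`. -/
theorem hasPBW_quantumMatrix {q : K} (hq : q ≠ 0) {s l u v c : K} (hs : s * s = 1)
    (huv : u + v = q - q⁻¹) (huv' : u * v = 0) (hc : c ≠ 0)
    (hZ : ∀ n, IsBraid (s • (Rhat q n - u • 1)))
    {R' : ∀ n, Matrix (Fin n × Fin n) (Fin n × Fin n) K}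
    (hR' : ∀ n a b e d, R' n (e, d) (a, b) =
      (if e = a ∧ d = b then (if a = b then l else if a < b then u else v) else 0)
        + if e = b ∧ d = a then (if a = b then 0 else s) else 0)
    (hR'c : ∀ n, q • 1 - R' n = c • (Rhat q n - l • 1)) {X : Type} {ℓ : X → ℕ}
    (h : HasPBW K (Quad.gen (Rhat q 1 - l • 1)) ℓ) (M N : ℕ) :
    HasPBW K (Quad.gen (tens (Rhat q M) 1 - tens 1 (R' N)))
      (powDeg (powDeg ℓ M) N) := by
  -- With $Z=s(\hat R-u)$ one has $\hat R-l=sZ+(u-l)$, a polynomial in the braid matrix $Z$.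
  have hQ : ∀ n, Slides (s • (Rhat q n - u • 1)) (Rhat q n - l • 1) := by
    intro n
    have := ((hZ n).slides.smul s).add ((Slides.one (s • (Rhat q n - u • 1))).smul (u - l))
    rw [smul_smul, hs, one_smul] at this
    convert this using 1
    module
  refine hasPBW_exchange hq hs huv huv' (hR' N) (hasPBW_block (hZ M) (hQ M) ?_ N)
  -- The same result for $1\times M$ matrices: as $\hat R_1=q$, the relation matrix is
  -- $1\otimes(q-R'_M)=c\cdot 1\otimes(\hat R_M-l)$, so each single copy is itself a braided product
  -- of $M$ one-generator algebras.
  have h1 := hasPBW_exchange hq hs huv huv' (hR' M) (hasPBW_block (hZ 1) (hQ 1) h M)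
  have h2 : (tens (Rhat q 1) 1 - tens 1 (R' M) :
      Matrix (Idx 1 M × Idx 1 M) (Idx 1 M × Idx 1 M) K) = tens 1 (c • (Rhat q M - l • 1)) := by
    rw [← hR'c, tens_sub_right, Rhat_one, tens_smul_left, tens_smul_right]
  rw [h2] at h1
  have h3 := hasPBW_quad_reindex (Q' := c • (Rhat q M - l • 1)) (Equiv.uniqueProd (Fin M) (Fin 1))
    (fun a b e d => by
      change _ = (1 : Matrix (Fin 1 × Fin 1) (Fin 1 × Fin 1) K) _ _ * _
      rw [Subsingleton.elim (a.1, b.1) (e.1, d.1), Matrix.one_apply_eq, one_mul]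
      rfl) h1
  refine hasPBW_quad_of_eq_mul (N := c • 1) (N' := c⁻¹ • 1) ?_ ?_ h3
  · simp
  · simp [smul_smul, hc]

/-- $G^2=P$ and $PG=G$ give `P` and `G` the same column space; in the applications a multiple of
`G`, unlike the projector, displays the exchange relations. -/
theorem hasPBW_quad_of_square {J : Type} [Fintype J] [DecidableEq J]
    {P G : Matrix (J × J) (J × J) K} {c : K} (hc : c ≠ 0) (hG : G * G = P) (hPG : P * G = G)
    {X : Type*} {ℓ : X → ℕ} (h : HasPBW K (Quad.gen (c • G)) ℓ) : HasPBW K (Quad.gen P) ℓ :=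
  hasPBW_quad_of_eq_mul (N := c • G) (N' := c⁻¹ • G) (by rw [mul_smul_comm, hPG])
    (by rw [smul_mul_smul_comm, mul_inv_cancel₀ hc, one_smul, hG]) h

/-- $\hat R_M\otimes1-1\otimes\hat R_N=(q+q^{-1})G$ with $G={\cal P}^S\otimes{\cal P}^A-{\cal
P}^A\otimes{\cal P}^S$ and $G^2={\sf P}^-$. Copies are reordered by $\hat R^{-1}=\hat R-(q-q^{-1})$,
and $\hat R_1-q=0$ leaves the single generator free. -/
theorem hasPBW_quad_PMinus {q : K} (hq : q ≠ 0) (hq2 : q ^ 2 ≠ -1) (M N : ℕ) :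
    HasPBW K (Quad.gen (PMinus q M N)) (powDeg (powDeg (id : ℕ → ℕ) M) N) := by
  have h0 := q_add_inv_ne hq hq2
  have h := hasPBW_quantumMatrix hq (s := 1) (l := q) (u := q - q⁻¹) (v := 0) (c := -1)
    (one_mul 1) (add_zero _) (mul_zero _) (neg_ne_zero.mpr one_ne_zero)
    (fun n => by
      rw [one_smul]
      exact (isBraid_Rhat hq n).of_inverse (Rhat_mul_sub hq n))
    (R' := Rhat q)
    (fun n a b e d => by rw [Rhat_symm, Rhat_apply]; rfl) (fun n => by module)
    (ℓ := (id : ℕ → ℕ)) (by rw [Rhat_one, sub_self]; exact hasPBW_quad_zero) M N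
  have hD : tens (Rhat q M) 1 - tens 1 (Rhat q N) =
      (q + q⁻¹) • (tens (PS q M) (PA q N) - tens (PA q M) (PS q N)) := by
    rw [← PS_add_PA hq hq2 M, ← PS_add_PA hq hq2 N, Rhat_eq hq hq2 M, Rhat_eq hq hq2 N]
    simp only [tens_add_left, tens_add_right, tens_sub_left, tens_sub_right, tens_smul_left,
      tens_smul_right]
    module
  rw [hD] at h
  refine hasPBW_quad_of_square h0 ?_ ?_ h <;>
    simp only [PMinus, add_mul, sub_mul, mul_sub, tens_mul, PS_mul_PA hq, PA_mul_PS hq,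
      PS_mul_self hq hq2, PA_mul_self hq hq2, tens_zero_left] <;> abel

/-- Here $R'=-\hat R^{-1}$ and $G={\cal P}^S\otimes{\cal P}^S-{\cal P}^A\otimes{\cal P}^A$. Copies
are reordered by $-\hat R$, and $\hat R_1+q^{-1}=q+q^{-1}\ne0$ forces the single generator to square
to zero. -/
theorem hasPBW_quad_PPlus {q : K} (hq : q ≠ 0) (hq2 : q ^ 2 ≠ -1) (M N : ℕ) :
    HasPBW K (Quad.gen (PPlus q M N)) (powDeg (powDeg (Fin.val : Fin 2 → ℕ) M) N) := by
  have h0 := q_add_inv_ne hq hq2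
  have h := hasPBW_quantumMatrix hq (s := -1) (l := -q⁻¹) (u := 0) (v := q - q⁻¹) (c := 1)
    (by ring) (zero_add _) (zero_mul _) one_ne_zero
    (fun n => by
      rw [zero_smul, sub_zero]
      exact (isBraid_Rhat hq n).smul (-1))
    (R' := fun n => (q - q⁻¹) • 1 - Rhat q n)
    (fun n a b e d => by
      rw [Matrix.sub_apply, Rhat_symm, Rhat_apply, Matrix.smul_apply, Matrix.one_apply]
      simp only [Prod.mk.injEq, dcoef, fcoef]
      by_cases h3 : a = b
      · subst h3
        by_cases h1 : e = a ∧ d = a <;> simp [h1]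
      · by_cases h1 : e = a ∧ d = b <;> by_cases h2 : e = b ∧ d = a <;>
          by_cases h4 : a < b <;> simp [h1, h2, h3, h4])
    (fun n => by module)
    (ℓ := (Fin.val : Fin 2 → ℕ))
    (by
      rw [Rhat_one, neg_smul, sub_neg_eq_add, ← add_smul]
      exact hasPBW_quad_smul_one h0) M N
  have hD : tens (Rhat q M) 1 - tens 1 ((q - q⁻¹) • 1 - Rhat q N) =
      (q + q⁻¹) • (tens (PS q M) (PS q N) - tens (PA q M) (PA q N)) := by
    rw [← PS_add_PA hq hq2 M, ← PS_add_PA hq hq2 N, Rhat_eq hq hq2 M, Rhat_eq hq hq2 N]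
    simp only [tens_add_left, tens_add_right, tens_sub_left, tens_sub_right, tens_smul_left,
      tens_smul_right]
    module
  rw [hD] at h
  refine hasPBW_quad_of_square h0 ?_ ?_ h <;>
    simp only [PPlus, add_mul, sub_mul, mul_sub, tens_mul, PS_mul_PA hq, PA_mul_PS hq,
      PS_mul_self hq hq2, PA_mul_self hq hq2, tens_zero_left] <;> abel

end Exchange

/-! ### The crossing for the inhomogeneous Heisenberg relation -/

section HeisCrossing

variable {K : Type*} [Field K] {I : Type} [Fintype I] [DecidableEq I]
  {A : Type*} [Ring A] [Algebra K A]

/-- The crossing matrix for the relation `A^A A⁺_B = δ^A_B 1 + S^{AC}_{BD} A⁺_C A^D`; the index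
`none` stands for the constant term. -/
def heisTheta (S : Matrix (I × I) (I × I) K) (x : I → A) (b : I) :
    Matrix (Option I) (Option I) A :=
  Matrix.of fun
    | some a, some d => ∑ c, S (a, c) (b, d) • x c
    | some a, none => if a = b then 1 else 0
    | none, some _ => 0
    | none, none => x b

theorem sum_heisTheta_mul_some (S : Matrix (I × I) (I × I) K) (x : I → A) (b₁ b₂ a d : I) :
    (heisTheta S x b₁ * heisTheta S x b₂) (some a) (some d) =
      ∑ c₁, ∑ c₂, (leg₁₂ S * leg₂₃ S) (a, c₁, c₂) (b₁, b₂, d) • (x c₁ * x c₂) := by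
  simp only [leg₁₂_mul_leg₂₃_apply, Finset.sum_smul]
  simp only [heisTheta, Matrix.mul_apply, Matrix.of_apply, Fintype.sum_option, mul_zero, zero_add,
    Finset.sum_mul_sum, smul_mul_smul_comm]
  rw [Finset.sum_comm]
  exact Finset.sum_congr rfl fun c₁ _ => Finset.sum_comm

theorem sum_heisTheta_mul_none (S : Matrix (I × I) (I × I) K) (x : I → A) (b₁ b₂ a : I) :
    (heisTheta S x b₁ * heisTheta S x b₂) (some a) none =
      ∑ c, ((1 + S) (a, c) (b₁, b₂)) • x c := by
  simp only [heisTheta, Matrix.mul_apply, Matrix.of_apply, Fintype.sum_option, Matrix.add_apply,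
    add_smul, Finset.sum_add_distrib, Matrix.one_apply, Prod.mk.injEq, ite_and, ite_smul, one_smul,
    zero_smul, mul_ite, mul_one, mul_zero, ite_mul, one_mul, zero_mul]
  simp [Finset.sum_ite_irrel]

/-- Entrywise: `none, none` is the relation itself, `none, some` is zero, `some, none` is linear
with coefficients $(1+S)P=0$, and `some, some` vanishes after sliding `P`. -/
theorem heisTheta_quadRel {P S : Matrix (I × I) (I × I) K} (hP : IsHeisPair P S) {x : I → A}
    (h : ∀ a b, ∑ c, ∑ d, P (c, d) (a, b) • (x c * x d) = 0) (a b : I) :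
    ∑ c, ∑ d, P (c, d) (a, b) • (heisTheta S x c * heisTheta S x d) = 0 := by
  ext j k
  simp only [Matrix.sum_apply, Matrix.smul_apply, Matrix.zero_apply]
  rcases j with _ | j <;> rcases k with _ | k
  · rw [← h a b]
    simp [heisTheta, Matrix.mul_apply, Fintype.sum_option]
  · simp [heisTheta, Matrix.mul_apply, Fintype.sum_option]
  · simp only [sum_heisTheta_mul_none, Finset.smul_sum, smul_smul]
    calc _ = ∑ c, ∑ e, ∑ d, (P (c, d) (a, b) * (1 + S) (j, e) (c, d)) • x e :=
          Finset.sum_congr rfl fun _ _ => Finset.sum_comm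
      _ = ∑ e, ((1 + S) * P) (j, e) (a, b) • x e := by
          rw [Finset.sum_comm]
          refine Finset.sum_congr rfl fun e _ => ?_
          simp only [← Finset.sum_smul]
          congr 1
          rw [Matrix.mul_apply, Fintype.sum_prod_type]
          simp only [mul_comm]
      _ = 0 := by simp [hP.add_mul]
  · simp only [sum_heisTheta_mul_some]
    rw [sum_sum_smul_comm (fun c d => P (c, d) (a, b))
      (fun c d u v => (leg₁₂ S * leg₂₃ S) (j, u, v) (c, d, k)) fun u v => x u * x v]
    simp only [← mul_leg₁₂_apply, hP.slides.fst, sum_leg₂₃_mul_smul, h, smul_zero,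
      Finset.sum_const_zero]

/-- Moving $y\,y$ past $x$ leaves terms linear in $y$ with coefficients $1+S$, killed by $P(1+S)=0$,
and terms $x\,y\,y$ in which `P` slides to the two $y$'s. -/
theorem heis_quadratic_mul {P S : Matrix (I × I) (I × I) K} (hP : IsHeisPair P S) {x y : I → A}
    (h : ∀ a b, y a * x b =
      (if a = b then 1 else 0) + ∑ c, ∑ d, S (a, c) (b, d) • (x c * y d)) (a b e : I) :
    (∑ c, ∑ d, P (a, b) (c, d) • (y d * y c)) * x e =
      ∑ f, x f * ∑ u, ∑ v, (leg₂₃ S * leg₁₂ S) (a, b, f) (e, u, v) •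
        ∑ c, ∑ d, P (u, v) (c, d) • (y d * y c) := by
  have h1 : ∀ c d, y d * y c * x e = ∑ g, (1 + S) (c, d) (e, g) • y g +
      ∑ f, x f * ∑ u, ∑ v, (leg₂₃ S * leg₁₂ S) (c, d, f) (e, u, v) • (y v * y u) := by
    intro c d
    rw [mul_assoc, h, mul_add]
    simp only [Finset.mul_sum, mul_smul_comm, ← mul_assoc, h, add_mul, smul_add,
      Finset.sum_add_distrib]
    rw [← add_assoc]
    congr 1
    · simp only [Matrix.add_apply, add_smul, Finset.sum_add_distrib]
      congr 1
      · simp [Matrix.one_apply, ite_and, ite_smul]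
      · rw [Finset.sum_comm]
        simp [ite_mul]
    · simp only [leg₂₃_mul_leg₁₂_apply, Finset.sum_mul, Finset.smul_sum, smul_smul, Finset.sum_smul,
        smul_mul_assoc]
      calc _ = ∑ w, ∑ f, ∑ u, ∑ v, (S (c, w) (e, u) * S (d, f) (w, v)) • (x f * y v * y u) :=
            Finset.sum_congr rfl fun w _ => Finset.sum_comm
        _ = ∑ f, ∑ u, ∑ w, ∑ v, (S (c, w) (e, u) * S (d, f) (w, v)) • (x f * y v * y u) := by
            rw [Finset.sum_comm]
            exact Finset.sum_congr rfl fun _ _ => Finset.sum_comm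
        _ = ∑ f, ∑ u, ∑ v, ∑ w, (S (c, w) (e, u) * S (d, f) (w, v)) • (x f * y v * y u) :=
            Finset.sum_congr rfl fun _ _ => Finset.sum_congr rfl fun _ _ => Finset.sum_comm
        _ = _ := by simp only [mul_comm]
  have hlin : ∑ c, ∑ d, P (a, b) (c, d) • ∑ g, (1 + S) (c, d) (e, g) • y g = 0 := by
    simp only [Finset.smul_sum, smul_smul]
    calc _ = ∑ c, ∑ g, ∑ d, (P (a, b) (c, d) * (1 + S) (c, d) (e, g)) • y g :=
          Finset.sum_congr rfl fun _ _ => Finset.sum_comm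
      _ = ∑ g, (P * (1 + S)) (a, b) (e, g) • y g := by
          rw [Finset.sum_comm]
          refine Finset.sum_congr rfl fun g _ => ?_
          simp only [← Finset.sum_smul]
          congr 1
          rw [Matrix.mul_apply, Fintype.sum_prod_type]
      _ = 0 := by simp [hP.mul_add]
  have h2 := fun f => sum_sum_smul_comm (fun c d => P (a, b) (c, d))
    (fun c d u v => (leg₂₃ S * leg₁₂ S) (c, d, f) (e, u, v)) (fun u v => y v * y u)
  have h3 := fun f => sum_sum_smul_comm (fun u v => (leg₂₃ S * leg₁₂ S) (a, b, f) (e, u, v))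
    (fun u v c d => P (u, v) (c, d)) (fun c d => y d * y c)
  simp only [mul_comm ((leg₂₃ S * leg₁₂ S) _ _), ← mul_leg₂₃_apply, hP.slides.snd] at h3
  simp only [← leg₁₂_mul_apply] at h2
  simp only [h3, ← h2, Finset.sum_mul, smul_mul_assoc, h1, smul_add, Finset.sum_add_distrib, hlin,
    zero_add]
  simp only [Finset.smul_sum (N := A), Finset.mul_sum, mul_smul_comm]
  calc _ = ∑ c, ∑ f, ∑ d, _ := Finset.sum_congr rfl fun γ _ => Finset.sum_comm
    _ = _ := Finset.sum_comm

end HeisCrossing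

/-! ### Triangular decomposition of Heisenberg algebras -/

section HeisPBW

variable {K : Type*} [Field K] {I : Type} [Fintype I] [DecidableEq I]

theorem adjoin_op {A ι : Type*} [Ring A] [Algebra K A] {g : ι → A}
    (h : Algebra.adjoin K (Set.range g) = ⊤) :
    Algebra.adjoin K (Set.range fun i => MulOpposite.op (g i)) = ⊤ := by
  have h1 := congrArg Subalgebra.op h
  rw [Subalgebra.op_adjoin, Subalgebra.op_top] at h1
  rw [← h1]
  congr 1
  ext x
  simp [← MulOpposite.unop_inj]

/-- The relations of the Heisenberg algebra, for elements of an arbitrary algebra. -/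
structure HeisRelations (P S : Matrix (I × I) (I × I) K) {E : Type*} [Ring E] [Algebra K E]
    (g : HGen I → E) : Prop where
  cr_cr : ∀ a b, ∑ c, ∑ d, P (c, d) (a, b) • (g (.cr c) * g (.cr d)) = 0
  an_an : ∀ a b, ∑ c, ∑ d, P (a, b) (c, d) • (g (.an d) * g (.an c)) = 0
  an_cr : ∀ a b, g (.an a) * g (.cr b) =
    (if a = b then 1 else 0) + ∑ c, ∑ d, S (a, c) (b, d) • (g (.cr c) * g (.an d))

/-- Triangular decomposition of a Heisenberg algebra. -/
theorem hasPBW_of_heisRelations {P S : Matrix (I × I) (I × I) K} (hP : IsHeisPair P S)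
    {E : Type*} [Ring E] [Algebra K E] {g : HGen I → E}
    (hg : Algebra.adjoin K (Set.range g) = ⊤) (hrel : HeisRelations P S g)
    (hlift : ∀ r : HGen I → Module.End K (Quad P ⊗[K] (Quad P)ᵐᵒᵖ), HeisRelations P S r →
      ∃ f : E →ₐ[K] Module.End K (Quad P ⊗[K] (Quad P)ᵐᵒᵖ), ∀ i, f (g i) = r i)
    {X : Type*} {ℓ : X → ℕ} (h : HasPBW K (Quad.gen P) ℓ) :
    HasPBW K g fun x : X × X => ℓ x.1 + ℓ x.2 := by
  -- Symmetry of `P` turns the annihilation relations into those of `Quad P` with reversed products,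
  -- so the second tensor factor is the opposite algebra.
  have hsymm : ∀ t t', P t t' = P t' t := fun t t' => congrFun₂ hP.symm t' t
  obtain ⟨Θ, hΘ⟩ := Quad.exists_lift P (heisTheta S (Quad.gen P))
    (heisTheta_quadRel hP (Quad.rel P))
  obtain ⟨fB, hfB⟩ := Quad.exists_lift P (fun a => g (.cr a)) hrel.cr_cr
  obtain ⟨fC', hfC'⟩ := Quad.exists_lift P (fun a => MulOpposite.op (g (.an a))) (fun a b => by
    simp only [← MulOpposite.op_mul, ← MulOpposite.op_smul, ← Finset.op_sum, hsymm _ (a, b),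
      hrel.an_an, MulOpposite.op_zero])
  obtain ⟨fC, hfC⟩ : ∃ fC : (Quad P)ᵐᵒᵖ →ₐ[K] E,
      ∀ a, fC (MulOpposite.op (Quad.gen P a)) = g (.an a) :=
    ⟨AlgHom.opComm fC', fun a => by simp [AlgHom.opComm, hfC']⟩
  let y : Option I → (Quad P)ᵐᵒᵖ := fun j => j.elim 1 fun a => MulOpposite.op (Quad.gen P a)
  let L : Quad P →ₐ[K] Module.End K (Quad P ⊗[K] (Quad P)ᵐᵒᵖ) := Algebra.lsmul K K _
  let Y : Option I → Module.End K (Quad P ⊗[K] (Quad P)ᵐᵒᵖ) := crossOp Θ y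
  have hYL : ∀ j b, Y j * L (Quad.gen P b) = ∑ k, L (heisTheta S (Quad.gen P) b j k) * Y k := by
    intro j b
    simp only [Y, L]
    rw [crossOp_mul_lsmul, hΘ]
  -- The operator of the constant term is the identity: it is so on $1\otimes C$, and it commutes
  -- with `L` because row `none` of the crossing is diagonal.
  have hYnone : Y none = 1 := by
    rw [← sub_eq_zero]
    refine crossOp_relation (Quad.adjoin_gen P) (fun _ : Unit => Y none - 1) (fun t c => ?_)
      (fun _ b _ => Quad.gen P b) (fun t b => ?_) ()
    · simp only [Y, LinearMap.sub_apply, crossOp_one_tmul]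
      simp [y]
    · have := hYL none b
      simp only [Fintype.sum_option, heisTheta, Matrix.of_apply, map_zero, zero_mul,
        Finset.sum_const_zero, add_zero] at this
      simp only [sub_mul, one_mul, Finset.univ_unique, Finset.sum_singleton, mul_sub, mul_one]
      exact congrArg (· - _) this
  have hYX : ∀ a b, Y (some a) * L (Quad.gen P b) = (if a = b then 1 else 0) +
      ∑ c, ∑ d, S (a, c) (b, d) • (L (Quad.gen P c) * Y (some d)) := by
    intro a b
    rw [hYL, Fintype.sum_option, hYnone, mul_one]
    simp only [heisTheta, Matrix.of_apply, map_sum, map_smul, Finset.sum_mul, smul_mul_assoc]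
    rw [Finset.sum_comm]
    congr 1
    split_ifs
    · rw [map_one]
    · rw [map_zero]
  have hYY : ∀ a b, ∑ c, ∑ d, P (a, b) (c, d) • (Y (some d) * Y (some c)) = 0 := by
    intro a b
    refine crossOp_relation (Quad.adjoin_gen P)
      (fun t : I × I => ∑ c, ∑ d, P t (c, d) • (Y (some d) * Y (some c))) (fun t c => ?_)
      (fun t e t' => ∑ f, (leg₂₃ S * leg₁₂ S) (t.1, t.2, f) (e, t'.1, t'.2) • Quad.gen P f)
      (fun t e => ?_) (a, b)
    · have := congrArg (fun z => (1 : Quad P) ⊗ₜ[K] (MulOpposite.op z * c)) (Quad.rel P t.1 t.2)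
      simp only [MulOpposite.op_zero, zero_mul, TensorProduct.tmul_zero, Finset.op_sum,
        Finset.sum_mul, TensorProduct.tmul_sum, MulOpposite.op_smul, MulOpposite.op_mul,
        smul_mul_assoc, TensorProduct.tmul_smul, mul_assoc, hsymm _ (t.1, t.2)] at this
      simp only [LinearMap.sum_apply, LinearMap.smul_apply, Module.End.mul_apply, Y,
        crossOp_one_tmul]
      exact this
    · have := heis_quadratic_mul (A := Module.End K (Quad P ⊗[K] (Quad P)ᵐᵒᵖ)) hP
        (x := fun b => L (Quad.gen P b)) (y := fun a => Y (some a)) hYX t.1 t.2 e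
      rw [Fintype.sum_prod_type]
      refine this.trans ?_
      obtain ⟨W, hW⟩ : ∃ W : I × I → Module.End K (Quad P ⊗[K] (Quad P)ᵐᵒᵖ),
        ∀ t, W t = ∑ c, ∑ d, P t (c, d) • (Y (some d) * Y (some c)) := ⟨_, fun _ => rfl⟩
      simp only [← hW, map_sum, map_smul, Finset.sum_mul, smul_mul_assoc, Finset.mul_sum,
        mul_smul_comm]
      rw [Finset.sum_comm]
      exact Finset.sum_congr rfl fun u _ => Finset.sum_comm
  obtain ⟨ρ, hρ⟩ := hlift (fun i => match i with
      | .cr a => L (Quad.gen P a)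
      | .an a => Y (some a))
    ⟨fun a b => by simp only [← map_mul, ← map_smul, ← map_sum, Quad.rel, map_zero], hYY, hYX⟩
  refine h.crossedProduct h.op (Quad.adjoin_gen P) (adjoin_op (Quad.adjoin_gen P)) hg Θ y
    (fun b j k => ?_) (fun j => ?_) some (fun _ => rfl) fB fC HGen.cr HGen.an hfB hfC
    (fun k => ?_) (fun j b => ?_) ρ (fun a => hρ _) (fun a => hρ _)
  · rw [hΘ]
    rcases j with _ | j <;> rcases k with _ | k
    · exact gen_mem_wordFiltration _ _
    · exact zero_mem _
    · change (if j = b then (1 : Quad P) else 0) ∈ _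
      split_ifs
      · exact one_mem_wordFiltration _ 1
      · exact zero_mem _
    · exact sum_mem fun c _ => Submodule.smul_mem _ _ (gen_mem_wordFiltration _ _)
  · rcases j with _ | a
    · exact one_mem_wordFiltration _ 1
    · exact gen_mem_wordFiltration (fun a => MulOpposite.op (Quad.gen P a)) a
  · rcases k with a | a
    · exact Or.inl ⟨a, rfl⟩
    · exact Or.inr ⟨a, rfl⟩
  · rw [hΘ, Fintype.sum_option]
    rcases j with _ | a
    · simp [y, heisTheta]
    · simp only [y, Option.elim, heisTheta, Matrix.of_apply, map_one, mul_one, map_sum, map_smul,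
        hfB, hfC, hrel.an_cr, Finset.sum_mul, smul_mul_assoc]
      rw [Finset.sum_comm]
      congr 1
      split_ifs
      · rw [map_one]
      · rw [map_zero]

theorem Heis.relations (P S : Matrix (I × I) (I × I) K) : HeisRelations P S (Heis.gen P S) where
  cr_cr a b := by
    simpa [Heis.gen] using RingQuot.mkAlgHom_rel K (HeisRel.cr_cr (P := P) (S := S) a b)
  an_an a b := by
    simpa [Heis.gen] using RingQuot.mkAlgHom_rel K (HeisRel.an_an (P := P) (S := S) a b)
  an_cr a b := by
    have := RingQuot.mkAlgHom_rel K (HeisRel.an_cr (P := P) (S := S) a b)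
    rw [map_sub, map_sub, map_zero, sub_sub, sub_eq_zero] at this
    simpa [Heis.gen, apply_ite (RingQuot.mkAlgHom K (HeisRel P S))] using this

theorem Heis.adjoin_gen (P S : Matrix (I × I) (I × I) K) :
    Algebra.adjoin K (Set.range (Heis.gen P S)) = ⊤ := adjoin_ringQuot _

theorem Heis.exists_lift (P S : Matrix (I × I) (I × I) K) {A : Type*} [Ring A] [Algebra K A]
    (x : HGen I → A) (h : HeisRelations P S x) :
    ∃ f : Heis P S →ₐ[K] A, ∀ i, f (Heis.gen P S i) = x i := by
  have hx : ∀ ⦃a b⦄, HeisRel P S a b → FreeAlgebra.lift K x a = FreeAlgebra.lift K x b := by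
    rintro _ _ (⟨a, b⟩ | ⟨a, b⟩ | ⟨a, b⟩)
    · simpa using h.cr_cr a b
    · simpa using h.an_an a b
    · rw [map_sub, map_sub, map_zero, sub_sub, sub_eq_zero]
      simpa [apply_ite (FreeAlgebra.lift K x)] using h.an_cr a b
  exact ⟨RingQuot.liftAlgHom K ⟨FreeAlgebra.lift K x, hx⟩, fun α =>
    (RingQuot.liftAlgHom_mkAlgHom_apply K _ hx _).trans (FreeAlgebra.lift_ι_apply _ _)⟩

theorem hasPBW_heis {P S : Matrix (I × I) (I × I) K} (hP : IsHeisPair P S) {X : Type*} {ℓ : X → ℕ}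
    (h : HasPBW K (Quad.gen P) ℓ) :
    HasPBW K (Heis.gen P S) fun x : X × X => ℓ x.1 + ℓ x.2 :=
  hasPBW_of_heisRelations hP (Heis.adjoin_gen P S) (Heis.relations P S)
    (fun r hr => Heis.exists_lift P S r hr) h

end HeisPBW

/-! ### The classical algebras as the case q = 1 -/

section ClassicalPBW

variable {K : Type*} [Field K]

/-- The permutation matrix of the flip `x ⊗ y ↦ y ⊗ x`. -/
def flip (K : Type*) [Field K] (I : Type) [DecidableEq I] : Matrix (I × I) (I × I) K :=
  Matrix.of fun U L => if U = L.swap then 1 else 0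

theorem flip_apply {I : Type} [DecidableEq I] (a b c d : I) :
    flip K I (a, b) (c, d) = if a = d ∧ b = c then 1 else 0 := by
  simp [flip]

theorem Rhat_eq_flip (n : ℕ) : Rhat (1 : K) n = flip K (Fin n) := by
  ext ⟨a, b⟩ ⟨c, d⟩
  rw [Rhat_apply, flip_apply]
  by_cases h : a = b <;> by_cases h1 : c = b <;> by_cases h2 : d = a <;>
    simp_all [dcoef, fcoef, eq_comm]

theorem tens_flip (M N : ℕ) : tens (flip K (Fin M)) (flip K (Fin N)) = flip K (Idx M N) := by
  ext ⟨⟨a, a'⟩, ⟨b, b'⟩⟩ ⟨⟨c, c'⟩, ⟨d, d'⟩⟩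
  simp only [tens, Matrix.of_apply, flip_apply, Prod.mk.injEq]
  by_cases h1 : a = d <;> by_cases h2 : a' = d' <;> by_cases h3 : b = c <;> simp [h1, h2, h3]

theorem RPlus_one (M N : ℕ) : RPlus (1 : K) M N = (1 : K) • flip K (Idx M N) := by
  rw [RPlus, Rhat_eq_flip, Rhat_eq_flip, tens_flip, one_smul]

theorem neg_RMinus_one (M N : ℕ) : -RMinus (1 : K) M N = (-1 : K) • flip K (Idx M N) := by
  rw [RMinus, Rhat_inv one_ne_zero, inv_one, sub_self, zero_smul, sub_zero, Rhat_eq_flip,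
    Rhat_eq_flip, tens_flip, neg_smul, one_smul]

theorem PMinus_one [CharZero K] (M N : ℕ) :
    PMinus (1 : K) M N = (2⁻¹ : K) • (1 - (1 : K) • flip K (Idx M N)) := by
  rw [← tens_flip, ← tens_one]
  simp only [PMinus, PS, PA, Rhat_eq_flip, inv_one, one_smul, tens_smul_left, tens_smul_right,
    tens_add_left, tens_sub_left, tens_add_right, tens_sub_right]
  module

theorem PPlus_one [CharZero K] (M N : ℕ) :
    PPlus (1 : K) M N = (2⁻¹ : K) • (1 - (-1 : K) • flip K (Idx M N)) := by
  rw [← tens_flip, ← tens_one]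
  simp only [PPlus, PS, PA, Rhat_eq_flip, inv_one, one_smul, tens_smul_left, tens_smul_right,
    tens_add_left, tens_sub_left, tens_add_right, tens_sub_right]
  module

/-- Canonical (anti)commutation relations for elements of an arbitrary algebra. -/
structure ClassRelations {I : Type} [DecidableEq I] (s : K) {E : Type*} [Ring E] [Algebra K E]
    (g : HGen I → E) : Prop where
  cr_cr : ∀ i j, g (.cr i) * g (.cr j) - s • (g (.cr j) * g (.cr i)) = 0
  an_an : ∀ i j, g (.an i) * g (.an j) - s • (g (.an j) * g (.an i)) = 0
  an_cr : ∀ i j, g (.an i) * g (.cr j) = (if i = j then 1 else 0) + s • (g (.cr j) * g (.an i))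

theorem Classical.relations (I : Type) [DecidableEq I] (s : K) :
    ClassRelations s (Classical.gen I s) where
  cr_cr a b := by
    simpa [Classical.gen] using RingQuot.mkAlgHom_rel K (ClassRel.cr_cr (s := s) a b)
  an_an a b := by
    simpa [Classical.gen] using RingQuot.mkAlgHom_rel K (ClassRel.an_an (s := s) a b)
  an_cr a b := by
    have := RingQuot.mkAlgHom_rel K (ClassRel.an_cr (s := s) a b)
    rw [map_sub, map_sub, map_zero, sub_sub, sub_eq_zero] at this
    simpa [Classical.gen, apply_ite (RingQuot.mkAlgHom K (ClassRel I s))] using this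

theorem Classical.exists_lift (I : Type) [DecidableEq I] (s : K) {A : Type*} [Ring A] [Algebra K A]
    (x : HGen I → A) (h : ClassRelations s x) :
    ∃ f : Classical I s →ₐ[K] A, ∀ i, f (Classical.gen I s i) = x i := by
  have hx : ∀ ⦃a b⦄, ClassRel I s a b → FreeAlgebra.lift K x a = FreeAlgebra.lift K x b := by
    rintro _ _ (⟨a, b⟩ | ⟨a, b⟩ | ⟨a, b⟩)
    · simpa using h.cr_cr a b
    · simpa using h.an_an a b
    · rw [map_sub, map_sub, map_zero, sub_sub, sub_eq_zero]
      simpa [apply_ite (FreeAlgebra.lift K x)] using h.an_cr a b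
  exact ⟨RingQuot.liftAlgHom K ⟨FreeAlgebra.lift K x, hx⟩, fun α =>
    (RingQuot.liftAlgHom_mkAlgHom_apply K _ hx _).trans (FreeAlgebra.lift_ι_apply _ _)⟩

/-- Each projected quadratic relation is one half of a canonical (anti)commutation relation, and $2$
is invertible. -/
theorem heisRelations_flip_iff [CharZero K] {I : Type} [Fintype I] [DecidableEq I] {s : K}
    {E : Type*} [Ring E] [Algebra K E] (g : HGen I → E) :
    HeisRelations ((2⁻¹ : K) • (1 - s • flip K I)) (s • flip K I) g ↔ ClassRelations s g := by
  have e1 : ∀ a b, ∑ c, ∑ d, ((2⁻¹ : K) • (1 - s • flip K I)) (c, d) (a, b) •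
      (g (.cr c) * g (.cr d)) =
      (2⁻¹ : K) • (g (.cr a) * g (.cr b) - s • (g (.cr b) * g (.cr a))) := by
    intro a b
    simp [Matrix.one_apply, flip_apply, mul_sub, sub_smul, Finset.sum_sub_distrib, ite_and,
      smul_sub, ite_smul, mul_smul]
  have e2 : ∀ a b, ∑ c, ∑ d, ((2⁻¹ : K) • (1 - s • flip K I)) (a, b) (c, d) •
      (g (.an d) * g (.an c)) =
      (2⁻¹ : K) • (g (.an b) * g (.an a) - s • (g (.an a) * g (.an b))) := by
    intro a b
    simp [Matrix.one_apply, flip_apply, mul_sub, sub_smul, Finset.sum_sub_distrib, ite_and,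
      smul_sub, ite_smul, mul_smul]
  have e3 : ∀ a b, ∑ c, ∑ d, (s • flip K I) (a, c) (b, d) • (g (.cr c) * g (.an d)) =
      s • (g (.cr b) * g (.an a)) := by
    intro a b
    simp [flip_apply, ite_and, ite_smul]
  have h2 : (2⁻¹ : K) ≠ 0 := inv_ne_zero two_ne_zero
  constructor
  · rintro ⟨h1, h3, h4⟩
    simp only [e1, e2, e3, smul_eq_zero, h2, false_or] at h1 h3 h4
    exact ⟨h1, fun a b => h3 b a, h4⟩
  · rintro ⟨h1, h3, h4⟩
    refine ⟨fun a b => ?_, fun a b => ?_, fun a b => ?_⟩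
    · rw [e1, h1, smul_zero]
    · rw [e2, h3, smul_zero]
    · rw [e3, h4]

theorem hasPBW_classical [CharZero K] {I : Type} [Fintype I] [DecidableEq I] {s : K}
    {P S : Matrix (I × I) (I × I) K} (hP : P = (2⁻¹ : K) • (1 - s • flip K I))
    (hS : S = s • flip K I) {X : Type*} {ℓ : X → ℕ} (h : HasPBW K (Heis.gen P S) ℓ) :
    HasPBW K (Classical.gen I s) ℓ := by
  subst hP hS
  obtain ⟨f, hf⟩ := Heis.exists_lift _ _ _
    ((heisRelations_flip_iff _).2 (Classical.relations I s))
  obtain ⟨f', hf'⟩ := Classical.exists_lift I s _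
    ((heisRelations_flip_iff _).1 (Heis.relations _ _))
  exact h.of_algHoms f f' (Equiv.refl _) hf hf' (Heis.adjoin_gen _ _) (adjoin_ringQuot _)

/-- The same index set serves at $q$ and at $1$; characteristic zero makes $1$ an admissible value,
since $1\ne-1$. -/
theorem poincareSeries_qWeyl [CharZero K] {q : K} (hq : q ≠ 0) (hq2 : q ^ 2 ≠ -1) (M N : ℕ) :
    poincareSeries K (Heis.gen (PMinus q M N) (RPlus q M N)) =
      poincareSeries K (Classical.gen (Idx M N) (1 : K)) := by
  have h1 : (1 : K) ^ 2 ≠ -1 := by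
    intro h
    have : (2 : K) = 0 := by linear_combination h
    exact two_ne_zero this
  exact (hasPBW_heis (isHeisPair_PMinus hq hq2 M N)
    (hasPBW_quad_PMinus hq hq2 M N)).poincareSeries_eq
    (hasPBW_classical (PMinus_one M N) (RPlus_one M N)
      (hasPBW_heis (isHeisPair_PMinus one_ne_zero h1 M N)
        (hasPBW_quad_PMinus one_ne_zero h1 M N)))

theorem poincareSeries_qClifford [CharZero K] {q : K} (hq : q ≠ 0) (hq2 : q ^ 2 ≠ -1) (M N : ℕ) :
    poincareSeries K (Heis.gen (PPlus q M N) (-RMinus q M N)) =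
      poincareSeries K (Classical.gen (Idx M N) (-1 : K)) := by
  have h1 : (1 : K) ^ 2 ≠ -1 := by
    intro h
    have : (2 : K) = 0 := by linear_combination h
    exact two_ne_zero this
  exact (hasPBW_heis (isHeisPair_PPlus hq hq2 M N)
    (hasPBW_quad_PPlus hq hq2 M N)).poincareSeries_eq
    (hasPBW_classical (PPlus_one M N) (neg_RMinus_one M N)
      (hasPBW_heis (isHeisPair_PPlus one_ne_zero h1 M N)
        (hasPBW_quad_PPlus one_ne_zero h1 M N)))

end ClassicalPBW

/-! ### RTT relations as commutation with a tensor square -/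

section RTT

variable {K : Type*} [Field K] {I : Type*} [Fintype I] [DecidableEq I]
  {A : Type*} [Ring A] [Algebra K A]

/-- The relations `G^{ij}_{hk} T^h_l T^k_m = T^i_h T^j_k G^{hk}_{lm}`. -/
def IsRTT (G : Matrix (I × I) (I × I) K) (T : Matrix I I A) : Prop :=
  ∀ i j l m, ∑ h, ∑ k, G (i, j) (h, k) • (T h l * T k m) =
    ∑ h, ∑ k, G (h, k) (l, m) • (T i h * T j k)

/-- The matrix `T^i_l T^j_m`. -/
def tensorSquare (T : Matrix I I A) : Matrix (I × I) (I × I) A :=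
  Matrix.of fun U L => T U.1 L.1 * T U.2 L.2

theorem isRTT_iff_commute (G : Matrix (I × I) (I × I) K) (T : Matrix I I A) :
    IsRTT G T ↔ Commute (G.map (algebraMap K A)) (tensorSquare T) := by
  rw [commute_iff_eq, ← Matrix.ext_iff]
  simp only [IsRTT, Prod.forall, Matrix.mul_apply, Fintype.sum_prod_type, tensorSquare,
    Matrix.map_apply, Matrix.of_apply, Algebra.smul_def, ← Algebra.commutes]

theorem IsRTT.add {G G' : Matrix (I × I) (I × I) K} {T : Matrix I I A} (h : IsRTT G T)
    (h' : IsRTT G' T) : IsRTT (G + G') T := by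
  intro i j l m
  simp only [Matrix.add_apply, add_smul, Finset.sum_add_distrib, h i j l m, h' i j l m]

theorem IsRTT.smul {G : Matrix (I × I) (I × I) K} {T : Matrix I I A} (h : IsRTT G T) (r : K) :
    IsRTT (r • G) T := by
  intro i j l m
  simp only [Matrix.smul_apply, smul_assoc, ← Finset.smul_sum, h i j l m]

theorem IsRTT.one (T : Matrix I I A) : IsRTT (1 : Matrix (I × I) (I × I) K) T := by
  intro i j l m
  simp [Matrix.one_apply, ite_and, ite_smul]

theorem IsRTT.sub {G G' : Matrix (I × I) (I × I) K} {T : Matrix I I A} (h : IsRTT G T)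
    (h' : IsRTT G' T) : IsRTT (G - G') T := by
  rw [sub_eq_add_neg, ← neg_one_smul K G']
  exact h.add (h'.smul _)

theorem IsRTT.transpose {G : Matrix (I × I) (I × I) K} (hG : G.transpose = G) {T : Matrix I I A}
    (h : IsRTT G T) : IsRTT G T.transpose := by
  intro i j l m
  have hG' : ∀ U L, G U L = G L U := fun U L => congrFun₂ hG L U
  simpa only [Matrix.transpose_apply, hG' (i, j), hG' _ (l, m)] using (h l m i j).symm

theorem IsRTT.mul {G : Matrix (I × I) (I × I) K} {T U : Matrix I I A} (hT : IsRTT G T)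
    (hU : IsRTT G U) (hTU : ∀ i j k l, Commute (T i j) (U k l)) : IsRTT G (T * U) := by
  rw [isRTT_iff_commute] at *
  have : tensorSquare (T * U) = tensorSquare T * tensorSquare U := by
    ext ⟨i, j⟩ ⟨l, m⟩
    simp only [tensorSquare, Matrix.of_apply, Matrix.mul_apply, Fintype.sum_prod_type,
      Finset.sum_mul_sum]
    refine Finset.sum_congr rfl fun a _ => Finset.sum_congr rfl fun b _ => ?_
    rw [mul_assoc, ← mul_assoc (U a l), ← (hTU j b a l).eq]
    simp only [mul_assoc]
  rw [this]
  exact hT.mul_right hU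

theorem IsRTT.map {B : Type*} [Ring B] [Algebra K B] {G : Matrix (I × I) (I × I) K}
    {T : Matrix I I A} (hT : IsRTT G T) (f : A →ₐ[K] B) : IsRTT G (T.map f) := by
  intro i j l m
  simpa only [map_sum, map_smul, map_mul, Matrix.map_apply] using congrArg f (hT i j l m)

theorem isRTT_one (G : Matrix (I × I) (I × I) K) : IsRTT G (1 : Matrix I I A) := by
  intro i j l m
  simp [Matrix.one_apply, ← ite_and]
  simp [ite_and]

/-- The inverse of $T_1T_2$ is $U_2U_1$ and commutes with `G` as well; the reversed order is what
requires the opposite algebra. -/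
theorem IsRTT.op_inverse {G : Matrix (I × I) (I × I) K} {T U : Matrix I I A} (hT : IsRTT G T)
    (hTU : T * U = 1) (hUT : U * T = 1) : IsRTT G (U.map (MulOpposite.op : A → Aᵐᵒᵖ)) := by
  let W : Matrix (I × I) (I × I) A := Matrix.of fun X L => U X.2 L.2 * U X.1 L.1
  have e1 : ∀ i j, ∑ k, T i k * U k j = if i = j then 1 else 0 := fun i j => by
    rw [← Matrix.mul_apply, hTU, Matrix.one_apply]
  have e2 : ∀ i j, ∑ k, U i k * T k j = if i = j then 1 else 0 := fun i j => by
    rw [← Matrix.mul_apply, hUT, Matrix.one_apply]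
  have h1 : tensorSquare T * W = 1 := by
    ext ⟨i, j⟩ ⟨l, m⟩
    simp only [tensorSquare, W, Matrix.of_apply, Matrix.mul_apply, Fintype.sum_prod_type]
    calc _ = ∑ h, T i h * (∑ k, T j k * U k m) * U h l := by
          simp only [Finset.mul_sum, Finset.sum_mul, mul_assoc]
      _ = _ := by
          rw [e1]
          by_cases hjm : j = m
          · simp only [hjm, if_true, mul_one, e1, Matrix.one_apply, Prod.mk.injEq, and_true]
          · simp [hjm]
  have h2 : W * tensorSquare T = 1 := by
    ext ⟨i, j⟩ ⟨l, m⟩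
    simp only [tensorSquare, W, Matrix.of_apply, Matrix.mul_apply, Fintype.sum_prod_type]
    rw [Finset.sum_comm]
    calc _ = ∑ k, U j k * (∑ h, U i h * T h l) * T k m := by
          simp only [Finset.mul_sum, Finset.sum_mul, mul_assoc]
      _ = _ := by
          rw [e2]
          by_cases hil : i = l
          · simp only [hil, if_true, mul_one, e2, Matrix.one_apply, Prod.mk.injEq, true_and]
          · simp [hil]
  rw [isRTT_iff_commute] at hT
  have h3 : Commute (G.map (algebraMap K A)) W := by
    calc _ = W * (tensorSquare T * G.map (algebraMap K A)) * W := by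
          rw [← mul_assoc W, h2, one_mul]
      _ = _ := by rw [← hT.eq, mul_assoc, mul_assoc, h1, mul_one]
  intro i j l m
  have h4 := congrFun₂ h3.eq (i, j) (l, m)
  simp only [Matrix.mul_apply, Fintype.sum_prod_type, W, Matrix.map_apply, Matrix.of_apply,
    ← Algebra.commutes, ← Algebra.smul_def] at h4
  apply MulOpposite.unop_injective
  simpa using h4

theorem IsRTT.tens {M N : ℕ} {X : Matrix (Fin M × Fin M) (Fin M × Fin M) K}
    {Y : Matrix (Fin N × Fin N) (Fin N × Fin N) K} {T : Matrix (Fin M) (Fin M) A}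
    {U : Matrix (Fin N) (Fin N) A} (hT : IsRTT X T) (hU : IsRTT Y U)
    (hTU : ∀ i j k l, Commute (T i j) (U k l)) :
    IsRTT (tens X Y) (Matrix.of fun B C : Idx M N => T B.1 C.1 * U B.2 C.2) := by
  rintro ⟨α, a⟩ ⟨β, b⟩ ⟨γ, c⟩ ⟨δ, d⟩
  have hc : ∀ i j k l i' j' k' l', T i j * U k l * (T i' j' * U k' l') =
      (T i j * T i' j') * (U k l * U k' l') := by
    intro i j k l i' j' k' l'
    rw [mul_assoc, ← mul_assoc (U k l), ← (hTU i' j' k l).eq]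
    simp only [mul_assoc]
  have h := congrArg₂ (· * ·) (hT α β γ δ) (hU a b c d)
  simp only [Finset.sum_mul_sum, smul_mul_smul_comm] at h
  simp only [QHeis.tens, Matrix.of_apply, hc, Fintype.sum_prod_type]
  exact h

end RTT

/-! ### The quantum exterior algebra: sorting words -/

section Exterior

variable {K : Type*} [Field K] {E : Type*} [Ring E] [Algebra K E] {n : ℕ}

/-- The relations of the quantum exterior algebra. -/
structure QExterior (q : K) (x : Fin n → E) : Prop where
  mul_self : ∀ a, x a * x a = 0
  swap : ∀ a b, a < b → x b * x a = (-q) • (x a * x b)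

/-- The number of inversions of a list. -/
def invCount : List (Fin n) → ℕ
  | [] => 0
  | a :: l => l.countP (· < a) + invCount l

/-- The coefficient of a word in quantum exterior generators. -/
noncomputable def wordCoeff (q : K) (l : List (Fin n)) : K :=
  if l.Nodup then (-q) ^ invCount l else 0

variable {q : K} {x : Fin n → E}

theorem QExterior.mul_prod_orderedInsert (hx : QExterior q x) (a : Fin n) :
    ∀ s : List (Fin n), s.Pairwise (· ≤ ·) → a ∉ s → x a * (s.map x).prod =
      (-q) ^ s.countP (· < a) • ((s.orderedInsert (· ≤ ·) a).map x).prod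
  | [], _, _ => by simp
  | b :: s, hs, ha => by
    rw [List.pairwise_cons] at hs
    rw [List.mem_cons, not_or] at ha
    by_cases hab : a ≤ b
    · have h0 : (b :: s).countP (· < a) = 0 := by
        rw [List.countP_eq_zero]
        intro c hc
        rcases List.mem_cons.1 hc with rfl | hc
        · simpa using hab
        · simpa using hab.trans (hs.1 c hc)
      rw [h0, List.orderedInsert_cons_of_le _ _ hab]
      simp
    · have hba : b < a := not_le.1 hab
      rw [List.orderedInsert_cons, if_neg hab, List.countP_cons_of_pos (by simpa using hba)]
      simp only [List.map_cons, List.prod_cons]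
      rw [← mul_assoc, hx.swap b a hba, smul_mul_assoc, mul_assoc,
        hx.mul_prod_orderedInsert a s hs.2 ha.2, mul_smul_comm, smul_smul, pow_succ']

/-- Push $x_a$ to the right until it meets its other copy. Passing a larger generator uses the swap
relation backwards, which needs $q\ne0$. -/
theorem QExterior.mul_prod_of_mem (hq : q ≠ 0) (hx : QExterior q x) (a : Fin n) :
    ∀ s : List (Fin n), a ∈ s → x a * (s.map x).prod = 0
  | [], h => by simp at h
  | b :: s, h => by
    simp only [List.map_cons, List.prod_cons]
    rw [← mul_assoc]
    rcases lt_trichotomy a b with hab | rfl | hab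
    · have h' := hx.mul_prod_of_mem hq a s ((List.mem_cons.1 h).resolve_left hab.ne)
      have := hx.swap a b hab
      rw [← inv_smul_eq_iff₀ (neg_ne_zero.2 hq)] at this
      rw [← this, smul_mul_assoc, mul_assoc, h', mul_zero, smul_zero]
    · rw [hx.mul_self, zero_mul]
    · have h' := hx.mul_prod_of_mem hq a s ((List.mem_cons.1 h).resolve_left hab.ne')
      rw [hx.swap b a hab, smul_mul_assoc, mul_assoc, h', mul_zero, smul_zero]

theorem QExterior.prod_eq_insertionSort (hq : q ≠ 0) (hx : QExterior q x) :
    ∀ l : List (Fin n),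
      (l.map x).prod = wordCoeff q l • ((l.insertionSort (· ≤ ·)).map x).prod
  | [] => by simp [wordCoeff, invCount]
  | a :: l => by
    by_cases ha : a ∈ l
    · rw [List.map_cons, List.prod_cons, hx.mul_prod_of_mem hq a l ha, wordCoeff,
        if_neg (fun h => (List.nodup_cons.1 h).1 ha), zero_smul]
    · rw [List.map_cons, List.prod_cons, hx.prod_eq_insertionSort hq l, mul_smul_comm,
        hx.mul_prod_orderedInsert a _ (List.pairwise_insertionSort _ l)
          (by rwa [List.mem_insertionSort]),
        (List.perm_insertionSort _ l).countP_eq, smul_smul, List.insertionSort_cons]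
      congr 1
      simp only [wordCoeff, List.nodup_cons, ha, not_false_iff, true_and, invCount]
      split_ifs
      · rw [pow_add, mul_comm]
      · rw [zero_mul]

theorem insertionSort_eq_finRange {l : List (Fin n)} (hl : l.length = n) (h : l.Nodup) :
    l.insertionSort (· ≤ ·) = List.finRange n := by
  refine List.Perm.eq_of_pairwise' (r := (· ≤ ·)) (List.pairwise_insertionSort _ l) ?_ ?_
  · exact (List.pairwise_lt_finRange n).imp le_of_lt
  · refine (List.perm_insertionSort _ l).trans ?_
    refine (List.perm_ext_iff_of_nodup h (List.nodup_finRange n)).2 fun a => ?_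
    simp only [List.mem_finRange, iff_true]
    have : l.toFinset = Finset.univ := by
      rw [← Finset.card_eq_iff_eq_univ, List.toFinset_card_of_nodup h, hl, Fintype.card_fin]
    rw [← List.mem_toFinset, this]
    exact Finset.mem_univ a

theorem QExterior.prod_eq (hq : q ≠ 0) (hx : QExterior q x) {l : List (Fin n)}
    (hl : l.length = n) :
    (l.map x).prod = wordCoeff q l • ((List.finRange n).map x).prod := by
  rw [hx.prod_eq_insertionSort hq]
  by_cases h : l.Nodup
  · rw [insertionSort_eq_finRange hl h]
  · simp [wordCoeff, h]

theorem countP_ofFn {X : Type*} (p : X → Prop) [DecidablePred p] : ∀ {k : ℕ} (f : Fin k → X),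
    (List.ofFn f).countP (fun a => decide (p a)) = ∑ i, if p (f i) then 1 else 0
  | 0, f => by simp
  | k + 1, f => by
    rw [List.ofFn_succ, List.countP_cons, countP_ofFn, Fin.sum_univ_succ, add_comm]
    simp

theorem card_inversions {m : ℕ} : ∀ {k : ℕ} (f : Fin k → Fin m),
    (Finset.univ.filter fun p : Fin k × Fin k => p.1 < p.2 ∧ f p.2 < f p.1).card =
      invCount (List.ofFn f)
  | 0, f => by simp [invCount]
  | k + 1, f => by
    rw [List.ofFn_succ, invCount, ← card_inversions, countP_ofFn (· < f 0)]
    simp only [Finset.card_filter, Fintype.sum_prod_type, Fin.sum_univ_succ (n := k),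
      Fin.succ_lt_succ_iff, Fin.succ_pos, false_and, true_and, if_false, zero_add,
      Fin.not_lt_zero]

end Exterior

/-! ### Coaction on exterior generators and the top form -/

section ExteriorCoaction

variable {K : Type*} [Field K] {E : Type*} [Ring E] [Algebra K E] {n : ℕ} {q : K}
  {A : Type*} [Ring A] [Algebra K A]

/-- The exterior relations are the eigenvalue equation of $\hat R$ for $-q^{-1}$, a form preserved
by every $T$ with $\hat RT_1T_2=T_1T_2\hat R$. On the diagonal the converse divides by $q+q^{-1}$.
-/
theorem qExterior_iff (hq : q ≠ 0) (hq2 : q ^ 2 ≠ -1) (x : Fin n → E) :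
    QExterior q x ↔ ∀ l m, ∑ h, ∑ k, Rhat q n (h, k) (l, m) • (x h * x k) =
      (-q⁻¹) • (x l * x m) := by
  simp only [sum_Rhat_smul' q _ _ fun h k => x h * x k]
  constructor
  · rintro ⟨h1, h2⟩ l m
    rcases lt_trichotomy l m with h | rfl | h
    · rw [dcoef_of_lt _ h, fcoef_of_ne h.ne, h2 l m h]
      module
    · rw [h1]
      simp
    · rw [dcoef_of_gt _ h, fcoef_of_ne h.ne', h2 m l h, smul_smul]
      simp [hq]
  · intro h
    refine ⟨fun a => ?_, fun a b hab => ?_⟩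
    · have := h a a
      rw [dcoef_self, fcoef_self, zero_smul, add_zero, ← sub_eq_zero, ← sub_smul] at this
      refine (smul_eq_zero.1 this).resolve_left ?_
      rw [sub_neg_eq_add]
      exact q_add_inv_ne hq hq2
    · have := h a b
      rw [dcoef_of_lt _ hab, fcoef_of_ne hab.ne, one_smul, ← eq_sub_iff_add_eq'] at this
      rw [this]
      module

theorem sum_smul_sum_mul_of_intertwine {J : Type*} [Fintype J] {R : Matrix J J K} {c : K}
    {X : J → E} (hX : ∀ L, ∑ U, R U L • X U = c • X L) {W : J → J → E}
    (hW : ∀ U L, ∑ V, R U V • W V L = ∑ V, R V L • W U V) (L : J) :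
    ∑ V, R V L • ∑ U, X U * W U V = c • ∑ U, X U * W U L := by
  calc _ = ∑ U, X U * ∑ V, R V L • W U V := by
        simp only [Finset.smul_sum, Finset.mul_sum, mul_smul_comm]
        exact Finset.sum_comm
    _ = ∑ V, (∑ U, R U V • X U) * W V L := by
        simp only [← hW, Finset.sum_mul, Finset.mul_sum, mul_smul_comm, smul_mul_assoc]
        exact Finset.sum_comm
    _ = _ := by simp only [hX, Finset.smul_sum, smul_mul_assoc]

theorem QExterior.coact (hq : q ≠ 0) (hq2 : q ^ 2 ≠ -1) {x : Fin n → E} (hx : QExterior q x)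
    {s : A →ₐ[K] E} (hs : ∀ i a, Commute (x i) (s a)) {T : Matrix (Fin n) (Fin n) A}
    (hT : IsRTT (Rhat q n) T) : QExterior q fun j => ∑ i, x i * s (T i j) := by
  rw [qExterior_iff hq hq2] at hx ⊢
  intro l m
  have h1 : ∀ l m, (∑ i, x i * s (T i l)) * ∑ i, x i * s (T i m) =
      ∑ U : Fin n × Fin n, x U.1 * x U.2 * s (T U.1 l * T U.2 m) := by
    intro l m
    rw [Finset.sum_mul_sum, Fintype.sum_prod_type]
    refine Finset.sum_congr rfl fun i _ => Finset.sum_congr rfl fun j _ => ?_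
    rw [map_mul, mul_assoc, ← mul_assoc (s _), ← (hs j _).eq]
    simp only [mul_assoc]
  simp only [h1]
  rw [← Fintype.sum_prod_type' fun h k => Rhat q n (h, k) (l, m) •
    ∑ U : Fin n × Fin n, x U.1 * x U.2 * s (T U.1 h * T U.2 k)]
  refine sum_smul_sum_mul_of_intertwine (R := Rhat q n) (X := fun U => x U.1 * x U.2)
    (W := fun U V => s (T U.1 V.1 * T U.2 V.2)) (fun L => ?_) (fun U L => ?_) (l, m)
  · rw [Fintype.sum_prod_type]
    exact hx L.1 L.2
  · have := congrArg s (hT U.1 U.2 L.1 L.2)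
    simp only [map_sum, map_smul] at this
    rw [Fintype.sum_prod_type, Fintype.sum_prod_type]
    exact this

theorem prod_ofFn_sum_mul {x : Fin n → E} : ∀ {m : ℕ} (z : Fin n → Fin m → E),
    (∀ i j k, Commute (x i) (z j k)) → (List.ofFn fun r => ∑ i, x i * z i r).prod =
      ∑ f : Fin m → Fin n, (List.ofFn fun r => x (f r)).prod *
        (List.ofFn fun r => z (f r) r).prod
  | 0, z, _ => by simp
  | m + 1, z, hz => by
    rw [List.ofFn_succ, List.prod_cons, prod_ofFn_sum_mul (fun i r => z i r.succ)
      fun i j k => hz i j _, Finset.sum_mul_sum, ← Fintype.sum_prod_type',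
      ← (Fin.consEquiv fun _ : Fin (m + 1) => Fin n).sum_comp]
    refine Finset.sum_congr rfl fun p _ => ?_
    have : Commute (List.ofFn fun r => x (p.2 r)).prod (z p.1 0) := by
      refine Commute.list_prod_left _ _ fun a ha => ?_
      obtain ⟨r, rfl⟩ := (List.mem_ofFn' _ _).1 ha
      exact hz _ _ _
    simp only [List.ofFn_succ, List.prod_cons, Fin.consEquiv_apply, Fin.cons_zero, Fin.cons_succ]
    rw [mul_assoc, ← mul_assoc (z _ _), ← this.eq]
    simp only [mul_assoc]

/-- Words with a repeated letter have coefficient zero, so a determinant sum extends to all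
functions, which is the form that expanding a product of sums yields. -/
theorem sum_wordCoeff_smul {V : Type*} [AddCommGroup V] [Module K V] (F : (Fin n → Fin n) → V) :
    ∑ f : Fin n → Fin n, wordCoeff q (List.ofFn f) • F f =
      ∑ σ : Equiv.Perm (Fin n), (-q) ^ (Finset.univ.filter
        fun p : Fin n × Fin n => p.1 < p.2 ∧ σ p.2 < σ p.1).card • F σ := by
  symm
  refine Finset.sum_of_injOn (fun σ : Equiv.Perm (Fin n) => (σ : Fin n → Fin n))
    (fun _ _ _ _ h => DFunLike.coe_injective h) (fun _ _ => Finset.mem_coe.2 (Finset.mem_univ _))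
    (fun f _ hf => ?_) fun σ _ => ?_
  · rw [wordCoeff, if_neg, zero_smul]
    rw [List.nodup_ofFn]
    intro h
    exact hf ⟨Equiv.ofBijective f (Finite.injective_iff_bijective.1 h), by simp, rfl⟩
  · rw [wordCoeff, if_pos (List.nodup_ofFn.2 σ.injective), card_inversions]

/-- Expand the product and sort every word in the `x`. The position in the product is the lower
index of `T`, hence the transpose. -/
theorem QExterior.prod_coact (hq : q ≠ 0) {x : Fin n → E} (hx : QExterior q x)
    {s : A →ₐ[K] E} {T : Matrix (Fin n) (Fin n) A} (hs : ∀ i j k, Commute (x i) (s (T j k))) :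
    ((List.finRange n).map fun j => ∑ i, x i * s (T i j)).prod =
      ((List.finRange n).map x).prod * s (qdet q T.transpose) := by
  rw [← List.ofFn_eq_map, prod_ofFn_sum_mul (fun i r => s (T i r)) hs, qdet,
    ← sum_wordCoeff_smul (fun f => (List.ofFn fun r => T.transpose r (f r)).prod), map_sum,
    Finset.mul_sum]
  refine Finset.sum_congr rfl fun f _ => ?_
  have h1 := hx.prod_eq hq (l := List.ofFn f) (by simp)
  rw [List.map_ofFn] at h1
  have h2 : s (List.ofFn fun r => T.transpose r (f r)).prod =
      (List.ofFn fun r => s (T (f r) r)).prod := by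
    rw [map_list_prod, List.map_ofFn]
    rfl
  rw [map_smul, mul_smul_comm, ← smul_mul_assoc, ← h1, h2]
  rfl

theorem commute_prod_map {x : Fin n → E} {e : E} (h : ∀ i, Commute (x i) e)
    (l : List (Fin n)) : Commute (l.map x).prod e :=
  Commute.list_prod_left _ _ fun a ha => by
    obtain ⟨i, _, rfl⟩ := List.mem_map.1 ha
    exact h i

/-- A word of total length `n` in old and transformed generators is a multiple of the top form. For
a single old letter `c` plays the role of a quantum minor; its formula is never needed. -/
theorem QExterior.exists_coeff_left (hq : q ≠ 0) {x : Fin n → E} (hx : QExterior q x)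
    {s : A →ₐ[K] E} (hs : ∀ i a, Commute (x i) (s a)) (T : Matrix (Fin n) (Fin n) A) :
    ∀ l w : List (Fin n), w.length + l.length = n → ∃ c, (w.map x).prod *
      (l.map fun j => ∑ i, x i * s (T i j)).prod = ((List.finRange n).map x).prod * s c
  | [], w, h => ⟨algebraMap K A (wordCoeff q w), by
      rw [hx.prod_eq hq (by simpa using h), AlgHom.commutes, ← Algebra.commutes,
        ← Algebra.smul_def]
      simp⟩
  | j :: l, w, h => by
    choose c hc using fun i => hx.exists_coeff_left hq hs T l (w ++ [i]) (by
      simp only [List.length_append, List.length_cons, List.length_nil] at h ⊢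
      omega)
    refine ⟨∑ i, T i j * c i, ?_⟩
    simp only [List.map_cons, List.prod_cons, map_sum, map_mul, Finset.mul_sum, Finset.sum_mul]
    refine Finset.sum_congr rfl fun i _ => ?_
    have h1 := hc i
    rw [List.map_append, List.prod_append, List.map_singleton, List.prod_singleton] at h1
    have h2 := commute_prod_map (fun k => hs k (T i j)) (List.finRange n)
    have h3 := commute_prod_map (fun k => hs k (T i j)) w
    calc _ = (w.map x).prod * s (T i j) * (x i *
            (l.map fun j => ∑ i, x i * s (T i j)).prod) := by
          rw [(hs i (T i j)).eq]
          simp only [mul_assoc]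
      _ = s (T i j) * (((List.finRange n).map x).prod * s (c i)) := by
          rw [h3.eq, ← h1]
          simp only [mul_assoc]
      _ = _ := by rw [← mul_assoc, ← mul_assoc, h2.eq]

theorem QExterior.exists_coeff_right (hq : q ≠ 0) {x : Fin n → E} (hx : QExterior q x)
    {s : A →ₐ[K] E} (hs : ∀ i a, Commute (x i) (s a)) (T : Matrix (Fin n) (Fin n) A)
    (l : List (Fin n)) : ∀ w : List (Fin n), w.length + l.length = n →
      ∃ c, (l.map fun j => ∑ i, x i * s (T i j)).prod * (w.map x).prod =
        ((List.finRange n).map x).prod * s c := by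
  induction l using List.reverseRecOn with
  | nil =>
    exact fun w h => ⟨algebraMap K A (wordCoeff q w), by
      rw [hx.prod_eq hq (by simpa using h), AlgHom.commutes, ← Algebra.commutes,
        ← Algebra.smul_def]
      simp⟩
  | append_singleton l j ih =>
    intro w h
    choose c hc using fun i => ih (i :: w) (by
      simp only [List.length_append, List.length_cons, List.length_nil] at h ⊢
      omega)
    refine ⟨∑ i, c i * T i j, ?_⟩
    simp only [List.map_append, List.prod_append, List.map_singleton, List.prod_singleton,
      map_sum, map_mul, Finset.mul_sum, Finset.sum_mul]
    refine Finset.sum_congr rfl fun i _ => ?_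
    have h3 := commute_prod_map (fun k => hs k (T i j)) w
    rw [← mul_assoc _ (s (c i)), ← hc, List.map_cons, List.prod_cons, mul_assoc, mul_assoc,
      ← h3.eq]
    simp only [mul_assoc]

end ExteriorCoaction

/-! ### A model of the exterior algebra on subsets -/

section ExteriorModel

variable {K : Type*} [Field K] {n : ℕ} {q : K} {A : Type*} [Ring A] [Algebra K A]

/-- Exterior multiplication by the `a`-th basis vector in the quantum exterior algebra. -/
def extGen (q : K) (A : Type*) [Ring A] [Algebra K A] (a : Fin n) :
    Matrix (Finset (Fin n)) (Finset (Fin n)) A :=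
  Matrix.of fun S' S => if a ∉ S ∧ S' = insert a S then
    algebraMap K A ((-q) ^ (S.filter (· < a)).card) else 0

theorem mul_extGen_apply (Y : Matrix (Finset (Fin n)) (Finset (Fin n)) A) (a : Fin n)
    (S' S : Finset (Fin n)) : (Y * extGen q A a) S' S =
      if a ∈ S then 0 else (-q) ^ (S.filter (· < a)).card • Y S' (insert a S) := by
  rw [Matrix.mul_apply]
  simp only [extGen, Matrix.of_apply]
  by_cases h : a ∈ S
  · simp [h]
  · simp only [h, not_false_iff, true_and, if_false, mul_ite, mul_zero, Finset.sum_ite_eq',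
      Finset.mem_univ, if_true]
    rw [← Algebra.commutes, ← Algebra.smul_def]

theorem qExterior_extGen (q : K) (n : ℕ) (A : Type*) [Ring A] [Algebra K A] :
    QExterior q (extGen q A : Fin n → _) where
  mul_self a := by
    ext S' S
    rw [mul_extGen_apply]
    simp [extGen]
  swap a b hab := by
    ext S' S
    rw [Matrix.smul_apply, mul_extGen_apply, mul_extGen_apply]
    by_cases ha : a ∈ S
    · simp [ha, extGen]
    by_cases hb : b ∈ S
    · simp [hb, extGen]
    simp only [ha, hb, if_false, extGen, Matrix.of_apply, Finset.mem_insert, hab.ne, hab.ne',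
      false_or, not_false_iff, true_and, Finset.insert_comm b a]
    split_ifs
    · rw [Finset.filter_insert, if_pos hab, Finset.filter_insert, if_neg hab.not_gt,
        Finset.card_insert_of_notMem (by simp [ha]), Algebra.algebraMap_eq_smul_one,
        Algebra.algebraMap_eq_smul_one, smul_smul, smul_smul, smul_smul]
      congr 1
      ring
    · simp

/-- Scalar matrices over a noncommutative algebra. -/
def scalarHom (K : Type*) [Field K] (J A : Type*) [Fintype J] [DecidableEq J] [Ring A]
    [Algebra K A] : A →ₐ[K] Matrix J J A :=
  { Matrix.scalar J with
    commutes' := fun r => by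
      ext i j
      simp [Matrix.algebraMap_matrix_apply, Matrix.diagonal_apply] }

theorem scalarHom_apply {J : Type*} [Fintype J] [DecidableEq J] (a : A) :
    scalarHom K J A a = Matrix.diagonal fun _ => a := rfl

theorem commute_extGen_scalarHom (i : Fin n) (a : A) :
    Commute (extGen q A i) (scalarHom K (Finset (Fin n)) A a) := by
  rw [commute_iff_eq]
  ext S' S
  rw [scalarHom_apply, Matrix.mul_diagonal, Matrix.diagonal_mul, extGen, Matrix.of_apply]
  split_ifs
  · rw [Algebra.commutes]
  · simp

theorem prod_extGen_apply_empty : ∀ {l : List (Fin n)}, l.Pairwise (· < ·) →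
    ∀ S, (l.map (extGen q A)).prod S ∅ = if S = l.toFinset then 1 else 0
  | [], _, S => by
    rw [List.map_nil, List.prod_nil, Matrix.one_apply]
    rfl
  | a :: l, h, S => by
    rw [List.pairwise_cons] at h
    rw [List.map_cons, List.prod_cons, Matrix.mul_apply]
    simp only [prod_extGen_apply_empty h.2, mul_ite, mul_one, mul_zero, Finset.sum_ite_eq',
      Finset.mem_univ, if_true, extGen, Matrix.of_apply, List.toFinset_cons]
    have h1 : a ∉ l.toFinset := fun h' => (h.1 a (List.mem_toFinset.1 h')).ne rfl
    have h2 : l.toFinset.filter (· < a) = ∅ := by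
      refine Finset.filter_eq_empty_iff.2 fun b hb => (h.1 b (List.mem_toFinset.1 hb)).not_gt
    simp [h1, h2]

/-- The top form takes the empty set to the full set with coefficient one, so its coefficient can be
read off from one entry. Determinant identities are proved by this comparison. -/
theorem prod_extGen_mul_injective (q : K) (n : ℕ) {a b : A}
    (h : ((List.finRange n).map (extGen q A)).prod * scalarHom K (Finset (Fin n)) A a =
      ((List.finRange n).map (extGen q A)).prod * scalarHom K (Finset (Fin n)) A b) : a = b := by
  have h1 := congrFun₂ h Finset.univ ∅
  simp only [scalarHom_apply, Matrix.mul_diagonal] at h1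
  rw [prod_extGen_apply_empty (List.pairwise_lt_finRange n)] at h1
  simpa using h1

end ExteriorModel

/-! ### Multiplicativity of the quantum determinant, and adjugates -/

section QDet

variable {K : Type*} [Field K] {n : ℕ} {q : K} {A : Type*} [Ring A] [Algebra K A]

/-- Transform the generators by `T` and then by `U`: they still satisfy the exterior relations after
the first step, so the top form is multiplied twice. -/
theorem qdet_transpose_mul (hq : q ≠ 0) (hq2 : q ^ 2 ≠ -1) {T U : Matrix (Fin n) (Fin n) A}
    (hT : IsRTT (Rhat q n) T) (hTU : ∀ i j k l, Commute (T i j) (U k l)) :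
    qdet q (T * U).transpose = qdet q T.transpose * qdet q U.transpose := by
  let s := scalarHom K (Finset (Fin n)) A
  have hx := qExterior_extGen q n A
  have hs : ∀ (i : Fin n) (a : A), Commute (extGen q A i) (s a) := commute_extGen_scalarHom
  refine prod_extGen_mul_injective q n ?_
  rw [← hx.prod_coact hq fun i j k => hs _ _, map_mul, ← mul_assoc,
    ← hx.prod_coact hq fun i j k => hs _ _,
    ← (hx.coact hq hq2 hs hT).prod_coact hq fun i j k => ?_]
  · congr 2
    funext j
    simp only [Matrix.mul_apply, map_sum, map_mul, Finset.mul_sum, Finset.sum_mul, mul_assoc]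
    exact Finset.sum_comm
  · refine Commute.sum_left _ _ _ fun l _ => (hs l _).mul_left ((hTU _ _ _ _).map s)

theorem qdet_mul (hq : q ≠ 0) (hq2 : q ^ 2 ≠ -1) {T U : Matrix (Fin n) (Fin n) A}
    (hU : IsRTT (Rhat q n) U) (hTU : ∀ i j k l, Commute (T i j) (U k l)) :
    qdet q (T * U) = qdet q T * qdet q U := by
  have h1 : (U.transpose * T.transpose).transpose = T * U := by
    ext i j
    simp only [Matrix.transpose_apply, Matrix.mul_apply]
    exact Finset.sum_congr rfl fun k _ => (hTU _ _ _ _).eq.symm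
  have h := qdet_transpose_mul hq hq2 (T := U.transpose) (U := T.transpose)
    (hU.transpose (Rhat_transpose q n)) fun i j k l => (hTU _ _ _ _).symm
  rw [h1, Matrix.transpose_transpose, Matrix.transpose_transpose] at h
  rw [h]
  refine Commute.eq (Commute.sum_left _ _ _ fun σ _ => Commute.sum_right _ _ _ fun τ _ =>
    Commute.smul_left (Commute.smul_right ?_ _) _)
  refine Commute.list_prod_left _ _ fun a ha => Commute.list_prod_right _ _ fun b hb => ?_
  obtain ⟨r, rfl⟩ := (List.mem_ofFn' _ _).1 ha
  obtain ⟨r', rfl⟩ := (List.mem_ofFn' _ _).1 hb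
  exact (hTU _ _ _ _).symm

theorem qdet_one (hq : q ≠ 0) : qdet q (1 : Matrix (Fin n) (Fin n) A) = 1 := by
  have hx := qExterior_extGen q n A
  refine prod_extGen_mul_injective q n ?_
  have h := hx.prod_coact hq (s := scalarHom K (Finset (Fin n)) A)
    (T := (1 : Matrix (Fin n) (Fin n) A)) fun i j k => commute_extGen_scalarHom _ _
  rw [Matrix.transpose_one] at h
  rw [← h, map_one, mul_one]
  congr 2
  funext j
  simp [Matrix.one_apply, apply_ite]

theorem map_qdet {B : Type*} [Ring B] [Algebra K B] (f : A →ₐ[K] B)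
    (T : Matrix (Fin n) (Fin n) A) : f (qdet q T) = qdet q (T.map f) := by
  simp only [qdet, map_sum, map_smul, map_list_prod, List.map_ofFn]
  rfl

theorem wordCoeff_ne_zero (hq : q ≠ 0) {l : List (Fin n)} (h : l.Nodup) : wordCoeff q l ≠ 0 := by
  rw [wordCoeff, if_pos h]
  exact pow_ne_zero _ (neg_ne_zero.2 hq)

/-- Laplace expansion: with $y=xT$, the word of all $y_i$ with $i\ne j$ followed by $y_a$ is zero
unless $a=j$, when it is a nonzero scalar times the top form in $y$. Expanding only $y_a$ exhibits
it as $\sum_k c_{jk}T^k_a$. -/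
theorem exists_left_adjugate (hq : q ≠ 0) (hq2 : q ^ 2 ≠ -1) {T : Matrix (Fin n) (Fin n) A}
    (hT : IsRTT (Rhat q n) T) :
    ∃ L : Matrix (Fin n) (Fin n) A, L * T = Matrix.diagonal fun _ => qdet q T.transpose := by
  let s := scalarHom K (Finset (Fin n)) A
  have hx := qExterior_extGen q n A
  have hs : ∀ (i : Fin n) (a : A), Commute (extGen q A i) (s a) := commute_extGen_scalarHom
  have hlen : ∀ j, ((List.finRange n).erase j).length + 1 = n := fun j => by
    rw [List.length_erase_of_mem (List.mem_finRange j), List.length_finRange]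
    have := j.pos
    omega
  choose c hc using fun j k => hx.exists_coeff_right hq hs T ((List.finRange n).erase j) [k]
    (by rw [List.length_singleton, add_comm, hlen])
  have key : ∀ j a, ∑ k, c j k * T k a =
      wordCoeff q ((List.finRange n).erase j ++ [a]) • qdet q T.transpose := by
    intro j a
    refine prod_extGen_mul_injective q n ?_
    have h1 := (hx.coact hq hq2 hs hT).prod_eq hq (l := (List.finRange n).erase j ++ [a])
      (by rw [List.length_append, List.length_singleton, hlen])
    rw [hx.prod_coact hq fun i j k => hs _ _, List.map_append, List.prod_append,
      List.map_singleton, List.prod_singleton, ← mul_smul_comm, ← map_smul] at h1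
    rw [← h1]
    change _ * s _ = _
    simp only [map_sum, map_mul, Finset.mul_sum, ← mul_assoc]
    refine Finset.sum_congr rfl fun k _ => ?_
    rw [← hc]
    simp
  refine ⟨Matrix.of fun j k => (wordCoeff q ((List.finRange n).erase j ++ [j]))⁻¹ • c j k, ?_⟩
  ext j a
  simp only [Matrix.mul_apply, Matrix.of_apply, smul_mul_assoc, ← Finset.smul_sum, key]
  by_cases h : j = a
  · subst h
    rw [inv_smul_smul₀ (wordCoeff_ne_zero hq ?_), Matrix.diagonal_apply_eq]
    refine List.nodup_append.2 ⟨(List.nodup_finRange n).erase _, List.nodup_singleton _, ?_⟩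
    intro b hb c hc hbc
    rw [List.mem_singleton] at hc
    subst hbc hc
    exact (List.nodup_finRange n).not_mem_erase hb
  · have h0 : wordCoeff q ((List.finRange n).erase j ++ [a]) = 0 := by
      refine if_neg fun h' => ?_
      exact (List.nodup_append.1 h').2.2 a ((List.mem_erase_of_ne (Ne.symm h)).2
        (List.mem_finRange a)) a (List.mem_singleton_self a) rfl
    rw [Matrix.diagonal_apply_ne _ h, h0, zero_smul, smul_zero]

/-- The same expansion for the transpose, with the distinguished letter in front so that the entry
of `T` ends up on the left. -/
theorem exists_right_adjugate (hq : q ≠ 0) (hq2 : q ^ 2 ≠ -1) {T : Matrix (Fin n) (Fin n) A}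
    (hT : IsRTT (Rhat q n) T) :
    ∃ C : Matrix (Fin n) (Fin n) A, T * C = Matrix.diagonal fun _ => qdet q T := by
  let s := scalarHom K (Finset (Fin n)) A
  have hx := qExterior_extGen q n A
  have hs : ∀ (i : Fin n) (a : A), Commute (extGen q A i) (s a) := commute_extGen_scalarHom
  have hlen : ∀ j, ((List.finRange n).erase j).length + 1 = n := fun j => by
    rw [List.length_erase_of_mem (List.mem_finRange j), List.length_finRange]
    have := j.pos
    omega
  choose c hc using fun k j => hx.exists_coeff_left hq hs T.transpose ((List.finRange n).erase j)
    [k] (by rw [List.length_singleton, add_comm, hlen])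
  have key : ∀ a j, ∑ k, T a k * c k j =
      wordCoeff q (a :: (List.finRange n).erase j) • qdet q T := by
    intro a j
    refine prod_extGen_mul_injective q n ?_
    have h1 := (hx.coact hq hq2 hs (hT.transpose (Rhat_transpose q n))).prod_eq hq
      (l := a :: (List.finRange n).erase j) (by rw [List.length_cons, hlen])
    rw [hx.prod_coact hq fun i j k => hs _ _, List.map_cons, List.prod_cons,
      ← mul_smul_comm, ← map_smul, Matrix.transpose_transpose] at h1
    rw [← h1]
    change _ * s _ = _
    simp only [map_sum, map_mul, Finset.mul_sum, Finset.sum_mul]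
    refine Finset.sum_congr rfl fun k _ => ?_
    rw [← mul_assoc, (commute_prod_map (fun i => hs i (T a k)) _).eq, mul_assoc, ← hc,
      List.map_singleton, List.prod_singleton, ← mul_assoc, ← (hs k _).eq]
    rfl
  refine ⟨Matrix.of fun k j => (wordCoeff q (j :: (List.finRange n).erase j))⁻¹ • c k j, ?_⟩
  ext a j
  simp only [Matrix.mul_apply, Matrix.of_apply, mul_smul_comm, ← Finset.smul_sum, key]
  by_cases h : a = j
  · subst h
    rw [inv_smul_smul₀ (wordCoeff_ne_zero hq ?_), Matrix.diagonal_apply_eq]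
    exact List.nodup_cons.2 ⟨(List.nodup_finRange n).not_mem_erase,
      (List.nodup_finRange n).erase _⟩
  · have h0 : wordCoeff q (a :: (List.finRange n).erase j) = 0 := by
      refine if_neg fun h' => ?_
      exact (List.nodup_cons.1 h').1 ((List.mem_erase_of_ne h).2 (List.mem_finRange a))
    rw [Matrix.diagonal_apply_ne _ h, h0, zero_smul, smul_zero]

end QDet

/-! ### Transposition, inverse matrices and the determinant of the inverse -/

section QDetTranspose

variable {K : Type*} [Field K] {n : ℕ} {q : K} {A : Type*} [Ring A] [Algebra K A]

theorem prod_map_insertionSort {X : Type*} [LinearOrder X] (f : X → A) : ∀ l : List X,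
    l.Pairwise (fun a b => ¬ a ≤ b → Commute (f a) (f b)) →
    (l.map f).prod = ((l.insertionSort (· ≤ ·)).map f).prod
  | [], _ => rfl
  | a :: l, h => by
    rw [List.pairwise_cons] at h
    have key : ∀ s : List X, (∀ b ∈ s, ¬ a ≤ b → Commute (f a) (f b)) →
        f a * (s.map f).prod = ((s.orderedInsert (· ≤ ·) a).map f).prod := by
      intro s
      induction s with
      | nil => simp
      | cons b s ih =>
        intro hs
        rw [List.orderedInsert_cons]
        split_ifs with hab
        · simp
        · simp only [List.map_cons, List.prod_cons]
          rw [← ih fun c hc => hs c (List.mem_cons_of_mem _ hc), ← mul_assoc,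
            (hs b List.mem_cons_self hab).eq, mul_assoc]
    rw [List.map_cons, List.prod_cons, prod_map_insertionSort f l h.2, List.insertionSort_cons]
    exact key _ fun b hb => h.1 b ((List.mem_insertionSort _).1 hb)

theorem IsRTT.commute {T : Matrix (Fin n) (Fin n) A} (hT : IsRTT (Rhat q n) T) {i j l m : Fin n}
    (hij : i < j) (hlm : m < l) : Commute (T j m) (T i l) := by
  have h := hT j i l m
  rw [sum_Rhat_smul q j i fun h k => T h l * T k m,
    sum_Rhat_smul' q l m fun h k => T j h * T i k, dcoef_of_gt _ hij, dcoef_of_gt _ hlm,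
    fcoef_of_ne hij.ne', fcoef_of_ne hlm.ne'] at h
  simpa [commute_iff_eq] using h.symm

/-- Sorting the factors of a term by row index only swaps entries $T^j_m$, $T^i_l$ with $i<j$,
$m<l$, which commute; this replaces $\sigma$ by $\sigma^{-1}$, which has as many inversions. -/
theorem qdet_transpose {T : Matrix (Fin n) (Fin n) A} (hT : IsRTT (Rhat q n) T) :
    qdet q T.transpose = qdet q T := by
  have h1 : ∀ σ : Equiv.Perm (Fin n), (List.ofFn fun i => T.transpose i (σ i)).prod =
      (List.ofFn fun i => T i (σ⁻¹ i)).prod := by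
    intro σ
    have h2 := prod_map_insertionSort (fun i => T i (σ⁻¹ i)) (List.ofFn σ) (by
      rw [List.pairwise_ofFn]
      intro i j hij hσ
      simp only [Equiv.Perm.inv_def, Equiv.symm_apply_apply]
      exact (hT.commute (not_le.1 hσ) hij))
    rw [insertionSort_eq_finRange (by simp) (List.nodup_ofFn.2 σ.injective), List.map_ofFn,
      ← List.ofFn_eq_map] at h2
    rw [← h2]
    congr 2
    funext i
    simp
  rw [qdet, qdet, ← Equiv.sum_comp (Equiv.inv (Equiv.Perm (Fin n)))]
  refine Finset.sum_congr rfl fun σ _ => ?_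
  rw [h1]
  simp only [Equiv.inv_apply, inv_inv]
  congr 2
  refine Finset.card_bij' (fun p _ => (σ⁻¹ p.2, σ⁻¹ p.1)) (fun p _ => (σ p.2, σ p.1)) ?_ ?_ ?_ ?_
  · rintro ⟨a, b⟩ h
    simpa [and_comm] using h
  · rintro ⟨a, b⟩ h
    simpa [and_comm] using h
  · rintro ⟨a, b⟩ _
    simp
  · rintro ⟨a, b⟩ _
    simp

theorem exists_inverse (hq : q ≠ 0) (hq2 : q ^ 2 ≠ -1) {T : Matrix (Fin n) (Fin n) A}
    (hT : IsRTT (Rhat q n) T) {d : A} (hd : qdet q T * d = 1) (hd' : d * qdet q T = 1) :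
    ∃ U : Matrix (Fin n) (Fin n) A, T * U = 1 ∧ U * T = 1 := by
  obtain ⟨C, hC⟩ := exists_right_adjugate hq hq2 hT
  obtain ⟨L, hL⟩ := exists_left_adjugate hq hq2 hT
  rw [qdet_transpose hT] at hL
  have h1 : T * (C * Matrix.diagonal fun _ => d) = 1 := by
    rw [← mul_assoc, hC, Matrix.diagonal_mul_diagonal, hd, Matrix.diagonal_one]
  have h2 : (Matrix.diagonal fun _ => d) * L * T = 1 := by
    rw [mul_assoc, hL, Matrix.diagonal_mul_diagonal, hd', Matrix.diagonal_one]
  refine ⟨_, h1, ?_⟩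
  rw [← left_inv_eq_right_inv h2 h1, h2]

theorem prod_ofFn_inverse_coact {E : Type*} [Ring E] [Algebra K E] {x y : Fin n → E}
    {s : A →ₐ[K] E} (hs : ∀ i a, Commute (x i) (s a)) {U : Matrix (Fin n) (Fin n) A}
    (hxy : ∀ j, x j = ∑ i, s (U j i) * y i) : ∀ {m : ℕ} (j : Fin m → Fin n),
    (List.ofFn fun r => x (j r)).prod = ∑ f : Fin m → Fin n,
      s (List.ofFn fun r => MulOpposite.op (U (j r) (f r))).prod.unop *
        (List.ofFn fun r => y (f r)).prod
  | 0, j => by simp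
  | m + 1, j => by
    rw [List.ofFn_succ, List.prod_cons, prod_ofFn_inverse_coact hs hxy,
      ← (Fin.consEquiv fun _ : Fin (m + 1) => Fin n).sum_comp, Fintype.sum_prod_type,
      Finset.sum_comm, Finset.mul_sum]
    refine Finset.sum_congr rfl fun f _ => ?_
    simp only [List.ofFn_succ, List.prod_cons, Fin.consEquiv_apply, Fin.cons_zero, Fin.cons_succ,
      MulOpposite.unop_mul, MulOpposite.unop_op, map_mul, mul_assoc, ← Finset.mul_sum]
    rw [← mul_assoc, (hs _ _).eq, mul_assoc, hxy (j 0), Finset.sum_mul]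
    simp only [mul_assoc]

/-- Write the generators as $x=Uy$ with $y=Tx$ and expand $x_1\cdots x_n$. The entries of `U`
accumulate in reverse order, so their sum is a determinant in the opposite algebra, and each word in
$y$ contributes the determinant of `T`. -/
theorem qdet_op_inverse_mul (hq : q ≠ 0) (hq2 : q ^ 2 ≠ -1) {T U : Matrix (Fin n) (Fin n) A}
    (hT : IsRTT (Rhat q n) T) (hUT : U * T = 1) :
    (qdet q (U.map (MulOpposite.op : A → Aᵐᵒᵖ))).unop * qdet q T = 1 := by
  let s := scalarHom K (Finset (Fin n)) A
  have hx := qExterior_extGen q n A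
  have hs : ∀ (i : Fin n) (a : A), Commute (extGen q A i) (s a) := commute_extGen_scalarHom
  let y : Fin n → Matrix (Finset (Fin n)) (Finset (Fin n)) A :=
    fun j => ∑ i, extGen q A i * s (T.transpose i j)
  have hy : QExterior q y := hx.coact hq hq2 hs (hT.transpose (Rhat_transpose q n))
  have hxy : ∀ j, extGen q A j = ∑ i, s (U j i) * y i := by
    intro j
    have h1 : ∀ k, ∑ i, U j i * T i k = if j = k then 1 else 0 := fun k => by
      rw [← Matrix.mul_apply, hUT, Matrix.one_apply]
    calc _ = ∑ k, extGen q A k * s (∑ i, U j i * T i k) := by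
          simp [h1, apply_ite s]
      _ = ∑ k, ∑ i, s (U j i) * (extGen q A k * s (T i k)) := by
          refine Finset.sum_congr rfl fun k _ => ?_
          rw [map_sum, Finset.mul_sum]
          refine Finset.sum_congr rfl fun i _ => ?_
          rw [map_mul, ← mul_assoc, (hs k _).eq, mul_assoc]
      _ = _ := by
          rw [Finset.sum_comm]
          simp only [y, Finset.mul_sum]
          rfl
  have h1 := prod_ofFn_inverse_coact hs hxy (id : Fin n → Fin n)
  have h2 : ∀ f : Fin n → Fin n, (List.ofFn fun r => y (f r)).prod = wordCoeff q (List.ofFn f) •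
      (((List.finRange n).map (extGen q A)).prod * s (qdet q T)) := by
    intro f
    have h3 := hx.prod_coact hq (T := T.transpose) fun i j k => hs i _
    rw [Matrix.transpose_transpose] at h3
    rw [← h3, ← hy.prod_eq hq (by simp), List.map_ofFn]
    rfl
  simp only [h2, id] at h1
  rw [List.ofFn_eq_map] at h1
  refine prod_extGen_mul_injective q n ?_
  rw [map_one, mul_one, map_mul, ← mul_assoc]
  change _ * s _ * s _ = _
  rw [(commute_prod_map (fun i => hs i _) _).eq, mul_assoc]
  refine Eq.trans ?_ h1.symm
  rw [qdet, ← sum_wordCoeff_smul (fun f : Fin n → Fin n =>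
    (List.ofFn fun i => U.map (MulOpposite.op : A → Aᵐᵒᵖ) i (f i)).prod), Finset.unop_sum, map_sum,
    Finset.sum_mul]
  refine Finset.sum_congr rfl fun f _ => ?_
  rw [MulOpposite.unop_smul, map_smul, smul_mul_assoc, mul_smul_comm]
  rfl

end QDetTranspose

/-! ### The quantum group by generators and relations -/

section QuantumGroup

variable {K : Type*} [Field K] {q : K} {M N : ℕ} {E : Type*} [Ring E] [Algebra K E]

/-- The `GL_q(M)` block of a family of elements. -/
def glBlock (g : FunGen M N → E) : Matrix (Fin M) (Fin M) E := Matrix.of fun α β => g (.gl α β)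

/-- The `SL_q(N)` block of a family of elements. -/
def slBlock (g : FunGen M N → E) : Matrix (Fin N) (Fin N) E := Matrix.of fun a b => g (.sl a b)

/-- The defining relations of `Fun(GL_q(M) × SL_q(N))`, for elements of an arbitrary algebra. -/
structure FunRelations (q : K) (g : FunGen M N → E) : Prop where
  gl : IsRTT (Rhat q M) (glBlock g)
  sl : IsRTT (Rhat q N) (slBlock g)
  comm : ∀ α β a b, Commute (glBlock g α β) (slBlock g a b)
  det_gl : qdet q (glBlock g) = g .t
  det_sl : qdet q (slBlock g) = 1
  t_tinv : g .t * g .tinv = 1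
  tinv_t : g .tinv * g .t = 1
  t_central : ∀ i, Commute (g .t) (g i)

theorem FunRelations.tinv_central {g : FunGen M N → E} (h : FunRelations q g) {z : E}
    (hz : Commute (g .t) z) : Commute (g .tinv) z := by
  rw [commute_iff_eq]
  calc _ = g .tinv * (z * (g .t * g .tinv)) := by rw [h.t_tinv, mul_one]
    _ = g .tinv * g .t * z * g .tinv := by
        rw [← mul_assoc z, ← hz.eq]
        simp only [mul_assoc]
    _ = _ := by rw [h.tinv_t, one_mul]

theorem FunAlg.relations (q : K) (M N : ℕ) : FunRelations q (FunAlg.gen q M N) := by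
  have hmap : ∀ {n : ℕ} (T : Matrix (Fin n) (Fin n) (FreeAlgebra K (FunGen M N))),
      RingQuot.mkAlgHom K (FunRel q M N) (qdet q T) =
        qdet q (T.map (RingQuot.mkAlgHom K (FunRel q M N))) := fun T => map_qdet _ T
  refine ⟨fun i j l m => ?_, fun i j l m => ?_, fun α β a b => ?_, ?_, ?_, ?_, ?_, fun i => ?_⟩
  · have := RingQuot.mkAlgHom_rel K (FunRel.gl_gl (q := q) (N := N) i j l m)
    simp only [map_sum, map_smul, map_mul] at this
    exact this
  · have := RingQuot.mkAlgHom_rel K (FunRel.sl_sl (q := q) (M := M) i j l m)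
    simp only [map_sum, map_smul, map_mul] at this
    exact this
  · have := RingQuot.mkAlgHom_rel K (FunRel.gl_sl (q := q) α β a b)
    simp only [map_mul] at this
    exact this
  · exact (hmap _).symm.trans (RingQuot.mkAlgHom_rel K (FunRel.det_gl (q := q) (N := N)))
  · exact ((hmap _).symm.trans (RingQuot.mkAlgHom_rel K (FunRel.det_sl (q := q) (M := M)))).trans
      (map_one _)
  · have := RingQuot.mkAlgHom_rel K (FunRel.t_tinv (q := q) (M := M) (N := N))
    simp only [map_mul, map_one] at this
    exact this
  · have := RingQuot.mkAlgHom_rel K (FunRel.tinv_t (q := q) (M := M) (N := N))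
    simp only [map_mul, map_one] at this
    exact this
  · have := RingQuot.mkAlgHom_rel K (FunRel.t_central (q := q) i)
    simp only [map_mul] at this
    exact this

theorem FunAlg.adjoin_gen (q : K) (M N : ℕ) :
    Algebra.adjoin K (Set.range (FunAlg.gen q M N)) = ⊤ := adjoin_ringQuot _

theorem FunAlg.exists_lift (q : K) (M N : ℕ) (g : FunGen M N → E) (h : FunRelations q g) :
    ∃ f : FunAlg q M N →ₐ[K] E, ∀ i, f (FunAlg.gen q M N i) = g i := by
  have hgl : (fgl K M N).map (FreeAlgebra.lift K g) = glBlock g := by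
    ext α β
    simp [fgl, glBlock]
  have hsl : (fsl K M N).map (FreeAlgebra.lift K g) = slBlock g := by
    ext α β
    simp [fsl, slBlock]
  have hgl' := fun α β => congrFun₂ hgl α β
  have hsl' := fun α β => congrFun₂ hsl α β
  simp only [Matrix.map_apply] at hgl' hsl'
  have hx : ∀ ⦃a b⦄, FunRel q M N a b → FreeAlgebra.lift K g a = FreeAlgebra.lift K g b := by
    rintro _ _ (⟨i, j, l, m⟩ | ⟨i, j, l, m⟩ | ⟨α, β, a, b⟩ | _ | _ | _ | _ | i)
    · simpa only [map_sum, map_smul, map_mul, hgl'] using h.gl i j l m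
    · simpa only [map_sum, map_smul, map_mul, hsl'] using h.sl i j l m
    · simpa only [map_mul, hgl', hsl'] using (h.comm α β a b).eq
    · rw [map_qdet, hgl, h.det_gl, ft, FreeAlgebra.lift_ι_apply]
    · rw [map_qdet, hsl, h.det_sl, map_one]
    · simpa [ft, ftinv] using h.t_tinv
    · simpa [ft, ftinv] using h.tinv_t
    · simpa [ft] using (h.t_central i).eq
  exact ⟨RingQuot.liftAlgHom K ⟨FreeAlgebra.lift K g, hx⟩, fun α =>
    (RingQuot.liftAlgHom_mkAlgHom_apply K _ hx _).trans (FreeAlgebra.lift_ι_apply _ _)⟩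

end QuantumGroup

/-! ### Comultiplication and counit on generators -/

section Comultiplication

variable {K : Type*} [Field K] {q : K} {M N : ℕ} {H : Type*} [Ring H] [Algebra K H]

/-- Images of the generators under the comultiplication. -/
def comulGen (K : Type*) [Field K] {M N : ℕ} {H : Type*} [Ring H] [Algebra K H]
    (g : FunGen M N → H) : FunGen M N → H ⊗[K] H
  | .gl α β => ∑ γ, g (.gl α γ) ⊗ₜ g (.gl γ β)
  | .sl a b => ∑ c, g (.sl a c) ⊗ₜ g (.sl c b)
  | .t => g .t ⊗ₜ g .t
  | .tinv => g .tinv ⊗ₜ g .tinv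

theorem commute_includeLeft_includeRight (x y : H) :
    Commute ((Algebra.TensorProduct.includeLeft : H →ₐ[K] H ⊗[K] H) x)
      ((Algebra.TensorProduct.includeRight : H →ₐ[K] H ⊗[K] H) y) := by
  simp [commute_iff_eq]

theorem commute_tmul {a b c d : H} (h : Commute a c) (h' : Commute b d) :
    Commute (a ⊗ₜ[K] b) (c ⊗ₜ[K] d) := by
  rw [commute_iff_eq, Algebra.TensorProduct.tmul_mul_tmul, Algebra.TensorProduct.tmul_mul_tmul,
    h.eq, h'.eq]

/-- Each block becomes the product of its copies in the two tensor factors, whose entries commute;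
so RTT and the determinant are multiplicative, and the determinant is grouplike. -/
theorem FunRelations.comulGen (hq : q ≠ 0) (hq2 : q ^ 2 ≠ -1) {g : FunGen M N → H}
    (h : FunRelations q g) : FunRelations q (comulGen K g) := by
  let l : H →ₐ[K] H ⊗[K] H := Algebra.TensorProduct.includeLeft
  let r : H →ₐ[K] H ⊗[K] H := Algebra.TensorProduct.includeRight
  have hlr : ∀ x y, Commute (l x) (r y) := commute_includeLeft_includeRight
  have hgl : glBlock (QHeis.comulGen K g) = (glBlock g).map l * (glBlock g).map r := by
    ext α β
    simp [glBlock, QHeis.comulGen, Matrix.mul_apply, l, r]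
  have hsl : slBlock (QHeis.comulGen K g) = (slBlock g).map l * (slBlock g).map r := by
    ext α β
    simp [slBlock, QHeis.comulGen, Matrix.mul_apply, l, r]
  refine ⟨?_, ?_, fun α β a b => ?_, ?_, ?_, ?_, ?_, fun i => ?_⟩
  · rw [hgl]
    exact (h.gl.map l).mul (h.gl.map r) fun _ _ _ _ => hlr _ _
  · rw [hsl]
    exact (h.sl.map l).mul (h.sl.map r) fun _ _ _ _ => hlr _ _
  · change Commute (∑ γ, g (.gl α γ) ⊗ₜ[K] g (.gl γ β)) (∑ c, g (.sl a c) ⊗ₜ[K] g (.sl c b))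
    exact Commute.sum_left _ _ _ fun γ _ => Commute.sum_right _ _ _ fun c _ =>
      commute_tmul (K := K) (h.comm _ _ _ _) (h.comm _ _ _ _)
  · rw [hgl, qdet_mul hq hq2 (T := (glBlock g).map l) (h.gl.map r) fun _ _ _ _ => hlr _ _,
      ← map_qdet, ← map_qdet, h.det_gl]
    simp [l, r, QHeis.comulGen]
  · rw [hsl, qdet_mul hq hq2 (T := (slBlock g).map l) (h.sl.map r) fun _ _ _ _ => hlr _ _,
      ← map_qdet, ← map_qdet, h.det_sl,
      map_one, map_one, one_mul]
  · simp [QHeis.comulGen, h.t_tinv, Algebra.TensorProduct.one_def]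
  · simp [QHeis.comulGen, h.tinv_t, Algebra.TensorProduct.one_def]
  · rcases i with ⟨α, β⟩ | _ | _ | ⟨a, b⟩
    · exact Commute.sum_right _ _ _ fun γ _ => commute_tmul (h.t_central _) (h.t_central _)
    · exact commute_tmul (h.t_central _) (h.t_central _)
    · exact commute_tmul (h.t_central _) (h.t_central _)
    · exact Commute.sum_right _ _ _ fun γ _ => commute_tmul (h.t_central _) (h.t_central _)

/-- Images of the generators under the counit. -/
def counitGen (K : Type*) [Field K] (M N : ℕ) : FunGen M N → K
  | .gl α β => if α = β then 1 else 0
  | .sl a b => if a = b then 1 else 0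
  | .t => 1
  | .tinv => 1

theorem funRelations_counitGen (hq : q ≠ 0) : FunRelations q (counitGen K M N) := by
  have hgl : glBlock (counitGen K M N) = 1 := by
    ext α β
    simp [glBlock, counitGen, Matrix.one_apply]
  have hsl : slBlock (counitGen K M N) = 1 := by
    ext α β
    simp [slBlock, counitGen, Matrix.one_apply]
  refine ⟨?_, ?_, fun α β a b => Commute.all _ _, ?_, ?_, ?_, ?_, fun i => Commute.all _ _⟩
  · rw [hgl]
    exact isRTT_one _
  · rw [hsl]
    exact isRTT_one _
  · rw [hgl, qdet_one hq]
    rfl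
  · rw [hsl, qdet_one hq]
  · exact mul_one _
  · exact mul_one _

end Comultiplication

/-! ### The antipode on generators -/

section Antipode

variable {K : Type*} [Field K] {q : K} {M N : ℕ} {H : Type*} [Ring H] [Algebra K H]

theorem commute_inverse_entry {n : ℕ} {T U : Matrix (Fin n) (Fin n) H} (hTU : T * U = 1)
    (hUT : U * T = 1) {z : H} (hz : ∀ i j, Commute z (T i j)) (i j : Fin n) :
    Commute z (U i j) := by
  have h1 : (Matrix.diagonal fun _ => z) * T = T * Matrix.diagonal fun _ => z := by
    ext i j
    rw [Matrix.diagonal_mul, Matrix.mul_diagonal, (hz i j).eq]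
  have h2 : (Matrix.diagonal fun _ => z) * U = U * Matrix.diagonal fun _ => z := by
    calc _ = U * T * (Matrix.diagonal fun _ => z) * U := by rw [hUT, one_mul]
      _ = U * (Matrix.diagonal fun _ => z) * (T * U) := by
          rw [mul_assoc U, ← h1]
          simp only [mul_assoc]
      _ = _ := by rw [hTU, mul_one]
  have h3 := congrFun₂ h2 i j
  rwa [Matrix.diagonal_mul, Matrix.mul_diagonal] at h3

/-- Two-sided inverses of the two blocks of generators. -/
structure BlockInverses (g : FunGen M N → H) (V : Matrix (Fin M) (Fin M) H)
    (W : Matrix (Fin N) (Fin N) H) : Prop where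
  gl_mul : glBlock g * V = 1
  mul_gl : V * glBlock g = 1
  sl_mul : slBlock g * W = 1
  mul_sl : W * slBlock g = 1

theorem FunRelations.exists_blockInverses (hq : q ≠ 0) (hq2 : q ^ 2 ≠ -1) {g : FunGen M N → H}
    (h : FunRelations q g) : ∃ V W, BlockInverses g V W := by
  obtain ⟨V, hV⟩ := exists_inverse hq hq2 h.gl (d := g .tinv) (by rw [h.det_gl, h.t_tinv])
    (by rw [h.det_gl, h.tinv_t])
  obtain ⟨W, hW⟩ := exists_inverse hq hq2 h.sl (d := 1) (by rw [h.det_sl, mul_one])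
    (by rw [h.det_sl, mul_one])
  exact ⟨V, W, hV.1, hV.2, hW.1, hW.2⟩

/-- Images of the generators under the antipode. -/
def antipodeGen (g : FunGen M N → H) (V : Matrix (Fin M) (Fin M) H)
    (W : Matrix (Fin N) (Fin N) H) : FunGen M N → Hᵐᵒᵖ
  | .gl α β => MulOpposite.op (V α β)
  | .sl a b => MulOpposite.op (W a b)
  | .t => MulOpposite.op (g .tinv)
  | .tinv => MulOpposite.op (g .t)

theorem commute_op {x y : H} (h : Commute x y) : Commute (MulOpposite.op x) (MulOpposite.op y) :=
  congrArg MulOpposite.op h.eq.symm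

theorem BlockInverses.comm {g : FunGen M N → H} (h : FunRelations q g)
    {V : Matrix (Fin M) (Fin M) H} {W : Matrix (Fin N) (Fin N) H} (hVW : BlockInverses g V W)
    (α β : Fin M) (a b : Fin N) : Commute (V α β) (W a b) :=
  commute_inverse_entry hVW.sl_mul hVW.mul_sl (fun c d =>
    (commute_inverse_entry hVW.gl_mul hVW.mul_gl (fun γ δ => (h.comm γ δ c d).symm) α β).symm) a b

/-- The inverse blocks satisfy RTT in the opposite algebra, and their determinants there are inverse
to $t$ and to $1$. -/
theorem FunRelations.antipodeGen (hq : q ≠ 0) (hq2 : q ^ 2 ≠ -1) {g : FunGen M N → H}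
    (h : FunRelations q g) {V : Matrix (Fin M) (Fin M) H} {W : Matrix (Fin N) (Fin N) H}
    (hVW : BlockInverses g V W) : FunRelations q (antipodeGen g V W) := by
  have htinv : ∀ i, Commute (g .tinv) (g i) := fun i => h.tinv_central (h.t_central i)
  refine ⟨h.gl.op_inverse hVW.gl_mul hVW.mul_gl, h.sl.op_inverse hVW.sl_mul hVW.mul_sl,
    fun α β a b => commute_op (hVW.comm h α β a b), ?_, ?_, ?_, ?_, fun i => ?_⟩
  · have h1 := qdet_op_inverse_mul hq hq2 h.gl hVW.mul_gl
    rw [h.det_gl] at h1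
    exact MulOpposite.unop_injective (left_inv_eq_right_inv h1 h.t_tinv)
  · have h1 := qdet_op_inverse_mul hq hq2 h.sl hVW.mul_sl
    rw [h.det_sl, mul_one] at h1
    exact MulOpposite.unop_injective h1
  · exact congrArg MulOpposite.op h.t_tinv
  · exact congrArg MulOpposite.op h.tinv_t
  · refine commute_op (x := g .tinv) ?_
    rcases i with ⟨α, β⟩ | _ | _ | ⟨a, b⟩
    · exact commute_inverse_entry hVW.gl_mul hVW.mul_gl (fun γ δ => htinv _) α β
    · exact htinv _
    · exact htinv _
    · exact commute_inverse_entry hVW.sl_mul hVW.mul_sl (fun γ δ => htinv _) a b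

end Antipode

/-! ### Hopf axioms from generators -/

section HopfStructure

variable {K : Type*} [Field K] {H : Type*} [Ring H] [Algebra K H]

/-- The linear map underlying an algebra homomorphism to the opposite algebra. -/
def opLinear (S : H →ₐ[K] Hᵐᵒᵖ) : H →ₗ[K] H :=
  (MulOpposite.opLinearEquiv K).symm.toLinearMap ∘ₗ S.toLinearMap

theorem opLinear_apply (S : H →ₐ[K] Hᵐᵒᵖ) (x : H) : opLinear S x = (S x).unop := rfl

theorem opLinear_mul (S : H →ₐ[K] Hᵐᵒᵖ) (x y : H) :
    opLinear S (x * y) = opLinear S y * opLinear S x := by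
  simp [opLinear_apply]

/-- Antimultiplicativity gives $m(S\otimes1)(z(c\otimes d))=S(c)\,m(S\otimes1)(z)\,d$, whose middle
factor is a scalar by assumption. Thus the antipode axiom passes to products. -/
theorem antipode_left_mul (S : H →ₐ[K] Hᵐᵒᵖ) {z : H ⊗[K] H} {r : K}
    (hz : LinearMap.mul' K H ((opLinear S).rTensor H z) = algebraMap K H r) (w : H ⊗[K] H) :
    LinearMap.mul' K H ((opLinear S).rTensor H (z * w)) =
      r • LinearMap.mul' K H ((opLinear S).rTensor H w) := by
  induction w using TensorProduct.induction_on with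
  | zero => simp
  | add x y hx hy => rw [mul_add, map_add, map_add, hx, hy, map_add, map_add, smul_add]
  | tmul c d =>
    have key : ∀ z : H ⊗[K] H, LinearMap.mul' K H ((opLinear S).rTensor H (z * c ⊗ₜ d)) =
        opLinear S c * LinearMap.mul' K H ((opLinear S).rTensor H z) * d := by
      intro z
      induction z using TensorProduct.induction_on with
      | zero => simp
      | add x y hx hy => rw [add_mul, map_add, map_add, hx, hy, map_add, map_add, mul_add, add_mul]
      | tmul a b => simp [opLinear_mul, mul_assoc]
    rw [key, hz, ← Algebra.commutes, ← Algebra.smul_def]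
    simp

theorem antipode_right_mul (S : H →ₐ[K] Hᵐᵒᵖ) {w : H ⊗[K] H} {r : K}
    (hw : LinearMap.mul' K H ((opLinear S).lTensor H w) = algebraMap K H r) (z : H ⊗[K] H) :
    LinearMap.mul' K H ((opLinear S).lTensor H (z * w)) =
      r • LinearMap.mul' K H ((opLinear S).lTensor H z) := by
  induction z using TensorProduct.induction_on with
  | zero => simp
  | add x y hx hy => rw [add_mul, map_add, map_add, hx, hy, map_add, map_add, smul_add]
  | tmul c d =>
    have key : ∀ w : H ⊗[K] H, LinearMap.mul' K H ((opLinear S).lTensor H (c ⊗ₜ d * w)) =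
        c * LinearMap.mul' K H ((opLinear S).lTensor H w) * opLinear S d := by
      intro w
      induction w using TensorProduct.induction_on with
      | zero => simp
      | add x y hx hy => rw [mul_add, map_add, map_add, hx, hy, map_add, map_add, mul_add, add_mul]
      | tmul a b => simp [opLinear_mul, mul_assoc]
    rw [key, hw, ← Algebra.commutes, mul_assoc, ← Algebra.smul_def]
    simp

/-- The Hopf algebra axioms hold as soon as they hold on generators. -/
theorem isHopf_of_generators {ι : Type*} {g : ι → H} (hg : Algebra.adjoin K (Set.range g) = ⊤)
    (Δ : H →ₐ[K] H ⊗[K] H) (ε : H →ₐ[K] K) (S : H →ₐ[K] Hᵐᵒᵖ)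
    (coassoc : ∀ i, Algebra.TensorProduct.assoc K K K H H H
      (Algebra.TensorProduct.map Δ (AlgHom.id K H) (Δ (g i))) =
        Algebra.TensorProduct.map (AlgHom.id K H) Δ (Δ (g i)))
    (rcounit : ∀ i, Algebra.TensorProduct.map ε (AlgHom.id K H) (Δ (g i)) = 1 ⊗ₜ[K] g i)
    (lcounit : ∀ i, Algebra.TensorProduct.map (AlgHom.id K H) ε (Δ (g i)) = g i ⊗ₜ[K] 1)
    (left : ∀ i, LinearMap.mul' K H ((opLinear S).rTensor H (Δ (g i))) = algebraMap K H (ε (g i)))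
    (right : ∀ i,
      LinearMap.mul' K H ((opLinear S).lTensor H (Δ (g i))) = algebraMap K H (ε (g i))) :
    IsHopf Δ ε (opLinear S) where
  coassoc := by
    refine AlgHom.ext_of_adjoin_eq_top hg ?_
    rintro _ ⟨i, rfl⟩
    exact coassoc i
  rTensor_counit x := by
    refine induction_of_adjoin hg (p := fun x =>
      Algebra.TensorProduct.map ε (AlgHom.id K H) (Δ x) = 1 ⊗ₜ[K] x) ?_ ?_ ?_ ?_ x
    · simp [Algebra.TensorProduct.one_def]
    · intro a b ha hb
      rw [map_add, map_add, ha, hb, TensorProduct.tmul_add]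
    · intro r a ha
      rw [map_smul, map_smul, ha, TensorProduct.tmul_smul]
    · intro i a ha
      rw [map_mul, map_mul, ha, rcounit, Algebra.TensorProduct.tmul_mul_tmul, one_mul]
  lTensor_counit x := by
    refine induction_of_adjoin hg (p := fun x =>
      Algebra.TensorProduct.map (AlgHom.id K H) ε (Δ x) = x ⊗ₜ[K] 1) ?_ ?_ ?_ ?_ x
    · simp [Algebra.TensorProduct.one_def]
    · intro a b ha hb
      rw [map_add, map_add, ha, hb, TensorProduct.add_tmul]
    · intro r a ha
      rw [map_smul, map_smul, ha, TensorProduct.smul_tmul']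
    · intro i a ha
      rw [map_mul, map_mul, ha, lcounit, Algebra.TensorProduct.tmul_mul_tmul, one_mul]
  antipode_left x := by
    refine induction_of_adjoin hg (p := fun x =>
      LinearMap.mul' K H ((opLinear S).rTensor H (Δ x)) = algebraMap K H (ε x)) ?_ ?_ ?_ ?_ x
    · simp [Algebra.TensorProduct.one_def, opLinear_apply]
    · intro a b ha hb
      rw [map_add, map_add, map_add, ha, hb, map_add, map_add]
    · intro r a ha
      rw [map_smul, map_smul, map_smul, ha, map_smul, smul_eq_mul, map_mul, Algebra.smul_def]
    · intro i a ha
      rw [map_mul, antipode_left_mul S (left i), ha, map_mul, map_mul, Algebra.smul_def]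
  antipode_right x := by
    refine induction_of_adjoin hg (p := fun x =>
      LinearMap.mul' K H ((opLinear S).lTensor H (Δ x)) = algebraMap K H (ε x)) ?_ ?_ ?_ ?_ x
    · simp [Algebra.TensorProduct.one_def, opLinear_apply]
    · intro a b ha hb
      rw [map_add, map_add, map_add, ha, hb, map_add, map_add]
    · intro r a ha
      rw [map_smul, map_smul, map_smul, ha, map_smul, smul_eq_mul, map_mul, Algebra.smul_def]
    · intro i a ha
      rw [map_mul, antipode_right_mul S ha, right, map_mul, map_mul, Algebra.smul_def,
        Algebra.commutes]

end HopfStructure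

/-! ### The Hopf algebra structure of the quantum group -/

section FunHopf

variable {K : Type*} [Field K] {q : K} {M N : ℕ} {H : Type*} [Ring H] [Algebra K H]

theorem isHopf_of_funRelations {g : FunGen M N → H} (hg : Algebra.adjoin K (Set.range g) = ⊤)
    (h : FunRelations q g) {V : Matrix (Fin M) (Fin M) H} {W : Matrix (Fin N) (Fin N) H}
    (hVW : BlockInverses g V W) {Δ : H →ₐ[K] H ⊗[K] H} (hΔ : ∀ i, Δ (g i) = comulGen K g i)
    {ε : H →ₐ[K] K} (hε : ∀ i, ε (g i) = counitGen K M N i) {S : H →ₐ[K] Hᵐᵒᵖ}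
    (hS : ∀ i, S (g i) = antipodeGen g V W i) : IsHopf Δ ε (opLinear S) := by
  have e1 : ∀ α β, ∑ γ, g (.gl α γ) * V γ β = if α = β then 1 else 0 := fun α β => by
    rw [← Matrix.one_apply, ← hVW.gl_mul]; rfl
  have e2 : ∀ α β, ∑ γ, V α γ * g (.gl γ β) = if α = β then 1 else 0 := fun α β => by
    rw [← Matrix.one_apply, ← hVW.mul_gl]; rfl
  have e3 : ∀ α β, ∑ γ, g (.sl α γ) * W γ β = if α = β then 1 else 0 := fun α β => by
    rw [← Matrix.one_apply, ← hVW.sl_mul]; rfl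
  have e4 : ∀ α β, ∑ γ, W α γ * g (.sl γ β) = if α = β then 1 else 0 := fun α β => by
    rw [← Matrix.one_apply, ← hVW.mul_sl]; rfl
  refine isHopf_of_generators hg Δ ε S (fun i => ?_) (fun i => ?_) (fun i => ?_) (fun i => ?_)
    fun i => ?_
  · rcases i with ⟨α, β⟩ | _ | _ | ⟨a, b⟩
    · simp only [hΔ, comulGen, map_sum, Algebra.TensorProduct.map_tmul, AlgHom.id_apply,
        TensorProduct.sum_tmul, TensorProduct.tmul_sum, Algebra.TensorProduct.assoc_tmul]
      exact Finset.sum_comm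
    · simp only [hΔ, comulGen, Algebra.TensorProduct.map_tmul, AlgHom.id_apply,
        Algebra.TensorProduct.assoc_tmul]
    · simp only [hΔ, comulGen, Algebra.TensorProduct.map_tmul, AlgHom.id_apply,
        Algebra.TensorProduct.assoc_tmul]
    · simp only [hΔ, comulGen, map_sum, Algebra.TensorProduct.map_tmul, AlgHom.id_apply,
        TensorProduct.sum_tmul, TensorProduct.tmul_sum, Algebra.TensorProduct.assoc_tmul]
      exact Finset.sum_comm
  · rcases i with ⟨α, β⟩ | _ | _ | ⟨a, b⟩ <;>
      simp [hΔ, comulGen, hε, counitGen, TensorProduct.ite_tmul]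
  · rcases i with ⟨α, β⟩ | _ | _ | ⟨a, b⟩ <;>
      simp [hΔ, comulGen, hε, counitGen, TensorProduct.tmul_ite]
  · rcases i with ⟨α, β⟩ | _ | _ | ⟨a, b⟩ <;>
      simp [hΔ, comulGen, hε, counitGen, opLinear_apply, hS, antipodeGen, e2, e4, h.tinv_t,
        h.t_tinv, apply_ite (algebraMap K H)]
  · rcases i with ⟨α, β⟩ | _ | _ | ⟨a, b⟩ <;>
      simp [hΔ, comulGen, hε, counitGen, opLinear_apply, hS, antipodeGen, e1, e3, h.tinv_t,
        h.t_tinv, apply_ite (algebraMap K H)]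

end FunHopf

/-! ### Heisenberg relations under the coaction -/

section Covariance

variable {K : Type*} [Field K] {I : Type} [Fintype I] [DecidableEq I]
  {H : Type*} [Ring H] [Algebra K H] {B : Type*} [Ring B] [Algebra K B]

/-- Images of the generators of a Heisenberg algebra under a coaction. -/
def coactGen (K : Type*) [Field K] {I : Type} [Fintype I] {H : Type*} [Ring H] [Algebra K H]
    {B : Type*} [Ring B] [Algebra K B] (g : HGen I → B) (T U : Matrix I I H) : HGen I → B ⊗[K] H
  | .cr a => ∑ b, g (.cr b) ⊗ₜ T b a
  | .an a => ∑ b, g (.an b) ⊗ₜ U a b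

theorem sum_tmul_mul_sum_tmul {J : Type*} [Fintype J] (x y : J → B) (u v : J → H) :
    (∑ a, x a ⊗ₜ[K] u a) * (∑ b, y b ⊗ₜ[K] v b) =
      ∑ p : J × J, ((x p.1 * y p.2) ⊗ₜ[K] (1 : H)) * ((1 : B) ⊗ₜ[K] (u p.1 * v p.2)) := by
  simp only [Finset.sum_mul_sum, Fintype.sum_prod_type, Algebra.TensorProduct.tmul_mul_tmul,
    one_mul, mul_one]

theorem sum_pair_comm {J V : Type*} [Fintype J] [AddCommMonoid V] (F : J → J → J → J → V) :
    ∑ a, ∑ b, ∑ c, ∑ d, F a b c d = ∑ c, ∑ d, ∑ a, ∑ b, F a b c d := by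
  calc _ = ∑ p : J × J, ∑ r : J × J, F p.1 p.2 r.1 r.2 := by simp only [Fintype.sum_prod_type]
    _ = _ := by
        rw [Finset.sum_comm]
        simp only [Fintype.sum_prod_type]

theorem sum_rotate {J V : Type*} [Fintype J] [AddCommMonoid V] (F : J → J → J → J → V) :
    ∑ a, ∑ b, ∑ c, ∑ d, F a b c d = ∑ d, ∑ a, ∑ b, ∑ c, F a b c d := by
  calc _ = ∑ p : J × J × J, ∑ d, F p.1 p.2.1 p.2.2 d := by simp only [Fintype.sum_prod_type]
    _ = _ := by
        rw [Finset.sum_comm]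
        simp only [Fintype.sum_prod_type]

/-- The quadratic relations survive because `P` intertwines $T_1T_2$ and, in the opposite algebra,
$U_1U_2$; the constant term survives by $UT=1$. -/
theorem HeisRelations.coactGen {P S : Matrix (I × I) (I × I) K} {g : HGen I → B}
    (hg : HeisRelations P S g) {T U : Matrix I I H} (hP : IsRTT P T) (hS : IsRTT S T)
    (hTU : T * U = 1) (hUT : U * T = 1) : HeisRelations P S (coactGen K g T U) := by
  have hPU := hP.op_inverse hTU hUT
  have e1 : ∀ i j, ∑ k, T i k * U k j = if i = j then 1 else 0 := fun i j => by
    rw [← Matrix.mul_apply, hTU, Matrix.one_apply]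
  have e2 : ∀ i j, ∑ k, U i k * T k j = if i = j then 1 else 0 := fun i j => by
    rw [← Matrix.mul_apply, hUT, Matrix.one_apply]
  refine ⟨fun a b => ?_, fun a b => ?_, fun a b => ?_⟩
  · have := sum_smul_sum_mul_of_intertwine (E := B ⊗[K] H) (R := P) (c := 0)
      (X := fun p => (g (.cr p.1) * g (.cr p.2)) ⊗ₜ[K] (1 : H))
      (W := fun p r => (1 : B) ⊗ₜ[K] (T p.1 r.1 * T p.2 r.2)) (fun L => ?_) (fun p r => ?_) (a, b)
    · rw [zero_smul, Fintype.sum_prod_type] at this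
      simpa only [QHeis.coactGen, sum_tmul_mul_sum_tmul] using this
    · simp only [TensorProduct.smul_tmul', ← TensorProduct.sum_tmul, Fintype.sum_prod_type]
      rw [hg.cr_cr L.1 L.2, TensorProduct.zero_tmul, zero_smul,
        TensorProduct.zero_tmul]
    · simp only [← TensorProduct.tmul_smul, ← TensorProduct.tmul_sum, Fintype.sum_prod_type]
      rw [hP p.1 p.2 r.1 r.2]
  · have := sum_smul_sum_mul_of_intertwine (E := B ⊗[K] H) (R := P.transpose) (c := 0)
      (X := fun p => (g (.an p.2) * g (.an p.1)) ⊗ₜ[K] (1 : H))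
      (W := fun p r => (1 : B) ⊗ₜ[K] (U r.2 p.2 * U r.1 p.1)) (fun L => ?_) (fun p r => ?_) (a, b)
    · rw [zero_smul, Fintype.sum_prod_type] at this
      rw [← this]
      refine Finset.sum_congr rfl fun c _ => Finset.sum_congr rfl fun d _ => ?_
      rw [QHeis.coactGen, QHeis.coactGen, sum_tmul_mul_sum_tmul, ← (Equiv.prodComm I I).sum_comp]
      rfl
    · simp only [TensorProduct.smul_tmul', ← TensorProduct.sum_tmul, Fintype.sum_prod_type,
        Matrix.transpose_apply]
      rw [hg.an_an L.1 L.2, TensorProduct.zero_tmul, zero_smul,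
        TensorProduct.zero_tmul]
    · simp only [← TensorProduct.tmul_smul, ← TensorProduct.tmul_sum, Fintype.sum_prod_type,
        Matrix.transpose_apply]
      have h1 := congrArg MulOpposite.unop (hPU r.1 r.2 p.1 p.2)
      simp only [Finset.unop_sum, MulOpposite.unop_smul, MulOpposite.unop_mul, Matrix.map_apply,
        MulOpposite.unop_op] at h1
      rw [h1]
  -- This is RTT for `S` multiplied by `U` on the left in one leg and on the right in the other,
  -- which mixes `T` with its inverse as the exchange relation requires.
  · have key : ∀ c d, ∑ e, ∑ f, S (e, c) (f, d) • (U a e * T f b) =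
        ∑ e, ∑ f, S (a, e) (b, f) • (T c e * U f d) := by
      intro c d
      have h1 : ∀ m, ∑ e, ∑ h, ∑ k, S (e, c) (h, k) • (U a e * (T h b * T k m)) =
          ∑ k, S (a, k) (b, m) • T c k := by
        intro m
        calc _ = ∑ e, U a e * ∑ h, ∑ k, S (e, c) (h, k) • (T h b * T k m) := by
              simp only [Finset.mul_sum, mul_smul_comm]
          _ = ∑ h, (∑ e, U a e * T e h) * ∑ k, S (h, k) (b, m) • T c k := by
              simp only [hS _ c b m, Finset.mul_sum, Finset.sum_mul, Finset.smul_sum, mul_smul_comm,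
                mul_assoc]
              rw [Finset.sum_comm]
              exact Finset.sum_congr rfl fun _ _ => Finset.sum_comm
          _ = _ := by simp [e2]
      calc _ = ∑ e, ∑ h, ∑ k, S (e, c) (h, k) • (U a e * (T h b * ∑ m, T k m * U m d)) := by
            simp [e1]
        _ = ∑ m, (∑ e, ∑ h, ∑ k, S (e, c) (h, k) • (U a e * (T h b * T k m))) * U m d := by
            simp only [Finset.mul_sum, Finset.smul_sum, Finset.sum_mul, smul_mul_assoc, mul_assoc]
            exact sum_rotate _
        _ = _ := by
            simp only [h1, Finset.sum_mul, smul_mul_assoc]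
            exact Finset.sum_comm
    have hl : QHeis.coactGen K g T U (.an a) * QHeis.coactGen K g T U (.cr b) =
        ∑ e, ∑ f, (g (.an e) * g (.cr f)) ⊗ₜ[K] (U a e * T f b) := by
      simp only [QHeis.coactGen, Finset.sum_mul_sum, Algebra.TensorProduct.tmul_mul_tmul]
    have hr : ∀ c d, QHeis.coactGen K g T U (.cr c) * QHeis.coactGen K g T U (.an d) =
        ∑ e, ∑ f, (g (.cr e) * g (.an f)) ⊗ₜ[K] (T e c * U d f) := by
      intro c d
      simp only [QHeis.coactGen, Finset.sum_mul_sum, Algebra.TensorProduct.tmul_mul_tmul]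
    simp only [hl, hr, hg.an_cr, TensorProduct.add_tmul, Finset.sum_add_distrib]
    congr 1
    · simp only [TensorProduct.ite_tmul, Finset.sum_ite_eq, Finset.mem_univ, if_true,
        ← TensorProduct.tmul_sum, e2]
      split_ifs
      · rfl
      · simp
    · simp only [TensorProduct.sum_tmul, ← TensorProduct.smul_tmul', ← TensorProduct.tmul_smul]
      calc _ = ∑ c, ∑ d, (g (.cr c) * g (.an d)) ⊗ₜ[K]
            ∑ e, ∑ f, S (e, c) (f, d) • (U a e * T f b) := by
            simp only [TensorProduct.tmul_sum]
            exact sum_pair_comm _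
        _ = _ := by
            simp only [key, TensorProduct.tmul_sum, TensorProduct.tmul_smul, Finset.smul_sum]
            exact sum_pair_comm _

end Covariance

/-! ### The coaction axioms -/

section Coaction

variable {K : Type*} [Field K] {I : Type} [Fintype I] [DecidableEq I]
  {H : Type*} [Ring H] [Algebra K H] {B : Type*} [Ring B] [Algebra K B]

/-- Both sides are entries of the inverse of the matrix $\Delta(T)$; inverting the product of the
two copies of `T` reverses the tensor factors. -/
theorem comul_inverse_entry {T U : Matrix I I H} (hTU : T * U = 1) (hUT : U * T = 1)
    {Δ : H →ₐ[K] H ⊗[K] H} (hΔ : ∀ i j, Δ (T i j) = ∑ k, T i k ⊗ₜ T k j) (i j : I) :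
    Δ (U i j) = ∑ k, U k j ⊗ₜ U i k := by
  let l : H →ₐ[K] H ⊗[K] H := Algebra.TensorProduct.includeLeft
  let r : H →ₐ[K] H ⊗[K] H := Algebra.TensorProduct.includeRight
  have hmap : ∀ (f : H →ₐ[K] H ⊗[K] H) {X Y : Matrix I I H}, X * Y = 1 →
      X.map f * Y.map f = 1 := fun f X Y h => by
    rw [← Matrix.map_mul, h, Matrix.map_one f (map_zero f) (map_one f)]
  have h1 : T.map Δ = T.map l * T.map r := by
    ext i j
    simp [hΔ, Matrix.mul_apply, l, r]
  have h2 : T.map Δ * (U.map r * U.map l) = 1 := by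
    rw [h1, mul_assoc, ← mul_assoc (T.map r), hmap r hTU, one_mul, hmap l hTU]
  have h4 : U.map Δ = U.map r * U.map l := left_inv_eq_right_inv (hmap Δ hUT) h2
  have h3 := congrFun₂ h4 i j
  simpa [Matrix.mul_apply, l, r] using h3

theorem counit_inverse_entry {T U : Matrix I I H} (hUT : U * T = 1) {ε : H →ₐ[K] K}
    (hε : ∀ i j, ε (T i j) = if i = j then 1 else 0) (i j : I) :
    ε (U i j) = if i = j then 1 else 0 := by
  have h1 : T.map ε = 1 := by
    ext i j
    simp [hε, Matrix.one_apply]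
  have h2 : U.map ε = 1 := by
    calc _ = U.map ε * T.map ε := by rw [h1, mul_one]
      _ = 1 := by rw [← Matrix.map_mul, hUT, Matrix.map_one ε (map_zero ε) (map_one ε)]
  rw [← Matrix.one_apply, ← h2, Matrix.map_apply]

theorem isCoaction_of_generators {g : HGen I → B} (hg : Algebra.adjoin K (Set.range g) = ⊤)
    {T U : Matrix I I H} (hTU : T * U = 1) (hUT : U * T = 1)
    {Δ : H →ₐ[K] H ⊗[K] H} (hΔ : ∀ i j, Δ (T i j) = ∑ k, T i k ⊗ₜ T k j)
    {ε : H →ₐ[K] K} (hε : ∀ i j, ε (T i j) = if i = j then 1 else 0)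
    {φ : B →ₐ[K] B ⊗[K] H} (hφ : ∀ i, φ (g i) = coactGen K g T U i) : IsCoaction Δ ε φ where
  coassoc := by
    refine AlgHom.ext_of_adjoin_eq_top hg ?_
    rintro _ ⟨i, rfl⟩
    change Algebra.TensorProduct.assoc K K K B H H
      (Algebra.TensorProduct.map φ (AlgHom.id K H) (φ (g i))) =
        Algebra.TensorProduct.map (AlgHom.id K B) Δ (φ (g i))
    rcases i with a | a
    · simp only [hφ, coactGen, map_sum, Algebra.TensorProduct.map_tmul, AlgHom.id_apply, hΔ,
        TensorProduct.sum_tmul, TensorProduct.tmul_sum, Algebra.TensorProduct.assoc_tmul]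
      exact Finset.sum_comm
    · simp only [hφ, coactGen, map_sum, Algebra.TensorProduct.map_tmul, AlgHom.id_apply,
        comul_inverse_entry hTU hUT hΔ, TensorProduct.sum_tmul, TensorProduct.tmul_sum,
        Algebra.TensorProduct.assoc_tmul]
      exact Finset.sum_comm
  counit x := by
    refine induction_of_adjoin hg (p := fun x =>
      Algebra.TensorProduct.map (AlgHom.id K B) ε (φ x) = x ⊗ₜ[K] 1) ?_ ?_ ?_ ?_ x
    · simp [Algebra.TensorProduct.one_def]
    · intro a b ha hb
      rw [map_add, map_add, ha, hb, TensorProduct.add_tmul]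
    · intro r a ha
      rw [map_smul, map_smul, ha, TensorProduct.smul_tmul']
    · intro i a ha
      rw [map_mul, map_mul, ha]
      have : Algebra.TensorProduct.map (AlgHom.id K B) ε (φ (g i)) = g i ⊗ₜ[K] 1 := by
        rcases i with a | a <;>
          simp [hφ, coactGen, hε, counit_inverse_entry hUT hε, TensorProduct.tmul_ite]
      rw [this, Algebra.TensorProduct.tmul_mul_tmul, one_mul]

end Coaction

/-! ### Collective generators and covariance of both algebras -/

section Collective

variable {K : Type*} [Field K] {q : K} {M N : ℕ} {H : Type*} [Ring H] [Algebra K H]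

/-- The collective generators `T^A_B = T^α_β T^a_b`. -/
def collective (g : FunGen M N → H) : Matrix (Idx M N) (Idx M N) H :=
  Matrix.of fun A B => glBlock g A.1 B.1 * slBlock g A.2 B.2

/-- The inverse of the matrix of collective generators. -/
def collectiveInv (V : Matrix (Fin M) (Fin M) H) (W : Matrix (Fin N) (Fin N) H) :
    Matrix (Idx M N) (Idx M N) H :=
  Matrix.of fun A B => W A.2 B.2 * V A.1 B.1

theorem collective_mul_inv {g : FunGen M N → H} {V : Matrix (Fin M) (Fin M) H}
    {W : Matrix (Fin N) (Fin N) H} (hVW : BlockInverses g V W) :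
    collective g * collectiveInv V W = 1 := by
  have e1 : ∀ α β, ∑ γ, glBlock g α γ * V γ β = if α = β then 1 else 0 := fun α β => by
    rw [← Matrix.mul_apply, hVW.gl_mul, Matrix.one_apply]
  have e3 : ∀ α β, ∑ γ, slBlock g α γ * W γ β = if α = β then 1 else 0 := fun α β => by
    rw [← Matrix.mul_apply, hVW.sl_mul, Matrix.one_apply]
  ext ⟨α, a⟩ ⟨β, b⟩
  simp only [Matrix.mul_apply, collective, collectiveInv, Matrix.of_apply, Fintype.sum_prod_type]
  calc _ = ∑ γ, glBlock g α γ * (∑ c, slBlock g a c * W c b) * V γ β := by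
        simp only [Finset.mul_sum, Finset.sum_mul, mul_assoc]
    _ = _ := by
        rw [e3]
        by_cases h : a = b
        · simp [h, e1, Matrix.one_apply]
        · simp [h]

theorem collectiveInv_mul {g : FunGen M N → H} {V : Matrix (Fin M) (Fin M) H}
    {W : Matrix (Fin N) (Fin N) H} (hVW : BlockInverses g V W) :
    collectiveInv V W * collective g = 1 := by
  have e2 : ∀ α β, ∑ γ, V α γ * glBlock g γ β = if α = β then 1 else 0 := fun α β => by
    rw [← Matrix.mul_apply, hVW.mul_gl, Matrix.one_apply]
  have e4 : ∀ α β, ∑ γ, W α γ * slBlock g γ β = if α = β then 1 else 0 := fun α β => by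
    rw [← Matrix.mul_apply, hVW.mul_sl, Matrix.one_apply]
  ext ⟨α, a⟩ ⟨β, b⟩
  simp only [Matrix.mul_apply, collective, collectiveInv, Matrix.of_apply, Fintype.sum_prod_type]
  rw [Finset.sum_comm]
  calc _ = ∑ c, W a c * (∑ γ, V α γ * glBlock g γ β) * slBlock g c b := by
        simp only [Finset.mul_sum, Finset.sum_mul, mul_assoc]
    _ = _ := by
        rw [e2]
        by_cases h : α = β
        · simp [h, e4, Matrix.one_apply]
        · simp [h]

theorem comul_collective {g : FunGen M N → H} {Δ : H →ₐ[K] H ⊗[K] H}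
    (hΔ : ∀ i, Δ (g i) = comulGen K g i) (A B : Idx M N) :
    Δ (collective g A B) = ∑ C, collective g A C ⊗ₜ collective g C B := by
  simp only [collective, glBlock, slBlock, Matrix.of_apply, map_mul, hΔ, comulGen,
    Finset.sum_mul_sum, Fintype.sum_prod_type, Algebra.TensorProduct.tmul_mul_tmul]

theorem counit_collective {g : FunGen M N → H} {ε : H →ₐ[K] K}
    (hε : ∀ i, ε (g i) = counitGen K M N i) (A B : Idx M N) :
    ε (collective g A B) = if A = B then 1 else 0 := by
  rcases A with ⟨α, a⟩
  rcases B with ⟨β, b⟩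
  simp only [collective, glBlock, slBlock, Matrix.of_apply, map_mul, hε, counitGen, Prod.mk.injEq]
  by_cases h : α = β <;> simp [h]

theorem FunRelations.isRTT_tens {g : FunGen M N → H} (h : FunRelations q g)
    {X : Matrix (Fin M × Fin M) (Fin M × Fin M) K} {Y : Matrix (Fin N × Fin N) (Fin N × Fin N) K}
    (hX : IsRTT X (glBlock g)) (hY : IsRTT Y (slBlock g)) : IsRTT (tens X Y) (collective g) :=
  hX.tens hY h.comm

theorem IsRTT.pS {n : ℕ} {T : Matrix (Fin n) (Fin n) H} (h : IsRTT (Rhat q n) T) :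
    IsRTT (PS q n) T := (h.add ((IsRTT.one T).smul _)).smul _

theorem IsRTT.pA {n : ℕ} {T : Matrix (Fin n) (Fin n) H} (h : IsRTT (Rhat q n) T) :
    IsRTT (PA q n) T := (((IsRTT.one T).smul _).sub h).smul _

theorem FunRelations.isRTT_PMinus {g : FunGen M N → H} (h : FunRelations q g) :
    IsRTT (PMinus q M N) (collective g) :=
  (h.isRTT_tens h.gl.pS h.sl.pA).add (h.isRTT_tens h.gl.pA h.sl.pS)

theorem FunRelations.isRTT_PPlus {g : FunGen M N → H} (h : FunRelations q g) :
    IsRTT (PPlus q M N) (collective g) :=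
  (h.isRTT_tens h.gl.pA h.sl.pA).add (h.isRTT_tens h.gl.pS h.sl.pS)

theorem FunRelations.isRTT_neg_RMinus (hq : q ≠ 0) {g : FunGen M N → H} (h : FunRelations q g) :
    IsRTT (-RMinus q M N) (collective g) := by
  have h1 : IsRTT (Rhat q M)⁻¹ (glBlock g) := by
    rw [Rhat_inv hq]
    exact h.gl.sub ((IsRTT.one _).smul _)
  rw [← neg_one_smul K]
  exact (h.isRTT_tens h1 h.sl).smul _

theorem isCovariant_of_isRTT {V : Matrix (Fin M) (Fin M) (FunAlg q M N)}
    {W : Matrix (Fin N) (Fin N) (FunAlg q M N)} (hVW : BlockInverses (FunAlg.gen q M N) V W)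
    {Δ : FunAlg q M N →ₐ[K] FunAlg q M N ⊗[K] FunAlg q M N}
    (hΔ : ∀ i, Δ (FunAlg.gen q M N i) = comulGen K (FunAlg.gen q M N) i)
    {ε : FunAlg q M N →ₐ[K] K} (hε : ∀ i, ε (FunAlg.gen q M N i) = counitGen K M N i)
    {S : FunAlg q M N →ₐ[K] (FunAlg q M N)ᵐᵒᵖ}
    (hS : ∀ i, S (FunAlg.gen q M N i) = antipodeGen (FunAlg.gen q M N) V W i)
    {P R : Matrix (Idx M N × Idx M N) (Idx M N × Idx M N) K}
    (hP : IsRTT P (collective (FunAlg.gen q M N))) (hR : IsRTT R (collective (FunAlg.gen q M N))) :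
    IsCovariant q M N Δ ε (opLinear S) P R := by
  obtain ⟨φ, hφ⟩ := Heis.exists_lift P R _ ((Heis.relations P R).coactGen hP hR
    (collective_mul_inv hVW) (collectiveInv_mul hVW))
  refine ⟨φ, isCoaction_of_generators (Heis.adjoin_gen P R) (collective_mul_inv hVW)
    (collectiveInv_mul hVW) (comul_collective hΔ) (counit_collective hε) hφ, fun A => hφ _,
    fun A => (hφ _).trans ?_⟩
  refine Finset.sum_congr rfl fun B _ => ?_
  -- The antipode reverses the product $T^\alpha_\beta T^a_b$, which is why `collectiveInv` has the
  -- `SL` factor first.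
  have : opLinear S (FunAlg.T q M N A B) = collectiveInv V W A B := by
    rw [FunAlg.T, opLinear_mul, opLinear_apply, opLinear_apply, hS, hS]
    rfl
  rw [this]

theorem exists_hopf_covariant (hq : q ≠ 0) (hq2 : q ^ 2 ≠ -1) (M N : ℕ) :
    ∃ (Δ : FunAlg q M N →ₐ[K] FunAlg q M N ⊗[K] FunAlg q M N) (ε : FunAlg q M N →ₐ[K] K)
        (S : FunAlg q M N →ₗ[K] FunAlg q M N),
      IsHopf Δ ε S ∧
      (∀ α β, Δ (FunAlg.gen q M N (.gl α β)) =
        ∑ γ, FunAlg.gen q M N (.gl α γ) ⊗ₜ[K] FunAlg.gen q M N (.gl γ β)) ∧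
      (∀ a b, Δ (FunAlg.gen q M N (.sl a b)) =
        ∑ c, FunAlg.gen q M N (.sl a c) ⊗ₜ[K] FunAlg.gen q M N (.sl c b)) ∧
      (∀ α β, ε (FunAlg.gen q M N (.gl α β)) = if α = β then 1 else 0) ∧
      (∀ a b, ε (FunAlg.gen q M N (.sl a b)) = if a = b then 1 else 0) ∧
      IsCovariant q M N Δ ε S (PMinus q M N) (RPlus q M N) ∧
      IsCovariant q M N Δ ε S (PPlus q M N) (-RMinus q M N) := by
  have h := FunAlg.relations q M N
  obtain ⟨V, W, hVW⟩ := h.exists_blockInverses hq hq2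
  obtain ⟨Δ, hΔ⟩ := FunAlg.exists_lift q M N _ (h.comulGen hq hq2)
  obtain ⟨ε, hε⟩ := FunAlg.exists_lift q M N _ (funRelations_counitGen hq)
  obtain ⟨S, hS⟩ := FunAlg.exists_lift q M N _ (h.antipodeGen hq hq2 hVW)
  exact ⟨Δ, ε, opLinear S, isHopf_of_funRelations (FunAlg.adjoin_gen q M N) h hVW hΔ hε hS,
    fun α β => hΔ _, fun a b => hΔ _, fun α β => hε _, fun a b => hε _,
    isCovariant_of_isRTT hVW hΔ hε hS h.isRTT_PMinus (h.isRTT_tens h.gl h.sl),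
    isCovariant_of_isRTT hVW hΔ hε hS h.isRTT_PPlus (h.isRTT_neg_RMinus hq)⟩

end Collective

end QHeis

theorem mainTheorem2 {K : Type*} [Field K] [CharZero K] (q : K) (hq : q ≠ 0) (hq2 : q ^ 2 ≠ -1)
    (M N : ℕ) (hM : 1 ≤ M) (hN : 1 ≤ N) :
    -- the projector decompositions of the two braid matrices
    (QHeis.IsProjectorTriple (QHeis.PMinus q M N)
        (QHeis.tens (QHeis.PS q M) (QHeis.PS q N)) (QHeis.tens (QHeis.PA q M) (QHeis.PA q N)) ∧
      QHeis.RPlus q M N = -QHeis.PMinus q M N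
        + q ^ 2 • QHeis.tens (QHeis.PS q M) (QHeis.PS q N)
        + (q ^ 2)⁻¹ • QHeis.tens (QHeis.PA q M) (QHeis.PA q N)) ∧
    (QHeis.IsProjectorTriple (QHeis.PPlus q M N)
        (QHeis.tens (QHeis.PA q M) (QHeis.PS q N)) (QHeis.tens (QHeis.PS q M) (QHeis.PA q N)) ∧
      QHeis.RMinus q M N = QHeis.PPlus q M N
        - q ^ 2 • QHeis.tens (QHeis.PA q M) (QHeis.PS q N)
        - (q ^ 2)⁻¹ • QHeis.tens (QHeis.PS q M) (QHeis.PA q N)) ∧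
    -- covariance under the Hopf algebra `Fun(GL_q(M) × SL_q(N))`
    (∃ (Δ : QHeis.FunAlg q M N →ₐ[K] QHeis.FunAlg q M N ⊗[K] QHeis.FunAlg q M N)
        (ε : QHeis.FunAlg q M N →ₐ[K] K)
        (S : QHeis.FunAlg q M N →ₗ[K] QHeis.FunAlg q M N),
      QHeis.IsHopf Δ ε S ∧
      (∀ α β, Δ (QHeis.FunAlg.gen q M N (.gl α β)) =
        ∑ γ, QHeis.FunAlg.gen q M N (.gl α γ) ⊗ₜ[K] QHeis.FunAlg.gen q M N (.gl γ β)) ∧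
      (∀ a b, Δ (QHeis.FunAlg.gen q M N (.sl a b)) =
        ∑ c, QHeis.FunAlg.gen q M N (.sl a c) ⊗ₜ[K] QHeis.FunAlg.gen q M N (.sl c b)) ∧
      (∀ α β, ε (QHeis.FunAlg.gen q M N (.gl α β)) = if α = β then 1 else 0) ∧
      (∀ a b, ε (QHeis.FunAlg.gen q M N (.sl a b)) = if a = b then 1 else 0) ∧
      QHeis.IsCovariant q M N Δ ε S (QHeis.PMinus q M N) (QHeis.RPlus q M N) ∧
      QHeis.IsCovariant q M N Δ ε S (QHeis.PPlus q M N) (-QHeis.RMinus q M N)) ∧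
    -- the Poincaré series agree with those of the classical Weyl and Clifford algebras
    QHeis.poincareSeries K
        (QHeis.Heis.gen (QHeis.PMinus q M N) (QHeis.RPlus q M N) : _ → QHeis.QWeyl q M N) =
      QHeis.poincareSeries K (QHeis.Classical.gen (QHeis.Idx M N) (1 : K)) ∧
    QHeis.poincareSeries K
        (QHeis.Heis.gen (QHeis.PPlus q M N) (-QHeis.RMinus q M N) : _ → QHeis.QClifford q M N) =
      QHeis.poincareSeries K (QHeis.Classical.gen (QHeis.Idx M N) (-1 : K)) := by
  exact ⟨⟨QHeis.isProjectorTriple_PMinus hq hq2 M N, QHeis.RPlus_eq hq hq2 M N⟩,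
    ⟨QHeis.isProjectorTriple_PPlus hq hq2 M N, QHeis.RMinus_eq hq hq2 M N⟩,
    QHeis.exists_hopf_covariant hq hq2 M N, QHeis.poincareSeries_qWeyl hq hq2 M N,
    QHeis.poincareSeries_qClifford hq hq2 M N⟩
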